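/- **Proposition** ($\mathcal P_{h+1}=\mathrm{Hig}(U_qsl(2))$). Let $h\ge 1$, $l=2h+1$, and let $q\in\mathbb C$ be a primitive $l$-th root of unity; write $[n]=\frac{q^n-q^{-n}}{q-q^{-1}}$ and $[m]!=[1]\cdots[m]$. Let $U=U_qsl(2)$ be the complex Hopf algebra generated by $E,F,K$ with relations $E^l=F^l=0$, $K^l=1$, $KE=q^2EK$, $KF=q^{-2}FK$, $EF-FE=\frac{K-K^{-1}}{q-q^{-1}}$ and structure maps $$\Delta(E)=1\otimes E+E\otimes K,\quad \Delta(F)=K^{-1}\otimes F+F\otimes 1,\quad \Delta(K)=K\otimes K,$$ $$\epsilon(E)=\epsilon(F)=0,\ \epsilon(K)=1,\qquad S(E)=-EK^{-1},\ S(F)=-KF,\ S(K)=K^{-1}.$$ Put $$R=\frac1l\sum_{0\le m,i,j\le l-1}\frac{(q-q^{-1})^m}{[m]!}\,q^{\frac{m(m-1)}2+2m(i-j)-2ij}\,E^mK^i\otimes F^mK^j,\quad Q=R_{21}R,\quad \Lambda=\frac{\sqrt l}{([l-1]!)^2}F^{l-1}E^{l-1}\sum_{j=0}^{l-1}K^j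 .$$ For $1\le r\le l$ let $V_r$ be the simple module with basis $v_0,\dots,v_{r-1}$ and action $Kv_n=q^{r-1-2n}v_n$, $Ev_n=[n][r-n]v_{n-1}$, $Fv_n=v_{n+1}$ (with $v_{-1}=v_r=0$), and let $\mathrm{qCh}_{V_r}=\mathrm{Tr}_{V_r}(K^{-1}\,\cdot\,)\in U^*$ be its $q$-character. Let $$\chi(r)=(\mathrm{qCh}_{V_r}\otimes\mathrm{id})(Q),\qquad \phi(r)=(\mathrm{qCh}_{V_r}\otimes \mathrm{id})(\Delta(\Lambda))$$ be its images under the Drinfeld and the Radford map, let $\mathcal D_l$ and $\mathcal R_l$ be the linear spans of $\chi(1),\dots,\chi(l)$ and of $\phi(1),\dots,\phi(l)$, and let $\mathrm{Hig}(U)$ be the image of the map $U\to U$, $x\mapsto\sum S(\Lambda_{(2)})\,x\,\Lambda_{(1)}K^{-1}$. Put $\nu(0)=\chi(l)$ and $\nu(r)=\chi(r)+\chi(l-r)$ for $1\le r\le h$. Then $\mathcal D_l$ and $\mathcal R_l$ are contained in the center of $U$, and $$\mathcal P_{h+1}:=\mathcal D_l\cap\mathcal R_l=\mathrm{Hig}(U).$$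 Moreover $\{\nu(r)\}_{r=0}^h$ and $\{\phi(l)\}\cup\{\phi(r)+\phi(l-r)\}_{r=1}^h$ are both bases of $\mathrm{Hig}(U)$, and they are related by $$\phi(l)=\frac1{\sqrt l}\Big(\nu(0)+2\sum_{j=1}^h\nu(j)\Big),\qquad \phi(r)+\phi(l-r)=\frac1{\sqrt l}\Big(\nu(0)+\sum_{j=1}^h(q^{jr}+q^{-jr})\,\nu(j)\Big)\quad(1\le r\le h),$$ that is, by the $(h+1)\times(h+1)$ matrix $S_N$ whose row $j=0$ has all entries $\frac1{\sqrt l}$ and whose entry in row $j\ge1$ and column $r$ is $\frac1{\sqrt l}(q^{jr}+q^{-jr})$. -/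

import Mathlib

open scoped TensorProduct

noncomputable section

/-! ## Linear maps attached to a Hopf algebra -/

namespace HopfMaps

variable {H : Type*} [Ring H] [HopfAlgebra ℂ H]

/-- The linear map `H ⊗ H → H`, `a ⊗ b ↦ β(a) b`, as a function of `β`, evaluated at `t`:
`β ↦ (β ⊗ id)(t)`. -/
def contractLeft (t : H ⊗[ℂ] H) : Module.Dual ℂ H →ₗ[ℂ] H where
  toFun β := TensorProduct.lid ℂ H (β.rTensor H t)
  map_add' β γ := by simp [LinearMap.rTensor_add]
  map_smul' c β := by simp [LinearMap.rTensor_smul]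

/-- The Drinfeld matrix `Q = R₂₁ R` of an element `R` of `H ⊗ H`. -/
def drinfeldMatrix (R : H ⊗[ℂ] H) : H ⊗[ℂ] H := TensorProduct.comm ℂ H H R * R

/-- The Drinfeld map `β ↦ (β ⊗ id)(Q)` with `Q = R₂₁ R`. -/
def drinfeldMap (R : H ⊗[ℂ] H) : Module.Dual ℂ H →ₗ[ℂ] H := contractLeft (drinfeldMatrix R)

/-- The Radford map `α ↦ (α ⊗ id)(Δ(Λ))`. -/
def radfordMap (Λ : H) : Module.Dual ℂ H →ₗ[ℂ] H := contractLeft (Coalgebra.comul Λ)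

/-- The trace map `x ↦ ∑ S(Λ₍₂₎) x Λ₍₁₎ G⁻¹`; the third argument stands for `G⁻¹`. -/
def higmanTrace (Λ Ginv : H) : H →ₗ[ℂ] H where
  toFun x := LinearMap.mul' ℂ H
    (TensorProduct.map (HopfAlgebra.antipode ℂ)
      (LinearMap.mulLeft ℂ x ∘ₗ LinearMap.mulRight ℂ Ginv)
      (TensorProduct.comm ℂ H H (Coalgebra.comul Λ)))
  map_add' x y := by
    have : LinearMap.mulLeft ℂ (x + y) = LinearMap.mulLeft ℂ x + LinearMap.mulLeft ℂ y := by
      ext; simp [add_mul]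
    simp [this, LinearMap.add_comp, TensorProduct.map_add_right]
  map_smul' c x := by
    have : LinearMap.mulLeft ℂ (c • x) = c • LinearMap.mulLeft ℂ x := by
      ext; simp
    simp [this, LinearMap.smul_comp, TensorProduct.map_smul_right]

end HopfMaps

namespace SmallQuantum

/-! ## The binomial formula for `q`-commuting elements -/

/-- Gaussian binomial coefficients at `ω`. -/
def gauss (ω : ℂ) : ℕ → ℕ → ℂ
  | _, 0 => 1
  | 0, _ + 1 => 0
  | n + 1, k + 1 => gauss ω n k + ω ^ (k + 1) * gauss ω n (k + 1)

theorem gauss_zero (ω : ℂ) (n : ℕ) : gauss ω n 0 = 1 := by cases n <;> rfl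

theorem gauss_of_lt (ω : ℂ) : ∀ n k : ℕ, n < k → gauss ω n k = 0
  | _, 0, h => absurd h (Nat.not_lt_zero _)
  | 0, _ + 1, _ => rfl
  | n + 1, k + 1, h => by
    rw [gauss, gauss_of_lt ω n k (by omega), gauss_of_lt ω n (k + 1) (by omega)]; simp

theorem gauss_absorb (ω : ℂ) : ∀ n k : ℕ,
    (1 - ω ^ (k + 1)) * gauss ω (n + 1) (k + 1) = (1 - ω ^ (n + 1)) * gauss ω n k
  | 0, 0 => by simp [gauss]
  | 0, k + 1 => by simp [gauss]
  | n + 1, 0 => by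
    have h := gauss_absorb ω n 0
    rw [show gauss ω (n + 1 + 1) (0 + 1) = gauss ω (n + 1) 0 + ω ^ (0 + 1) * gauss ω (n + 1) (0 + 1)
      from rfl]
    simp only [gauss_zero] at h ⊢
    linear_combination ω * h
  | n + 1, k + 1 => by
    have h1 := gauss_absorb ω n (k + 1)
    have h2 := gauss_absorb ω n k
    rw [gauss]
    rw [show gauss ω (n + 1) (k + 1) = gauss ω n k + ω ^ (k + 1) * gauss ω n (k + 1) from rfl]
      at h2 ⊢
    linear_combination ω ^ (k + 2) * h1 + ω * h2

theorem gauss_eq_zero {ω : ℂ} {l : ℕ} (hω : IsPrimitiveRoot ω l) {k : ℕ} (h0 : 0 < k)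
    (hk : k < l) : gauss ω l k = 0 := by
  obtain ⟨k, rfl⟩ : ∃ j, k = j + 1 := ⟨k - 1, by omega⟩
  obtain ⟨l, rfl⟩ : ∃ j, l = j + 1 := ⟨l - 1, by omega⟩
  have h := gauss_absorb ω l k
  rw [hω.pow_eq_one, sub_self, zero_mul] at h
  rcases mul_eq_zero.1 h with h | h
  · exact absurd (sub_eq_zero.1 h).symm (hω.pow_ne_one_of_pos_of_lt (by omega) hk)
  · exact h

section QComm

variable {A : Type*} [Ring A] [Algebra ℂ A] {x y : A} {ω : ℂ}

theorem mul_pow_qcomm (hxy : y * x = ω • (x * y)) (n : ℕ) : y * x ^ n = ω ^ n • (x ^ n * y) := by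
  induction n with
  | zero => simp
  | succ n ih =>
    rw [pow_succ, ← mul_assoc, ih, smul_mul_assoc, mul_assoc, hxy, mul_smul_comm, smul_smul,
      ← mul_assoc, pow_succ]

theorem pow_mul_qcomm (hxy : y * x = ω • (x * y)) (n : ℕ) : y ^ n * x = ω ^ n • (x * y ^ n) := by
  induction n with
  | zero => simp
  | succ n ih =>
    rw [pow_succ, mul_assoc, hxy, mul_smul_comm, ← mul_assoc, ih, smul_mul_assoc, smul_smul,
      mul_assoc, pow_succ, mul_comm]

theorem add_pow_qcomm (hxy : y * x = ω • (x * y)) (n : ℕ) :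
    (x + y) ^ n = ∑ k ∈ Finset.range (n + 1), gauss ω n k • (x ^ k * y ^ (n - k)) := by
  induction n with
  | zero => simp [gauss]
  | succ n ih =>
    have e1 : x * ∑ k ∈ Finset.range (n + 1), gauss ω n k • (x ^ k * y ^ (n - k)) =
        ∑ k ∈ Finset.range (n + 1), gauss ω n k • (x ^ (k + 1) * y ^ (n - k)) := by
      rw [Finset.mul_sum]
      refine Finset.sum_congr rfl fun k _ => ?_
      rw [mul_smul_comm, ← mul_assoc, pow_succ']
    have e2 : y * ∑ k ∈ Finset.range (n + 1), gauss ω n k • (x ^ k * y ^ (n - k)) =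
        ∑ k ∈ Finset.range (n + 2), (ω ^ k * gauss ω n k) • (x ^ k * y ^ (n + 1 - k)) := by
      rw [Finset.sum_range_succ _ (n + 1), gauss_of_lt ω n (n + 1) (by omega), mul_zero, zero_smul,
        add_zero, Finset.mul_sum]
      refine Finset.sum_congr rfl fun k hk => ?_
      have : n + 1 - k = (n - k) + 1 := by have := Finset.mem_range.1 hk; omega
      rw [mul_smul_comm, ← mul_assoc, mul_pow_qcomm hxy, this, pow_succ' y, smul_mul_assoc,
        smul_smul, mul_assoc, mul_comm]
    rw [pow_succ', ih, add_mul, e1, e2, Finset.sum_range_succ' _ (n + 1),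
      Finset.sum_range_succ' _ (n + 1), ← add_assoc, ← Finset.sum_add_distrib]
    congr 1
    · refine Finset.sum_congr rfl fun k _ => ?_
      rw [show n + 1 - (k + 1) = n - k by omega, ← add_smul]
      rfl
    · simp [gauss_zero]

theorem add_pow_root {l : ℕ} (hl : 0 < l) (hω : IsPrimitiveRoot ω l) (hxy : y * x = ω • (x * y)) :
    (x + y) ^ l = x ^ l + y ^ l := by
  obtain ⟨l, rfl⟩ : ∃ j, l = j + 1 := ⟨l - 1, by omega⟩
  rw [add_pow_qcomm hxy, Finset.sum_range_succ, Finset.sum_range_succ']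
  rw [Finset.sum_eq_zero]
  · have : gauss ω (l + 1) (l + 1) = 1 := by
      have key : ∀ n, gauss ω n n = 1 := by
        intro n
        induction n with
        | zero => rfl
        | succ n ih => rw [gauss, ih, gauss_of_lt ω n (n + 1) (by omega)]; simp
      exact key _
    simp [gauss_zero, this, add_comm]
  · intro k hk
    rw [gauss_eq_zero hω (by omega) (by have := Finset.mem_range.1 hk; omega), zero_smul]

theorem exists_mul_pow (hxy : y * x = ω • (x * y)) (n : ℕ) :
    ∃ c : ℂ, (x * y) ^ n = c • (x ^ n * y ^ n) := by
  induction n with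
  | zero => exact ⟨1, by simp⟩
  | succ n ih =>
    obtain ⟨c, hc⟩ := ih
    refine ⟨c * ω ^ n, ?_⟩
    rw [pow_succ, hc, smul_mul_assoc, mul_assoc, ← mul_assoc (y ^ n), pow_mul_qcomm hxy,
      smul_mul_assoc, mul_smul_comm, smul_smul, pow_succ, pow_succ]
    simp only [mul_assoc]

end QComm

/-! ## The algebra -/

/-- The data on which the small quantum group depends: `l = 2h + 1 ≥ 3` and a primitive `l`-th
root of unity `q`. -/
structure Param where
  h : ℕ
  one_le : 1 ≤ h
  q : ℂ
  prim : IsPrimitiveRoot q (2 * h + 1)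

namespace Param

variable (p : Param)

/-- The odd order `l = 2h + 1` of the root of unity. -/
def l : ℕ := 2 * p.h + 1

/-- The quantum integer `[n] = (qⁿ - q⁻ⁿ) / (q - q⁻¹)`. -/
def qInt (n : ℤ) : ℂ := (p.q ^ n - p.q ^ (-n)) / (p.q - p.q⁻¹)

/-- The quantum factorial `[m]! = [1][2]⋯[m]`. -/
def qFact (m : ℕ) : ℂ := ∏ i ∈ Finset.range m, p.qInt (i + 1)

theorem l_pos : 0 < p.l := by unfold l; omega

theorem prim' : IsPrimitiveRoot p.q p.l := p.prim

theorem q_ne_zero : p.q ≠ 0 := p.prim.ne_zero (by omega)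

theorem q_pow_l : p.q ^ p.l = 1 := p.prim.pow_eq_one

theorem prim_sq : IsPrimitiveRoot (p.q ^ 2) p.l := by
  refine p.prim.pow_of_coprime 2 ?_
  rw [Nat.coprime_mul_left_add_right]
  exact Nat.coprime_one_right 2

end Param

/-- The three generators. -/
inductive Gen
  | E
  | F
  | K

/-- The defining relations; since `K ^ l = 1`, the inverse of `K` is `K ^ (l - 1)`. -/
inductive Rel (p : Param) : FreeAlgebra ℂ Gen → FreeAlgebra ℂ Gen → Prop
  | E_pow : Rel p (FreeAlgebra.ι ℂ Gen.E ^ p.l) 0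
  | F_pow : Rel p (FreeAlgebra.ι ℂ Gen.F ^ p.l) 0
  | K_pow : Rel p (FreeAlgebra.ι ℂ Gen.K ^ p.l) 1
  | K_E : Rel p (FreeAlgebra.ι ℂ Gen.K * FreeAlgebra.ι ℂ Gen.E)
      ((p.q ^ 2) • (FreeAlgebra.ι ℂ Gen.E * FreeAlgebra.ι ℂ Gen.K))
  | K_F : Rel p (FreeAlgebra.ι ℂ Gen.K * FreeAlgebra.ι ℂ Gen.F)
      ((p.q ^ 2)⁻¹ • (FreeAlgebra.ι ℂ Gen.F * FreeAlgebra.ι ℂ Gen.K))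
  | E_F : Rel p (FreeAlgebra.ι ℂ Gen.E * FreeAlgebra.ι ℂ Gen.F
        - FreeAlgebra.ι ℂ Gen.F * FreeAlgebra.ι ℂ Gen.E)
      ((p.q - p.q⁻¹)⁻¹ • (FreeAlgebra.ι ℂ Gen.K - FreeAlgebra.ι ℂ Gen.K ^ (p.l - 1)))

/-- The algebra underlying the small quantum group `U_q sl(2)`. -/
def Uq (p : Param) : Type := RingQuot (Rel p)

namespace Uq

variable (p : Param)

instance instRing : Ring (Uq p) := inferInstanceAs (Ring (RingQuot (Rel p)))

instance instAlgebra : Algebra ℂ (Uq p) := inferInstanceAs (Algebra ℂ (RingQuot (Rel p)))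

/-- The quotient map from the free algebra. -/
def mk : FreeAlgebra ℂ Gen →ₐ[ℂ] Uq p := RingQuot.mkAlgHom ℂ (Rel p)

def E : Uq p := mk p (FreeAlgebra.ι ℂ Gen.E)
def F : Uq p := mk p (FreeAlgebra.ι ℂ Gen.F)
def K : Uq p := mk p (FreeAlgebra.ι ℂ Gen.K)
/-- The inverse of `K`. -/
def Kinv : Uq p := K p ^ (p.l - 1)

theorem mk_rel {x y : FreeAlgebra ℂ Gen} (h : Rel p x y) : mk p x = mk p y :=
  RingQuot.mkAlgHom_rel ℂ h

theorem E_pow : E p ^ p.l = 0 := by simpa [E] using mk_rel p Rel.E_pow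
theorem F_pow : F p ^ p.l = 0 := by simpa [F] using mk_rel p Rel.F_pow
theorem K_pow : K p ^ p.l = 1 := by simpa [K] using mk_rel p Rel.K_pow
theorem K_mul_E : K p * E p = (p.q ^ 2) • (E p * K p) := by
  simpa [K, E] using mk_rel p Rel.K_E
theorem K_mul_F : K p * F p = (p.q ^ 2)⁻¹ • (F p * K p) := by
  simpa [K, F] using mk_rel p Rel.K_F
theorem E_mul_F : E p * F p - F p * E p = (p.q - p.q⁻¹)⁻¹ • (K p - Kinv p) := by
  simpa [K, E, F, Kinv] using mk_rel p Rel.E_F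

theorem K_mul_Kinv : K p * Kinv p = 1 := by
  rw [Kinv, ← pow_succ', Nat.sub_add_cancel p.l_pos, K_pow]
theorem Kinv_mul_K : Kinv p * K p = 1 := by
  rw [Kinv, ← pow_succ, Nat.sub_add_cancel p.l_pos, K_pow]

variable {p}

section Lift

variable {A : Type*} [Ring A] [Algebra ℂ A] (e f k : A)

/-- The algebra map given by images of the generators that satisfy the relations. -/
def lift (hE : e ^ p.l = 0) (hF : f ^ p.l = 0) (hK : k ^ p.l = 1)
    (hKE : k * e = (p.q ^ 2) • (e * k)) (hKF : k * f = (p.q ^ 2)⁻¹ • (f * k))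
    (hEF : e * f - f * e = (p.q - p.q⁻¹)⁻¹ • (k - k ^ (p.l - 1))) : Uq p →ₐ[ℂ] A :=
  RingQuot.liftAlgHom ℂ (s := Rel p)
    ⟨FreeAlgebra.lift ℂ (fun g => Gen.rec e f k g), by
      intro x y h
      cases h <;> simp [hE, hF, hK, hKE, hKF, hEF]⟩

variable {e f k} {hE : e ^ p.l = 0} {hF : f ^ p.l = 0} {hK : k ^ p.l = 1}
    {hKE : k * e = (p.q ^ 2) • (e * k)} {hKF : k * f = (p.q ^ 2)⁻¹ • (f * k)}
    {hEF : e * f - f * e = (p.q - p.q⁻¹)⁻¹ • (k - k ^ (p.l - 1))}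

@[simp] theorem lift_E : lift e f k hE hF hK hKE hKF hEF (E p) = e := by
  unfold lift E mk
  erw [RingQuot.liftAlgHom_mkAlgHom_apply]
  simp

@[simp] theorem lift_F : lift e f k hE hF hK hKE hKF hEF (F p) = f := by
  unfold lift F mk
  erw [RingQuot.liftAlgHom_mkAlgHom_apply]
  simp

@[simp] theorem lift_K : lift e f k hE hF hK hKE hKF hEF (K p) = k := by
  unfold lift K mk
  erw [RingQuot.liftAlgHom_mkAlgHom_apply]
  simp

theorem hom_ext {A : Type*} [Semiring A] [Algebra ℂ A] {φ ψ : Uq p →ₐ[ℂ] A}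
    (hE : φ (E p) = ψ (E p)) (hF : φ (F p) = ψ (F p))
    (hK : φ (K p) = ψ (K p)) : φ = ψ := by
  refine RingQuot.ringQuot_ext' ℂ φ ψ ?_
  refine FreeAlgebra.hom_ext ?_
  funext g
  cases g
  · exact hE
  · exact hF
  · exact hK

end Lift

theorem induction {P : Uq p → Prop} (hE : P (E p)) (hF : P (F p)) (hK : P (K p))
    (hc : ∀ c : ℂ, P (algebraMap ℂ (Uq p) c)) (hadd : ∀ x y, P x → P y → P (x + y))
    (hmul : ∀ x y, P x → P y → P (x * y)) (x : Uq p) : P x := by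
  obtain ⟨x, rfl⟩ : ∃ y, mk p y = x := RingQuot.mkAlgHom_surjective ℂ (Rel p) x
  induction x with
  | grade0 c => rw [AlgHom.commutes]; exact hc c
  | grade1 g =>
    cases g
    · exact hE
    · exact hF
    · exact hK
  | mul a b ha hb => rw [map_mul]; exact hmul _ _ ha hb
  | add a b ha hb => rw [map_add]; exact hadd _ _ ha hb

variable (p)

theorem Kinv_mul_E : Kinv p * E p = (p.q ^ 2)⁻¹ • (E p * Kinv p) := by
  have hq : p.q ^ 2 ≠ 0 := pow_ne_zero _ p.q_ne_zero
  have h : E p = (p.q ^ 2) • (Kinv p * E p * K p) := by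
    rw [mul_assoc, ← mul_smul_comm, ← K_mul_E, ← mul_assoc, Kinv_mul_K, one_mul]
  conv_rhs => rw [h]
  rw [smul_mul_assoc, mul_assoc _ (K p), K_mul_Kinv, mul_one, smul_smul, inv_mul_cancel₀ hq,
    one_smul]

theorem Kinv_mul_F : Kinv p * F p = (p.q ^ 2) • (F p * Kinv p) := by
  have hq : p.q ^ 2 ≠ 0 := pow_ne_zero _ p.q_ne_zero
  have h : F p = (p.q ^ 2)⁻¹ • (Kinv p * F p * K p) := by
    rw [mul_assoc, ← mul_smul_comm, ← K_mul_F, ← mul_assoc, Kinv_mul_K, one_mul]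
  conv_rhs => rw [h]
  rw [smul_mul_assoc, mul_assoc _ (K p), K_mul_Kinv, mul_one, smul_smul, mul_inv_cancel₀ hq,
    one_smul]

theorem E_mul_K : E p * K p = (p.q ^ 2)⁻¹ • (K p * E p) := by
  rw [K_mul_E, smul_smul, inv_mul_cancel₀ (pow_ne_zero _ p.q_ne_zero), one_smul]

theorem F_mul_K : F p * K p = (p.q ^ 2) • (K p * F p) := by
  rw [K_mul_F, smul_smul, mul_inv_cancel₀ (pow_ne_zero _ p.q_ne_zero), one_smul]

theorem Kinv_pow : Kinv p ^ p.l = 1 := by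
  rw [Kinv, ← pow_mul, mul_comm, pow_mul, K_pow, one_pow]

theorem Kinv_pow_pred : Kinv p ^ (p.l - 1) = K p := by
  have h : Kinv p * Kinv p ^ (p.l - 1) = 1 := by
    rw [← pow_succ', Nat.sub_add_cancel p.l_pos, Kinv_pow]
  calc Kinv p ^ (p.l - 1) = K p * (Kinv p * Kinv p ^ (p.l - 1)) := by
        rw [← mul_assoc, K_mul_Kinv, one_mul]
    _ = K p := by rw [h, mul_one]

/-! ## The Hopf algebra structure -/

/-- `Δ(E) = 1 ⊗ E + E ⊗ K`, `Δ(F) = K⁻¹ ⊗ F + F ⊗ 1`, `Δ(K) = K ⊗ K`. -/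
def comulHom : Uq p →ₐ[ℂ] Uq p ⊗[ℂ] Uq p :=
  lift (1 ⊗ₜ E p + E p ⊗ₜ K p) (Kinv p ⊗ₜ F p + F p ⊗ₜ 1) (K p ⊗ₜ K p)
    (by
      rw [add_pow_root p.l_pos p.prim_sq]
      · simp [Algebra.TensorProduct.tmul_pow, E_pow]
      · simp [K_mul_E, TensorProduct.tmul_smul])
    (by
      rw [add_comm, add_pow_root p.l_pos p.prim_sq]
      · simp [Algebra.TensorProduct.tmul_pow, F_pow]
      · simp [Kinv_mul_F, TensorProduct.smul_tmul'])
    (by simp [Algebra.TensorProduct.tmul_pow, K_pow, Algebra.TensorProduct.one_def])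
    (by
      simp only [mul_add, add_mul, Algebra.TensorProduct.tmul_mul_tmul, K_mul_E, mul_one, one_mul,
        TensorProduct.smul_tmul', TensorProduct.tmul_smul, smul_add])
    (by
      simp only [mul_add, add_mul, Algebra.TensorProduct.tmul_mul_tmul, K_mul_F, mul_one, one_mul,
        TensorProduct.smul_tmul', TensorProduct.tmul_smul, smul_add, K_mul_Kinv, Kinv_mul_K])
    (by
      have hq : p.q ^ 2 ≠ 0 := pow_ne_zero _ p.q_ne_zero
      have h1 : (E p * Kinv p) ⊗ₜ[ℂ] (K p * F p) = (Kinv p * E p) ⊗ₜ[ℂ] (F p * K p) := by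
        rw [Kinv_mul_E, K_mul_F, TensorProduct.tmul_smul, TensorProduct.smul_tmul']
      have h2 : E p * F p = F p * E p + (p.q - p.q⁻¹)⁻¹ • (K p - Kinv p) := by
        rw [← E_mul_F]; abel
      rw [Algebra.TensorProduct.tmul_pow, ← Kinv]
      simp only [mul_add, add_mul, Algebra.TensorProduct.tmul_mul_tmul, mul_one, one_mul, h1, h2,
        TensorProduct.tmul_add, TensorProduct.add_tmul, TensorProduct.tmul_smul,
        ← TensorProduct.smul_tmul', TensorProduct.tmul_sub, TensorProduct.sub_tmul, smul_sub]
      abel)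

/-- `ε(E) = ε(F) = 0`, `ε(K) = 1`. -/
def counitHom : Uq p →ₐ[ℂ] ℂ :=
  lift 0 0 1 (zero_pow p.l_pos.ne') (zero_pow p.l_pos.ne') (one_pow _) (by simp) (by simp)
    (by simp)

/-- The antipode as an algebra map to the opposite algebra:
`S(E) = -E K⁻¹`, `S(F) = -K F`, `S(K) = K⁻¹`. -/
def antipodeHom : Uq p →ₐ[ℂ] (Uq p)ᵐᵒᵖ :=
  lift (MulOpposite.op (-(E p * Kinv p))) (MulOpposite.op (-(K p * F p)))
    (MulOpposite.op (Kinv p))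
    (by
      obtain ⟨c, hc⟩ := exists_mul_pow (Kinv_mul_E p) p.l
      rw [← MulOpposite.op_pow, neg_pow, hc, E_pow]; simp)
    (by
      obtain ⟨c, hc⟩ := exists_mul_pow (F_mul_K p) p.l
      rw [← MulOpposite.op_pow, neg_pow, hc, F_pow]; simp)
    (by rw [← MulOpposite.op_pow, Kinv_pow]; rfl)
    (by
      rw [← MulOpposite.op_mul, ← MulOpposite.op_mul, ← MulOpposite.op_smul]
      congr 1
      rw [mul_neg, neg_mul, ← mul_assoc, Kinv_mul_E, smul_mul_assoc, smul_neg, smul_smul,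
        mul_inv_cancel₀ (pow_ne_zero _ p.q_ne_zero), one_smul])
    (by
      rw [← MulOpposite.op_mul, ← MulOpposite.op_mul, ← MulOpposite.op_smul]
      congr 1
      rw [mul_neg, neg_mul, ← mul_assoc, Kinv_mul_K, one_mul, K_mul_F, smul_mul_assoc, mul_assoc,
        K_mul_Kinv, mul_one, smul_neg])
    (by
      rw [← MulOpposite.op_pow, Kinv_pow_pred, ← MulOpposite.op_mul, ← MulOpposite.op_mul,
        ← MulOpposite.op_sub, ← MulOpposite.op_sub, ← MulOpposite.op_smul]
      congr 1
      have h1 : K p * F p * (E p * Kinv p) = F p * E p := by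
        rw [K_mul_F, smul_mul_assoc, mul_assoc, ← mul_assoc (K p), K_mul_E, smul_mul_assoc,
          mul_smul_comm, smul_smul, inv_mul_cancel₀ (pow_ne_zero _ p.q_ne_zero), one_smul,
          mul_assoc, K_mul_Kinv, mul_one]
      have h2 : E p * Kinv p * (K p * F p) = E p * F p := by
        rw [mul_assoc, ← mul_assoc (Kinv p), Kinv_mul_K, one_mul]
      rw [neg_mul_neg, neg_mul_neg, h1, h2, ← neg_sub (E p * F p), E_mul_F, ← smul_neg, neg_sub])

@[simp] theorem comulHom_E : comulHom p (E p) = 1 ⊗ₜ E p + E p ⊗ₜ K p := lift_E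
@[simp] theorem comulHom_F : comulHom p (F p) = Kinv p ⊗ₜ F p + F p ⊗ₜ 1 := lift_F
@[simp] theorem comulHom_K : comulHom p (K p) = K p ⊗ₜ K p := lift_K
@[simp] theorem comulHom_Kinv : comulHom p (Kinv p) = Kinv p ⊗ₜ Kinv p := by
  simp [Kinv, Algebra.TensorProduct.tmul_pow]
@[simp] theorem counitHom_E : counitHom p (E p) = 0 := lift_E
@[simp] theorem counitHom_F : counitHom p (F p) = 0 := lift_F
@[simp] theorem counitHom_K : counitHom p (K p) = 1 := lift_K
@[simp] theorem counitHom_Kinv : counitHom p (Kinv p) = 1 := by simp [Kinv]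

instance instBialgebra : Bialgebra ℂ (Uq p) :=
  Bialgebra.ofAlgHom (comulHom p) (counitHom p)
    (by
      apply hom_ext <;>
        simp [TensorProduct.add_tmul, TensorProduct.tmul_add, Algebra.TensorProduct.one_def,
          add_assoc])
    (by apply hom_ext <;> simp)
    (by apply hom_ext <;> simp)

/-- The antipode as a linear map. -/
def antipodeLin : Uq p →ₗ[ℂ] Uq p :=
  (MulOpposite.opLinearEquiv ℂ).symm.toLinearMap ∘ₗ (antipodeHom p).toLinearMap

@[simp] theorem antipodeLin_mul (x y : Uq p) :
    antipodeLin p (x * y) = antipodeLin p y * antipodeLin p x := by simp [antipodeLin]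
@[simp] theorem antipodeLin_algebraMap (c : ℂ) :
    antipodeLin p (algebraMap ℂ _ c) = algebraMap ℂ _ c := by simp [antipodeLin]
@[simp] theorem antipodeLin_one : antipodeLin p 1 = 1 := by simp [antipodeLin]
@[simp] theorem antipodeLin_E : antipodeLin p (E p) = -(E p * Kinv p) := by
  simp [antipodeLin, antipodeHom]
@[simp] theorem antipodeLin_F : antipodeLin p (F p) = -(K p * F p) := by
  simp [antipodeLin, antipodeHom]
@[simp] theorem antipodeLin_K : antipodeLin p (K p) = Kinv p := by
  simp [antipodeLin, antipodeHom]
@[simp] theorem antipodeLin_Kinv : antipodeLin p (Kinv p) = K p := by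
  conv_rhs => rw [← Kinv_pow_pred]
  simp [antipodeLin, antipodeHom, Kinv]

theorem antipode_left (x : Uq p) :
    LinearMap.mul' ℂ (Uq p) ((antipodeLin p).rTensor (Uq p) (comulHom p x)) =
      algebraMap ℂ (Uq p) (counitHom p x) := by
  induction x using induction with
  | hE => simp [mul_assoc, Kinv_mul_K]
  | hF => simp
  | hK => simp [Kinv_mul_K]
  | hc c => simp
  | hadd x y hx hy => simp [hx, hy]
  | hmul x y hx hy =>
    have key : ∀ (z w : Uq p ⊗[ℂ] Uq p) (c : ℂ),
        LinearMap.mul' ℂ (Uq p) ((antipodeLin p).rTensor (Uq p) z) = algebraMap ℂ _ c →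
        LinearMap.mul' ℂ (Uq p) ((antipodeLin p).rTensor (Uq p) (z * w)) =
          c • LinearMap.mul' ℂ (Uq p) ((antipodeLin p).rTensor (Uq p) w) := by
      intro z w c hz
      induction w with
      | zero => simp
      | add a b ha hb => rw [mul_add, map_add, map_add, ha, hb, map_add, map_add, smul_add]
      | tmul a b =>
        have : ∀ z : Uq p ⊗[ℂ] Uq p,
            LinearMap.mul' ℂ (Uq p) ((antipodeLin p).rTensor (Uq p) (z * a ⊗ₜ b)) =
            antipodeLin p a * LinearMap.mul' ℂ (Uq p) ((antipodeLin p).rTensor (Uq p) z) * b := by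
          intro z
          induction z with
          | zero => simp
          | add u v hu hv => simp only [add_mul, map_add, hu, hv, mul_add]
          | tmul u v => simp [mul_assoc]
        rw [this, hz, ← Algebra.commutes, mul_assoc, ← Algebra.smul_def]
        simp
    rw [map_mul, key _ _ _ hx, hy, map_mul, map_mul, Algebra.smul_def]

theorem antipode_right (x : Uq p) :
    LinearMap.mul' ℂ (Uq p) ((antipodeLin p).lTensor (Uq p) (comulHom p x)) =
      algebraMap ℂ (Uq p) (counitHom p x) := by
  induction x using induction with
  | hE => simp
  | hF => simp [← mul_assoc, Kinv_mul_K]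
  | hK => simp [K_mul_Kinv]
  | hc c => simp
  | hadd x y hx hy => simp [hx, hy]
  | hmul x y hx hy =>
    have key : ∀ (z w : Uq p ⊗[ℂ] Uq p) (c : ℂ),
        LinearMap.mul' ℂ (Uq p) ((antipodeLin p).lTensor (Uq p) w) = algebraMap ℂ _ c →
        LinearMap.mul' ℂ (Uq p) ((antipodeLin p).lTensor (Uq p) (z * w)) =
          c • LinearMap.mul' ℂ (Uq p) ((antipodeLin p).lTensor (Uq p) z) := by
      intro z w c hw
      induction z with
      | zero => simp
      | add a b ha hb => rw [add_mul, map_add, map_add, ha, hb, map_add, map_add, smul_add]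
      | tmul a b =>
        have : ∀ w : Uq p ⊗[ℂ] Uq p,
            LinearMap.mul' ℂ (Uq p) ((antipodeLin p).lTensor (Uq p) (a ⊗ₜ b * w)) =
            a * LinearMap.mul' ℂ (Uq p) ((antipodeLin p).lTensor (Uq p) w) * antipodeLin p b := by
          intro w
          induction w with
          | zero => simp
          | add u v hu hv => simp only [add_mul, map_add, hu, hv, mul_add]
          | tmul u v => simp [mul_assoc]
        rw [this, hw, ← Algebra.commutes, mul_assoc, ← Algebra.smul_def]
        simp
    rw [map_mul, key _ _ _ hy, hx, map_mul, mul_comm, map_mul, Algebra.smul_def]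

instance instHopfAlgebra : HopfAlgebra ℂ (Uq p) where
  antipode := antipodeLin p
  mul_antipode_rTensor_comul := LinearMap.ext (antipode_left p)
  mul_antipode_lTensor_comul := LinearMap.ext (antipode_right p)

/-- The universal `R`-matrix. -/
def rMatrix : Uq p ⊗[ℂ] Uq p :=
  ∑ m ∈ Finset.range p.l, ∑ i ∈ Finset.range p.l, ∑ j ∈ Finset.range p.l,
    ((1 / (p.l : ℂ)) * ((p.q - p.q⁻¹) ^ m / p.qFact m) *
        p.q ^ ((m : ℤ) * (m - 1) / 2 + 2 * m * (i - j) - 2 * i * j)) •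
      ((E p ^ m * K p ^ i) ⊗ₜ[ℂ] (F p ^ m * K p ^ j))

/-- The two-sided integral `Λ = ζ F^(l-1) E^(l-1) ∑ⱼ K^j` with `ζ = √l / ([l-1]!)²`. -/
def integral : Uq p :=
  (((Real.sqrt p.l : ℝ) : ℂ) / p.qFact (p.l - 1) ^ 2) •
    (F p ^ (p.l - 1) * E p ^ (p.l - 1) * ∑ j ∈ Finset.range p.l, K p ^ j)

end Uq

/-! ## The simple modules -/

section Simple

variable (p : Param) (r : ℕ)

/-- `E vₙ = [n][r-n] vₙ₋₁`, `v₋₁ = 0`, as a matrix acting on column vectors. -/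
def matE : Matrix (Fin r) (Fin r) ℂ :=
  Matrix.of fun i j => if (i : ℕ) + 1 = j then p.qInt j * p.qInt (r - j) else 0

/-- `F vₙ = vₙ₊₁`, `vᵣ = 0`. -/
def matF : Matrix (Fin r) (Fin r) ℂ :=
  Matrix.of fun i j => if (i : ℕ) = j + 1 then 1 else 0

/-- `K vₙ = q^(r-1-2n) vₙ`. -/
def matK : Matrix (Fin r) (Fin r) ℂ :=
  Matrix.diagonal fun n => p.q ^ ((r : ℤ) - 1 - 2 * (n : ℤ))

theorem matPow_upper {M : Matrix (Fin r) (Fin r) ℂ}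
    (hM : ∀ i j : Fin r, (j : ℕ) < i + 1 → M i j = 0) (k : ℕ) :
    ∀ i j : Fin r, (j : ℕ) < i + k → (M ^ k) i j = 0 := by
  induction k with
  | zero => intro i j h; rw [pow_zero, Matrix.one_apply_ne]; rintro rfl; omega
  | succ k ih =>
    intro i j h
    rw [pow_succ, Matrix.mul_apply]
    refine Finset.sum_eq_zero fun a _ => ?_
    by_cases ha : (a : ℕ) < i + k
    · rw [ih i a ha, zero_mul]
    · rw [hM a j (by omega), mul_zero]

theorem matE_pow (hr : r ≤ p.l) : matE p r ^ p.l = 0 := by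
  ext i j
  refine matPow_upper r (fun i j h => ?_) p.l i j (by omega)
  simp only [matE, Matrix.of_apply]
  rw [if_neg (by omega)]

theorem matF_pow (hr : r ≤ p.l) : matF r ^ p.l = 0 := by
  rw [← Matrix.transpose_inj, Matrix.transpose_pow]
  ext i j
  refine matPow_upper r (fun i j h => ?_) p.l i j (by omega)
  simp only [matF, Matrix.of_apply, Matrix.transpose_apply]
  rw [if_neg (by omega)]

theorem matK_pow : matK p r ^ p.l = 1 := by
  rw [matK, Matrix.diagonal_pow, ← Matrix.diagonal_one]
  congr 1
  funext n
  rw [Pi.pow_apply, ← zpow_natCast, ← zpow_mul, mul_comm, zpow_mul, zpow_natCast, p.q_pow_l,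
    one_zpow]

theorem matK_pow_pred :
    matK p r ^ (p.l - 1) = Matrix.diagonal fun n : Fin r => p.q ^ (-((r : ℤ) - 1 - 2 * (n : ℤ))) := by
  rw [matK, Matrix.diagonal_pow]
  congr 1
  funext n
  rw [Pi.pow_apply, ← zpow_natCast, ← zpow_mul, Nat.cast_sub p.l_pos, mul_sub, zpow_sub₀ p.q_ne_zero,
    mul_comm, zpow_mul, zpow_natCast, p.q_pow_l, one_zpow, zpow_neg, one_div]
  simp

theorem qInt_identity (n r : ℤ) :
    p.qInt (n + 1) * p.qInt (r - (n + 1)) - p.qInt n * p.qInt (r - n) =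
      (p.q - p.q⁻¹)⁻¹ * (p.q ^ (r - 1 - 2 * n) - p.q ^ (-(r - 1 - 2 * n))) := by
  have hq := p.q_ne_zero
  have key : (p.q ^ (n + 1) - p.q ^ (-(n + 1))) * (p.q ^ (r - (n + 1)) - p.q ^ (-(r - (n + 1)))) -
      (p.q ^ n - p.q ^ (-n)) * (p.q ^ (r - n) - p.q ^ (-(r - n))) =
      (p.q - p.q⁻¹) * (p.q ^ (r - 1 - 2 * n) - p.q ^ (-(r - 1 - 2 * n))) := by
    have e : (p.q - p.q⁻¹) = p.q ^ (1 : ℤ) - p.q ^ (-1 : ℤ) := by simp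
    rw [e]
    simp only [sub_mul, mul_sub, ← zpow_add₀ hq]
    ring_nf
  unfold Param.qInt
  rw [div_mul_div_comm, div_mul_div_comm, ← sub_div, key]
  by_cases hd : p.q - p.q⁻¹ = 0
  · simp [hd]
  · field_simp

/-- The simple module `V_r`, `r ≤ l`, with highest weight vector `v₀` and basis
`v₀, …, v_{r-1}`, as a matrix representation. -/
def simpleRep (hr : r ≤ p.l) : Uq p →ₐ[ℂ] Matrix (Fin r) (Fin r) ℂ :=
  Uq.lift (matE p r) (matF r) (matK p r) (matE_pow p r hr) (matF_pow p r hr) (matK_pow p r)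
    (by
      ext i j
      simp only [matK, matE, Matrix.diagonal_mul, Matrix.smul_apply, Matrix.mul_diagonal,
        Matrix.of_apply, smul_eq_mul]
      split_ifs with h
      · rw [← h]
        push_cast
        rw [show ((r : ℤ) - 1 - 2 * (i : ℤ)) = 2 + ((r : ℤ) - 1 - 2 * ((i : ℤ) + 1)) by ring,
          zpow_add₀ p.q_ne_zero]
        norm_cast
        ring
      · simp)
    (by
      ext i j
      simp only [matK, matF, Matrix.diagonal_mul, Matrix.smul_apply, Matrix.mul_diagonal,
        Matrix.of_apply, smul_eq_mul]
      split_ifs with h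
      · rw [h]
        push_cast
        rw [show ((r : ℤ) - 1 - 2 * ((j : ℤ) + 1)) = -2 + ((r : ℤ) - 1 - 2 * (j : ℤ)) by ring,
          zpow_add₀ p.q_ne_zero, zpow_neg]
        norm_cast
        ring
      · simp)
    (by
      rw [matK_pow_pred]
      have hEF : matE p r * matF r =
          Matrix.diagonal fun n : Fin r => p.qInt ((n : ℤ) + 1) * p.qInt (r - ((n : ℤ) + 1)) := by
        ext i j
        rw [Matrix.mul_apply, Matrix.diagonal_apply]
        simp only [matE, matF, Matrix.of_apply, mul_ite, mul_one, mul_zero]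
        by_cases hi : (i : ℕ) + 1 < r
        · rw [Finset.sum_eq_single ⟨i + 1, hi⟩]
          · simp only [if_true, Nat.add_right_cancel_iff, Fin.ext_iff]
            push_cast
            rfl
          · intro b _ hb
            rw [ite_eq_right_iff]
            intro h1
            rw [ite_eq_right_iff]
            intro h2
            exact absurd (Fin.ext h2.symm) hb
          · simp
        · rw [Finset.sum_eq_zero]
          · have : (i : ℤ) + 1 = r := by have := i.isLt; omega
            rw [this, sub_self]
            simp [Param.qInt]
          · intro b _
            have := b.isLt
            split_ifs <;> first | rfl | omega
      have hFE : matF r * matE p r =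
          Matrix.diagonal fun n : Fin r => p.qInt n * p.qInt (r - (n : ℤ)) := by
        ext i j
        rw [Matrix.mul_apply, Matrix.diagonal_apply]
        simp only [matE, matF, Matrix.of_apply, ite_mul, mul_ite, one_mul, mul_zero, zero_mul]
        by_cases hi : 0 < (i : ℕ)
        · rw [Finset.sum_eq_single ⟨i - 1, by omega⟩]
          · simp only [Fin.ext_iff]
            have h1 : (i : ℕ) = i - 1 + 1 := by omega
            by_cases hij : (i : ℕ) = j
            · rw [if_pos (by omega), if_pos h1, if_pos hij, hij]
            · rw [if_neg (by omega), if_neg hij]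
          · intro b _ hb
            have : (b : ℕ) ≠ i - 1 := fun h => hb (Fin.ext h)
            split_ifs <;> first | rfl | omega
          · simp
        · rw [Finset.sum_eq_zero]
          · have : (i : ℤ) = 0 := by omega
            rw [this]
            simp [Param.qInt]
          · intro b _
            split_ifs <;> first | rfl | omega
      rw [hEF, hFE, matK, Matrix.diagonal_sub, Matrix.diagonal_sub, ← Matrix.diagonal_smul]
      congr 1
      funext n
      rw [Pi.smul_apply, smul_eq_mul]
      exact qInt_identity p n r)

/-- The `q`-character `Tr_{V_r}(K⁻¹ ·)`. -/
def qCh (hr : r ≤ p.l) : Module.Dual ℂ (Uq p) :=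
  Matrix.traceLinearMap (Fin r) ℂ ℂ ∘ₗ (simpleRep p r hr).toLinearMap ∘ₗ
    LinearMap.mulLeft ℂ (Uq.Kinv p)

/-- `χ(r)`, the image of the `q`-character of `V_r` under the Drinfeld map. -/
def chi (hr : r ≤ p.l) : Uq p := HopfMaps.drinfeldMap (Uq.rMatrix p) (qCh p r hr)

/-- `φ(r)`, the image of the `q`-character of `V_r` under the Radford map. -/
def phi (hr : r ≤ p.l) : Uq p := HopfMaps.radfordMap (Uq.integral p) (qCh p r hr)

end Simple

variable (p : Param)

/-- The span of the Drinfeld images of the `q`-characters of `V_1, …, V_l`. -/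
def drinfeldImage : Submodule ℂ (Uq p) :=
  Submodule.span ℂ {x | ∃ (r : ℕ) (_ : 1 ≤ r) (hr : r ≤ p.l), x = chi p r hr}

/-- The span of the Radford images of the `q`-characters of `V_1, …, V_l`. -/
def radfordImage : Submodule ℂ (Uq p) :=
  Submodule.span ℂ {x | ∃ (r : ℕ) (_ : 1 ≤ r) (hr : r ≤ p.l), x = phi p r hr}

/-- The Higman ideal, the image of the trace map `x ↦ ∑ S(Λ₍₂₎) x Λ₍₁₎ G⁻¹`
with balancing element `G = K`. -/
def higman : Submodule ℂ (Uq p) :=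
  LinearMap.range (HopfMaps.higmanTrace (Uq.integral p) (Uq.Kinv p))

/-- `ν(0) = χ(l)` and `ν(r) = χ(r) + χ(l - r)` for `1 ≤ r ≤ h`. -/
def nu (r : Fin (p.h + 1)) : Uq p :=
  if r = 0 then chi p p.l le_rfl
  else chi p r (by have := r.isLt; unfold Param.l; omega) + chi p (p.l - r) (Nat.sub_le _ _)

/-- `φ(l)` at index `0` and `φ(r) + φ(l - r)` for `1 ≤ r ≤ h`. -/
def phiSum (r : Fin (p.h + 1)) : Uq p :=
  if r = 0 then phi p p.l le_rfl
  else phi p r (by have := r.isLt; unfold Param.l; omega) + phi p (p.l - r) (Nat.sub_le _ _)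

/-- The matrix with entries `1/√l` in row `j = 0` and `(q^{jr} + q^{-jr})/√l` in rows `j ≥ 1`. -/
def sMatrix : Matrix (Fin (p.h + 1)) (Fin (p.h + 1)) ℂ :=
  Matrix.of fun j r => (1 / ((Real.sqrt p.l : ℝ) : ℂ)) *
    if j = 0 then 1 else p.q ^ ((j : ℤ) * r) + p.q ^ (-((j : ℤ) * r))

end SmallQuantum

end

/-!
The proof takes place in the algebra `ℂ[C]` generated by the Casimir element
`C = (q - q⁻¹)² F E + q K + q⁻¹ K⁻¹`. Multiplying by the idempotents of `ℂ[K]`, which sum to `1`,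
reduces an identity in `U` to one on each eigenspace of `K` (`Uq.ext_idem`), and there `Eⁿ Fⁿ` and
`Fⁿ Eⁿ` are products of factors `C - (qᵃ + q⁻ᵃ)` (`Uq.E_pow_F_pow_mul_idem`,
`Uq.F_pow_E_pow_mul_idem`). In particular `E ^ l = 0` shows that `C` is annihilated by the product of
the factors `X - (qᵃ + q⁻ᵃ)` over `a ∈ ℤ/l` (`Uq.aeval_minpol`), while an explicit module with basis
`Fᵃ Eᵇ u` shows that `C` satisfies no equation of smaller degree, even after multiplication by one
idempotent (`Uq.eq_zero_of_aeval_mul_idem`).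

*Drinfeld images.* The Gauss sums in `Q` collapse, and `χ(r + 1)` becomes a combination of the
elements `Eᵐ Fᵐ` whose coefficients are convolutions of `q`-binomial coefficients. These are the
coefficients of the Chebyshev polynomial `S_r` in the Newton basis with nodes `qᵃ + q⁻ᵃ`, as one sees
from the generating series `1 / (1 - X y + y²)`. Hence `χ(r + 1) = S_r(C)` (`chi_eq`).

*Radford images.* Since `Λ` is a two-sided integral, `φ(r)` is central and `C φ(r)` is
`(q^r + q⁻ʳ) φ(r)`. On an eigenspace of `K`, `φ(r)` is a polynomial in `C` of degree less than `l`, so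
it is a multiple of `M_r(C)`, where `M_r` is the annihilating polynomial divided by
`X - (q^r + q⁻ʳ)`. Comparing leading coefficients, the multiple is `1 / √l` times the multiplicity of
a weight in `V_r` (`phi_mul_idem`). The weights of `V_r` and `V_{l-r}` together exhaust `ℤ/l`, so
`φ(r) + φ(l - r) = M_r(C) / √l` (`phi_add_phi`). The expansion of `M_r` in Chebyshev polynomials is
the transformation matrix (`phiSum_eq_sum`).

*The Higman ideal.* The trace map is linear over the center, vanishes on elements of nonzero weight
and on `K, …, K ^ (l - 1)`, and sends `1` to a nonzero multiple of `χ(l) = S_{l-1}(C)`. So the ideal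
is `ℂ[C] χ(l)` (`mem_higman_iff`). As `l S_{l-1}` is the sum of `M_a` over `a ∈ ℤ/l`, and `M_a(C)` is
an eigenvector of `C` for `qᵃ + q⁻ᵃ`, interpolation shows that the ideal has the basis `M_r(C)`,
`0 ≤ r ≤ h`, of eigenvectors with distinct eigenvalues. Counting dimensions, the elements `ν(r)` form
a basis as well.

*The intersection.* An element of both images is `f(C)` with `deg f < l`, and on one eigenspace of `K`
it agrees with an element `g(C)` of the Higman ideal with `deg g < l`. Therefore `f = g`.
-/

noncomputable section

open Polynomial

namespace SmallQuantum

/-! ### Powers of `q` -/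

namespace Param

variable (p : Param)

theorem l_odd : Odd p.l := ⟨p.h, rfl⟩

theorem one_lt_l : 1 < p.l := by have := p.one_le; unfold l; omega

theorem l_ne_zero : (p.l : ℂ) ≠ 0 := Nat.cast_ne_zero.2 p.l_pos.ne'

theorem zpow_add (a b : ℤ) : p.q ^ (a + b) = p.q ^ a * p.q ^ b := zpow_add₀ p.q_ne_zero a b

theorem zpow_ne_zero (a : ℤ) : p.q ^ a ≠ 0 := _root_.zpow_ne_zero a p.q_ne_zero

theorem zpow_eq_one_iff (a : ℤ) : p.q ^ a = 1 ↔ (p.l : ℤ) ∣ a := p.prim'.zpow_eq_one_iff_dvd a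

theorem zpow_eq_iff (a b : ℤ) : p.q ^ a = p.q ^ b ↔ (p.l : ℤ) ∣ a - b := by
  rw [← p.zpow_eq_one_iff, sub_eq_add_neg, p.zpow_add, zpow_neg, mul_inv_eq_one₀ (p.zpow_ne_zero b)]

/-- Since `l` is odd, `2` is invertible modulo `l`. -/
theorem dvd_of_dvd_two_mul {a : ℤ} (h : (p.l : ℤ) ∣ 2 * a) : (p.l : ℤ) ∣ a := by
  refine Int.dvd_of_dvd_mul_right_of_gcd_one h ?_
  have : Nat.Coprime p.l 2 := Nat.coprime_two_right.2 p.l_odd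
  exact_mod_cast this

theorem zpow_eq_zpow_neg_iff (a : ℤ) : p.q ^ a = p.q ^ (-a) ↔ (p.l : ℤ) ∣ a := by
  rw [p.zpow_eq_iff, sub_neg_eq_add, ← two_mul]
  exact ⟨p.dvd_of_dvd_two_mul, fun h => h.mul_left 2⟩

theorem q_sub_inv_ne_zero : p.q - p.q⁻¹ ≠ 0 := by
  rw [sub_ne_zero]
  have := p.zpow_eq_zpow_neg_iff 1
  simp only [zpow_one, zpow_neg] at this
  rw [Ne, this]
  have := p.one_lt_l
  intro h
  have := Int.le_of_dvd one_pos h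
  omega

theorem qInt_zero : p.qInt 0 = 0 := by simp [qInt]

theorem qInt_eq_zero_iff (n : ℤ) : p.qInt n = 0 ↔ (p.l : ℤ) ∣ n := by
  rw [qInt, div_eq_zero_iff, or_iff_left p.q_sub_inv_ne_zero, sub_eq_zero, p.zpow_eq_zpow_neg_iff]

theorem qInt_ne_zero {n : ℕ} (h0 : 0 < n) (hn : n < p.l) : p.qInt n ≠ 0 := by
  rw [Ne, qInt_eq_zero_iff]
  intro h
  have := Int.le_of_dvd (by omega) h
  omega

theorem qFact_ne_zero {n : ℕ} (hn : n < p.l) : p.qFact n ≠ 0 := by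
  refine Finset.prod_ne_zero_iff.2 fun i hi => ?_
  have hi := Finset.mem_range.1 hi
  exact_mod_cast p.qInt_ne_zero (n := i + 1) (by omega) (by omega)

/-- Orthogonality of the characters of `ℤ/l`. -/
theorem sum_zpow_mul (n : ℤ) :
    ∑ j ∈ Finset.range p.l, p.q ^ (n * (j : ℤ)) = if (p.l : ℤ) ∣ n then (p.l : ℂ) else 0 := by
  have e : ∀ j : ℕ, p.q ^ (n * (j : ℤ)) = (p.q ^ n) ^ j := fun j => by
    rw [zpow_mul, zpow_natCast]
  simp only [e]
  split_ifs with h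
  · simp [(p.zpow_eq_one_iff n).2 h]
  · have h1 : p.q ^ n ≠ 1 := fun h' => h ((p.zpow_eq_one_iff n).1 h')
    have h2 : (p.q ^ n) ^ p.l = 1 := by
      rw [← zpow_natCast, ← zpow_mul, p.zpow_eq_one_iff]; exact dvd_mul_left _ _
    have := geom_sum_mul (p.q ^ n) p.l
    rw [h2, sub_self] at this
    exact (mul_eq_zero.1 this).resolve_right (sub_ne_zero.2 h1)

/-- A residue class modulo `l` meets `{0, …, l - 1}` in exactly one point. -/
theorem sum_ite_dvd_sub (n : ℤ) (g : ℤ → ℂ) (hg : ∀ a b : ℤ, (p.l : ℤ) ∣ a - b → g a = g b) :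
    ∑ i ∈ Finset.range p.l, (if (p.l : ℤ) ∣ n - i then g i else 0) = g n := by
  have hl : (0 : ℤ) < p.l := by exact_mod_cast p.l_pos
  have h0 := Int.emod_nonneg n hl.ne'
  have h1 := Int.emod_lt_of_pos n hl
  have hd : (p.l : ℤ) ∣ n - n % p.l := Int.dvd_self_sub_emod
  rw [Finset.sum_eq_single (n % p.l).toNat]
  · rw [Int.toNat_of_nonneg h0, if_pos hd]
    exact (hg _ _ hd).symm
  · intro b hb hne
    have hb := Finset.mem_range.1 hb
    rw [if_neg]
    intro h
    have h3 : (p.l : ℤ) ∣ (b : ℤ) - n % p.l := by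
      have := dvd_sub hd h
      rwa [show n - n % p.l - (n - b) = (b : ℤ) - n % p.l by ring] at this
    have h4 := Int.eq_zero_of_abs_lt_dvd h3 (by rw [abs_lt]; constructor <;> omega)
    omega
  · intro h
    exact absurd (Finset.mem_range.2 (by omega)) h

/-- Division by `2` modulo `l = 2h + 1` is multiplication by `h + 1`. -/
theorem dvd_sub_two_mul_iff (u i : ℤ) : (p.l : ℤ) ∣ u - 2 * i ↔ (p.l : ℤ) ∣ (p.h + 1) * u - i := by
  have hl : (p.l : ℤ) = 2 * p.h + 1 := by simp [l]
  constructor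
  · rintro ⟨a, ha⟩
    exact ⟨(p.h + 1) * a + i, by rw [hl] at ha ⊢; linear_combination ((p.h : ℤ) + 1) * ha⟩
  · rintro ⟨a, ha⟩
    exact ⟨2 * a - u, by rw [hl] at ha ⊢; linear_combination 2 * ha⟩

/-- A double Gauss sum over `ℤ/l`; here `h + 1` is the inverse of `2` modulo `l = 2h + 1`. -/
theorem sum_sum_zpow (u v : ℤ) :
    ∑ i ∈ Finset.range p.l, ∑ j ∈ Finset.range p.l, p.q ^ (-2 * (i : ℤ) * j + j * u + i * v) =
      p.l * p.q ^ ((p.h + 1) * u * v : ℤ) := by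
  have e : ∀ i : ℕ, ∑ j ∈ Finset.range p.l, p.q ^ (-2 * (i : ℤ) * j + j * u + i * v) =
      if (p.l : ℤ) ∣ (p.h + 1) * u - i then p.l * p.q ^ ((i : ℤ) * v) else 0 := by
    intro i
    have e1 : ∀ j : ℕ, p.q ^ (-2 * (i : ℤ) * j + j * u + i * v) =
        p.q ^ ((u - 2 * i) * (j : ℤ)) * p.q ^ ((i : ℤ) * v) := fun j => by
      rw [← p.zpow_add]; congr 1; ring
    simp only [e1]
    rw [← Finset.sum_mul, sum_zpow_mul]
    simp only [p.dvd_sub_two_mul_iff, ite_mul, zero_mul]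
  simp only [e]
  rw [p.sum_ite_dvd_sub ((p.h + 1) * u) fun i => (p.l : ℂ) * p.q ^ (i * v)]
  intro a b hab
  congr 1
  rw [zpow_eq_iff, ← sub_mul]
  exact hab.mul_right v

/-- `q ^ n + q ^ (-n)`, the value of the Casimir element on the simple module of dimension `n`. -/
def bet (n : ℤ) : ℂ := p.q ^ n + p.q ^ (-n)

theorem bet_zero : p.bet 0 = 2 := by simp [bet]; norm_num

theorem bet_neg (n : ℤ) : p.bet (-n) = p.bet n := by simp [bet, add_comm]

theorem bet_congr {a b : ℤ} (h : (p.l : ℤ) ∣ a - b) : p.bet a = p.bet b := by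
  have h1 := (p.zpow_eq_iff a b).2 h
  rw [bet, bet, zpow_neg, zpow_neg, h1]

theorem bet_l_sub (r : ℤ) : p.bet (p.l - r) = p.bet r := by
  rw [← p.bet_neg r]; exact p.bet_congr (by simp)

theorem bet_mul (a b : ℤ) : p.bet a * p.bet b = p.bet (a + b) + p.bet (a - b) := by
  have h : ∀ x y : ℤ, p.q ^ (x + y) = p.q ^ x * p.q ^ y := p.zpow_add
  simp only [bet, sub_eq_add_neg, neg_add, h, neg_neg]
  ring

theorem bet_sub_bet (a b : ℤ) :
    p.bet a - p.bet b = p.q ^ (-a) * (p.q ^ (a + b) - 1) * (p.q ^ (a - b) - 1) := by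
  have hq := p.zpow_ne_zero
  have := hq a
  have := hq b
  simp only [bet, sub_eq_add_neg, p.zpow_add, zpow_neg]
  field_simp
  ring

/-- The residues `0, …, h` represent the orbits of `n ↦ -n` on `ℤ/l`. -/
theorem bet_injOn {r s : ℕ} (hr : r ≤ p.h) (hs : s ≤ p.h) (h : p.bet r = p.bet s) : r = s := by
  have hl : (p.l : ℤ) = 2 * p.h + 1 := by simp [l]
  have := p.bet_sub_bet r s
  rw [h, sub_self, eq_comm, mul_assoc, mul_eq_zero, or_iff_right (p.zpow_ne_zero _), mul_eq_zero,
    sub_eq_zero, sub_eq_zero, zpow_eq_one_iff, zpow_eq_one_iff] at this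
  rcases this with h | h
  · have := Int.eq_zero_of_abs_lt_dvd h (by rw [abs_lt]; constructor <;> omega)
    omega
  · have := Int.eq_zero_of_abs_lt_dvd h (by rw [abs_lt]; constructor <;> omega)
    omega

/-- The scalar `(q - q⁻¹)²` that clears the denominators of the quantum integers in the Casimir
element. -/
def c : ℂ := (p.q - p.q⁻¹) ^ 2

theorem c_ne_zero : p.c ≠ 0 := pow_ne_zero _ p.q_sub_inv_ne_zero

theorem c_mul_qInt_mul (a b : ℤ) : p.c * (p.qInt a * p.qInt b) = p.bet (a + b) - p.bet (a - b) := by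
  have := p.q_sub_inv_ne_zero
  have h : ∀ x y : ℤ, p.q ^ (x + y) = p.q ^ x * p.q ^ y := p.zpow_add
  have e : p.c * (p.qInt a * p.qInt b) =
      (p.q ^ a - p.q ^ (-a)) * (p.q ^ b - p.q ^ (-b)) := by
    rw [c, qInt, qInt, div_mul_div_comm, ← sq, mul_div_cancel₀ _ (pow_ne_zero _ this)]
  rw [e]
  simp only [bet, sub_eq_add_neg, neg_add, h, neg_neg]
  ring

/-! ### Polynomials attached to the Casimir element -/

/-- The polynomial `∏ (X - (q ^ i + q ^ (-i)))`, `i ∈ ℤ/l`, that annihilates the Casimir element,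
written as a Vieta–Lucas polynomial. -/
def minpol : ℂ[X] := Chebyshev.C ℂ p.l - 2

theorem eval_chebyshev_C {t : ℂ} (ht : t ≠ 0) (n : ℕ) :
    (Chebyshev.C ℂ n).eval (t + t⁻¹) = t ^ n + (t ^ n)⁻¹ := by
  induction n using Nat.twoStepInduction with
  | zero => simp; norm_num
  | one => simp
  | more n h0 h1 =>
    push_cast at h1 ⊢
    rw [Chebyshev.C_add_two, eval_sub, eval_mul, eval_X, h0, h1]
    field_simp
    ring

/-- Polynomial identities may be checked at the points `t + t⁻¹`, since these exhaust `ℂ`. -/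
theorem exists_add_inv (x : ℂ) : ∃ t : ℂ, t ≠ 0 ∧ t + t⁻¹ = x := by
  obtain ⟨s, hs⟩ := IsAlgClosed.exists_pow_nat_eq (x ^ 2 - 4) (n := 2) two_pos
  have h : (x + s) / 2 * ((x - s) / 2) = 1 := by linear_combination -hs / 4
  have h0 : (x + s) / 2 ≠ 0 := left_ne_zero_of_mul_eq_one h
  refine ⟨(x + s) / 2, h0, ?_⟩
  rw [inv_eq_of_mul_eq_one_right h]
  ring

theorem prod_sub_root (a : ℂ) (ha : a ^ p.l = 1) {ω : ℂ} (hω : IsPrimitiveRoot ω p.l) (t : ℂ) :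
    ∏ i ∈ Finset.range p.l, (t - ω ^ i * a) = t ^ p.l - 1 := by
  have := congrArg (Polynomial.eval t) (X_pow_sub_C_eq_prod hω p.l_pos ha)
  simpa [eval_prod] using this.symm

/-- Any `l` nodes `k, k + 2, …, k + 2(l - 1)` exhaust the residues modulo `l`. -/
theorem prod_nodes (k : ℤ) :
    ∏ i ∈ Finset.range p.l, (X - C (p.bet (k + 2 * i))) = p.minpol := by
  refine Polynomial.funext fun x => ?_
  obtain ⟨t, ht, rfl⟩ := exists_add_inv x
  have h1 : ∀ i : ℕ, t + t⁻¹ - p.bet (k + 2 * i) =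
      (t - (p.q ^ 2) ^ i * p.q ^ k) * (t - (p.q ^ 2)⁻¹ ^ i * p.q ^ (-k)) * t⁻¹ := by
    intro i
    have e1 : p.q ^ (k + 2 * (i : ℤ)) = (p.q ^ 2) ^ i * p.q ^ k := by
      rw [p.zpow_add, mul_comm, zpow_mul]; norm_cast
    have e2 : p.q ^ (-(k + 2 * (i : ℤ))) = (p.q ^ 2)⁻¹ ^ i * p.q ^ (-k) := by
      rw [zpow_neg, e1, mul_inv, inv_pow, zpow_neg]
    rw [bet, e1, e2]
    have h3 : (p.q ^ 2) ^ i * p.q ^ k * ((p.q ^ 2)⁻¹ ^ i * p.q ^ (-k)) = 1 := by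
      rw [← e1, ← e2, ← p.zpow_add]; simp
    have h4 : t * t⁻¹ = 1 := mul_inv_cancel₀ ht
    linear_combination (-t + (p.q ^ 2) ^ i * p.q ^ k + (p.q ^ 2)⁻¹ ^ i * p.q ^ (-k)) * h4 - t⁻¹ * h3
  have hk : ∀ k : ℤ, (p.q ^ k) ^ p.l = 1 := fun k => by
    rw [← zpow_natCast, ← zpow_mul, zpow_eq_one_iff]; exact dvd_mul_left _ _
  rw [eval_prod]
  simp only [eval_sub, eval_X, eval_C, h1]
  rw [Finset.prod_mul_distrib, Finset.prod_mul_distrib, p.prod_sub_root _ (hk k) p.prim_sq,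
    p.prod_sub_root _ (hk (-k)) p.prim_sq.inv, minpol, eval_sub, eval_chebyshev_C ht]
  have : t ^ p.l ≠ 0 := pow_ne_zero _ ht
  simp
  field_simp
  ring

theorem monic_minpol : p.minpol.Monic := by
  rw [← p.prod_nodes 0]; exact monic_prod_of_monic _ _ fun i _ => monic_X_sub_C _

theorem natDegree_minpol : p.minpol.natDegree = p.l := by
  rw [← p.prod_nodes 0, natDegree_prod_of_monic _ _ fun i _ => monic_X_sub_C _]
  simp

/-- The cofactor of `X - (q ^ r + q ^ (-r))` in the annihilating polynomial, expanded in Chebyshev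
polynomials. -/
def cofactor (r : ℤ) : ℂ[X] :=
  Chebyshev.S ℂ (p.l - 1) +
    ∑ j ∈ Finset.range (p.l - 1), C (p.bet ((j + 1) * r)) * Chebyshev.S ℂ j

/-- A Christoffel–Darboux type summation: the product telescopes by the three-term recurrences of
`S` and of `j ↦ q ^ (j r) + q ^ (-j r)`. -/
theorem mul_sum_chebyshev (r : ℤ) (n : ℕ) :
    (X - C (p.bet r)) * ∑ j ∈ Finset.range n, C (p.bet ((j + 1) * r)) * Chebyshev.S ℂ j =
      C (p.bet (n * r)) * Chebyshev.S ℂ n - C (p.bet ((n + 1) * r)) * Chebyshev.S ℂ (n - 1) - 2 := by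
  induction n with
  | zero => simp [bet_zero, ← C_ofNat]
  | succ n ih =>
    rw [Finset.sum_range_succ, mul_add, ih]
    push_cast
    have h1 := congrArg (C : ℂ → ℂ[X]) (p.bet_mul ((n + 1) * r) r)
    rw [show ((n : ℤ) + 1) * r + r = (n + 1 + 1) * r by ring,
      show ((n : ℤ) + 1) * r - r = n * r by ring, C_mul, C_add] at h1
    rw [Chebyshev.S_add_one ℂ n, show (n : ℤ) + 1 - 1 = n by ring]
    linear_combination -Chebyshev.S ℂ n * h1

theorem mul_cofactor (r : ℤ) : (X - C (p.bet r)) * p.cofactor r = p.minpol := by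
  have hl := p.l_pos
  have h := p.mul_sum_chebyshev r (p.l - 1)
  rw [Nat.cast_sub hl] at h
  have e1 : p.bet (((p.l : ℤ) - (1 : ℕ)) * r) = p.bet r := by
    rw [← p.bet_neg r]; exact p.bet_congr ⟨r, by push_cast; ring⟩
  have e2 : p.bet (((p.l : ℤ) - (1 : ℕ) + 1) * r) = 2 := by
    rw [← p.bet_zero]; exact p.bet_congr ⟨r, by push_cast; ring⟩
  rw [e1, e2] at h
  rw [cofactor, mul_add, h, minpol, Chebyshev.C_eq_S_sub_X_mul_S]
  have h2 := Chebyshev.S_eq ℂ p.l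
  rw [show (p.l : ℤ) - 2 = p.l - (1 : ℕ) - 1 by push_cast; ring] at h2
  push_cast at h2 ⊢
  rw [C_ofNat]
  linear_combination -2 * h2

theorem cofactor_congr {r s : ℤ} (h : p.bet r = p.bet s) : p.cofactor r = p.cofactor s := by
  refine mul_left_cancel₀ (X_sub_C_ne_zero (p.bet r)) ?_
  rw [mul_cofactor, h, mul_cofactor]

theorem monic_cofactor (r : ℤ) : (p.cofactor r).Monic := by
  have := p.monic_minpol
  rw [← p.mul_cofactor r] at this
  exact (monic_X_sub_C _).of_mul_monic_left this

theorem natDegree_cofactor (r : ℤ) : (p.cofactor r).natDegree = p.l - 1 := by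
  have := p.natDegree_minpol
  rw [← p.mul_cofactor r, (monic_X_sub_C _).natDegree_mul (p.monic_cofactor r),
    natDegree_X_sub_C] at this
  omega

/-- Only the node `j - 1 - 2b` is missing from the products on the left, which occur in
`Eᵇ Fᵇ` and `Fᵃ Eᵃ`, `a + b = l - 1`. -/
theorem prod_mul_prod_nodes (j : ℤ) {b : ℕ} (hb : b < p.l) :
    (∏ i ∈ Finset.range b, (X - C (p.bet (j - 1 - 2 * i)))) *
      ∏ i ∈ Finset.range (p.l - 1 - b), (X - C (p.bet (j + 1 + 2 * i))) =
      p.cofactor (j - 1 - 2 * b) := by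
  refine mul_left_cancel₀ (X_sub_C_ne_zero (p.bet (j - 1 - 2 * b))) ?_
  rw [mul_cofactor, ← p.prod_nodes (j - 1 - 2 * b), show p.l = b + 1 + (p.l - 1 - b) by omega,
    Finset.prod_range_add, Finset.prod_range_succ', ← mul_assoc,
    show b + 1 + (p.l - 1 - b) - 1 - b = p.l - 1 - b by omega]
  congr 1
  · rw [mul_comm]
    congr 1
    · rw [← Finset.prod_range_reflect]
      refine Finset.prod_congr rfl fun i hi => ?_
      have := Finset.mem_range.1 hi
      congr 4
      rw [Nat.cast_sub (by omega), Nat.cast_sub (by omega)]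
      push_cast; ring
    · simp
  · refine Finset.prod_congr rfl fun i _ => ?_
    congr 3
    push_cast; ring

/-- Averaging over the nodes leaves only the leading Chebyshev polynomial, by orthogonality of
characters. -/
theorem sum_cofactor (k : ℤ) :
    ∑ b ∈ Finset.range p.l, p.cofactor (k - 2 * b) = (p.l : ℂ[X]) * Chebyshev.S ℂ (p.l - 1) := by
  simp only [cofactor, Finset.sum_add_distrib]
  rw [Finset.sum_const, Finset.card_range, nsmul_eq_mul, Finset.sum_comm, add_eq_left]
  refine Finset.sum_eq_zero fun j hj => ?_
  have hj := Finset.mem_range.1 hj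
  rw [← Finset.sum_mul, ← map_sum]
  have hnd : ¬ (p.l : ℤ) ∣ 2 * (j + 1) := fun h => by
    have := Int.le_of_dvd (by omega) (p.dvd_of_dvd_two_mul h)
    omega
  have hnd' : ¬ (p.l : ℤ) ∣ -(2 * (j + 1)) := by rwa [dvd_neg]
  have : ∑ b ∈ Finset.range p.l, p.bet ((j + 1) * (k - 2 * b)) = 0 := by
    have e : ∀ b : ℕ, p.bet ((j + 1) * (k - 2 * b)) =
        p.q ^ ((j + 1) * k) * p.q ^ (-(2 * (j + 1 : ℤ)) * (b : ℤ)) +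
        p.q ^ (-((j + 1) * k)) * p.q ^ (2 * (j + 1 : ℤ) * (b : ℤ)) := fun b => by
      rw [bet, ← p.zpow_add, ← p.zpow_add]; congr 2 <;> ring
    simp only [e]
    rw [Finset.sum_add_distrib, ← Finset.mul_sum, ← Finset.mul_sum, sum_zpow_mul, sum_zpow_mul,
      if_neg hnd, if_neg hnd']
    simp
  rw [this]; simp

end Param

theorem monic_and_natDegree_chebyshev_S (n : ℕ) :
    (Chebyshev.S ℂ n).Monic ∧ (Chebyshev.S ℂ n).natDegree = n := by
  induction n using Nat.twoStepInduction with
  | zero => simp [monic_one]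
  | one => simp [monic_X]
  | more n h0 h1 =>
    push_cast at h1 ⊢
    have hm : (X * Chebyshev.S ℂ ((n : ℤ) + 1)).Monic := monic_X.mul h1.1
    have hd : (X * Chebyshev.S ℂ ((n : ℤ) + 1)).natDegree = n + 2 := by
      rw [monic_X.natDegree_mul h1.1, h1.2, natDegree_X]; ring
    have hlt : (Chebyshev.S ℂ (n : ℤ)).degree < (X * Chebyshev.S ℂ ((n : ℤ) + 1)).degree := by
      rw [degree_eq_natDegree h0.1.ne_zero, degree_eq_natDegree hm.ne_zero, h0.2, hd]
      exact_mod_cast Nat.lt_add_of_pos_right two_pos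
    rw [Chebyshev.S_add_two]
    exact ⟨hm.sub_of_left hlt, by rw [natDegree_sub_eq_left_of_natDegree_lt (by omega), hd]⟩

end SmallQuantum

end

noncomputable section

open Polynomial hiding smul_pow

namespace SmallQuantum

namespace Uq

variable (p : Param)

/-! ### The Casimir element -/

/-- The Casimir element `(q - q⁻¹)² F E + q K + q⁻¹ K⁻¹`. -/
def cas : Uq p := p.c • (F p * E p) + p.q • K p + p.q⁻¹ • Kinv p

theorem E_mul_F_eq : E p * F p = F p * E p + (p.q - p.q⁻¹)⁻¹ • (K p - Kinv p) := by
  rw [← E_mul_F]; abel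

theorem c_smul_E_mul_F :
    p.c • (E p * F p) = p.c • (F p * E p) + (p.q - p.q⁻¹) • (K p - Kinv p) := by
  rw [E_mul_F_eq, smul_add, smul_smul, Param.c, sq, mul_assoc,
    mul_inv_cancel₀ p.q_sub_inv_ne_zero, mul_one]

theorem cas_eq : cas p = p.c • (E p * F p) + p.q⁻¹ • K p + p.q • Kinv p := by
  rw [c_smul_E_mul_F, cas]; module

theorem cas_mul_K : cas p * K p = K p * cas p := by
  have h1 : F p * E p * K p = K p * (F p * E p) := by
    rw [mul_assoc, E_mul_K, mul_smul_comm, ← mul_assoc, F_mul_K, smul_mul_assoc, smul_smul,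
      inv_mul_cancel₀ (pow_ne_zero _ p.q_ne_zero), one_smul, mul_assoc]
  simp only [cas, add_mul, mul_add, smul_mul_assoc, mul_smul_comm, h1, K_mul_Kinv, Kinv_mul_K]

theorem cas_mul_E : cas p * E p = E p * cas p := by
  have hq := p.q_ne_zero
  have h1 : p.q⁻¹ * p.q ^ 2 = p.q := by field_simp
  have h2 : p.q * (p.q ^ 2)⁻¹ = p.q⁻¹ := by field_simp
  rw [cas_eq, add_mul, add_mul, smul_mul_assoc, smul_mul_assoc, smul_mul_assoc, K_mul_E, Kinv_mul_E,
    ← cas_eq, cas, mul_add, mul_add, mul_smul_comm, mul_smul_comm, mul_smul_comm, mul_assoc,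
    smul_smul, smul_smul, h1, h2]

theorem cas_mul_F : cas p * F p = F p * cas p := by
  have hq := p.q_ne_zero
  have h1 : p.q⁻¹ * p.q ^ 2 = p.q := by field_simp
  have h2 : p.q * (p.q ^ 2)⁻¹ = p.q⁻¹ := by field_simp
  rw [cas, add_mul, add_mul, smul_mul_assoc, smul_mul_assoc, smul_mul_assoc, K_mul_F, Kinv_mul_F,
    ← cas, cas_eq, mul_add, mul_add, mul_smul_comm, mul_smul_comm, mul_smul_comm, mul_assoc,
    smul_smul, smul_smul, h1, h2]

theorem mem_center_of_commute {z : Uq p} (hE : z * E p = E p * z) (hF : z * F p = F p * z)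
    (hK : z * K p = K p * z) : z ∈ Subalgebra.center ℂ (Uq p) := by
  rw [Subalgebra.mem_center_iff]
  intro x
  induction x using induction with
  | hE => exact hE.symm
  | hF => exact hF.symm
  | hK => exact hK.symm
  | hc c => exact Algebra.commutes _ _
  | hadd x y hx hy => rw [add_mul, mul_add, hx, hy]
  | hmul x y hx hy => rw [mul_assoc, hy, ← mul_assoc, hx, mul_assoc]

theorem cas_mem_center : cas p ∈ Subalgebra.center ℂ (Uq p) :=
  mem_center_of_commute p (cas_mul_E p) (cas_mul_F p) (cas_mul_K p)

theorem aeval_cas_mem_center (f : ℂ[X]) : aeval (cas p) f ∈ Subalgebra.center ℂ (Uq p) := by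
  have := aeval_subalgebra_coe f (Subalgebra.center ℂ (Uq p)) ⟨cas p, cas_mem_center p⟩
  rw [← this]; exact Subtype.coe_prop _

theorem aeval_cas_comm (f : ℂ[X]) (x : Uq p) : x * aeval (cas p) f = aeval (cas p) f * x :=
  Subalgebra.mem_center_iff.1 (aeval_cas_mem_center p f) x

/-! ### The idempotents of the Cartan part -/

/-- The idempotent of `ℂ[K]` that projects onto the eigenspace of `K` for `q ^ k`. -/
def idem (k : ℤ) : Uq p :=
  (1 / (p.l : ℂ)) • ∑ j ∈ Finset.range p.l, (p.q ^ (-k) • K p) ^ j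

theorem K_mul_idem (k : ℤ) : K p * idem p k = p.q ^ k • idem p k := by
  have h1 : (p.q ^ (-k) • K p) ^ p.l = 1 := by
    rw [smul_pow, K_pow, ← zpow_natCast, ← zpow_mul, (p.zpow_eq_one_iff _).2 (dvd_mul_left _ _),
      one_smul]
  have h2 := mul_neg_geom_sum (p.q ^ (-k) • K p) p.l
  rw [h1, sub_self, sub_mul, one_mul, sub_eq_zero, smul_mul_assoc] at h2
  rw [idem, mul_smul_comm, smul_comm]
  congr 1
  conv_rhs => rw [h2]
  rw [smul_smul, ← p.zpow_add, add_neg_cancel, zpow_zero, one_smul]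

theorem K_pow_mul_idem (n : ℕ) (k : ℤ) : K p ^ n * idem p k = p.q ^ (k * n) • idem p k := by
  induction n with
  | zero => simp
  | succ n ih =>
    rw [pow_succ, mul_assoc, K_mul_idem, mul_smul_comm, ih, smul_smul, ← p.zpow_add]
    congr 2; push_cast; ring

theorem Kinv_mul_idem (k : ℤ) : Kinv p * idem p k = p.q ^ (-k) • idem p k := by
  have : Kinv p * (K p * idem p k) = idem p k := by rw [← mul_assoc, Kinv_mul_K, one_mul]
  rw [K_mul_idem, mul_smul_comm] at this
  conv_rhs => rw [← this]
  rw [smul_smul, ← p.zpow_add, neg_add_cancel, zpow_zero, one_smul]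

theorem idem_mul_K (k : ℤ) : idem p k * K p = K p * idem p k := by
  simp only [idem, smul_mul_assoc, mul_smul_comm, Finset.sum_mul, Finset.mul_sum, smul_pow]
  simp only [← pow_succ, ← pow_succ']

theorem E_mul_idem (k : ℤ) : E p * idem p k = idem p (k + 2) * E p := by
  have h : SemiconjBy (E p) (p.q ^ (-k) • K p) (p.q ^ (-(k + 2)) • K p) := by
    rw [SemiconjBy, mul_smul_comm, E_mul_K, smul_mul_assoc, smul_smul]
    congr 1
    rw [neg_add, p.zpow_add, zpow_neg _ 2]; rfl
  simp only [idem, smul_mul_assoc, mul_smul_comm, Finset.sum_mul, Finset.mul_sum]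
  congr 1
  exact Finset.sum_congr rfl fun j _ => h.pow_right j

theorem F_mul_idem (k : ℤ) : F p * idem p k = idem p (k - 2) * F p := by
  have h : SemiconjBy (F p) (p.q ^ (-k) • K p) (p.q ^ (-(k - 2)) • K p) := by
    rw [SemiconjBy, mul_smul_comm, F_mul_K, smul_mul_assoc, smul_smul]
    congr 1
    rw [neg_sub, sub_eq_neg_add, p.zpow_add]; rfl
  simp only [idem, smul_mul_assoc, mul_smul_comm, Finset.sum_mul, Finset.mul_sum]
  congr 1
  exact Finset.sum_congr rfl fun j _ => h.pow_right j

theorem E_pow_mul_idem (n : ℕ) (k : ℤ) : E p ^ n * idem p k = idem p (k + 2 * n) * E p ^ n := by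
  induction n generalizing k with
  | zero => simp
  | succ n ih =>
    rw [pow_succ, mul_assoc, E_mul_idem, ← mul_assoc, ih, mul_assoc, ← pow_succ]
    congr 2; push_cast; ring

theorem F_pow_mul_idem (n : ℕ) (k : ℤ) : F p ^ n * idem p k = idem p (k - 2 * n) * F p ^ n := by
  induction n generalizing k with
  | zero => simp
  | succ n ih =>
    rw [pow_succ, mul_assoc, F_mul_idem, ← mul_assoc, ih, mul_assoc, ← pow_succ]
    congr 2; push_cast; ring

theorem sum_idem : ∑ k ∈ Finset.range p.l, idem p k = 1 := by
  simp only [idem]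
  rw [← Finset.smul_sum, Finset.sum_comm]
  have h : ∀ j ∈ Finset.range p.l, ∑ k ∈ Finset.range p.l, (p.q ^ (-(k : ℤ)) • K p) ^ j =
      if j = 0 then (p.l : ℂ) • 1 else 0 := by
    intro j hj
    have hj := Finset.mem_range.1 hj
    have e : ∀ k : ℕ, (p.q ^ (-(k : ℤ)) • K p) ^ j = p.q ^ (-(j : ℤ) * (k : ℤ)) • K p ^ j :=
      fun k => by
        rw [smul_pow, ← zpow_natCast, ← zpow_mul]; congr 2; ring
    simp only [e]
    rw [← Finset.sum_smul, p.sum_zpow_mul]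
    split_ifs with h1 h2 h2
    · simp [h2]
    · have := Int.le_of_dvd (by omega) ((dvd_neg).1 h1)
      omega
    · exact absurd (by simp [h2]) h1
    · exact zero_smul _ _
  rw [Finset.sum_congr rfl h, Finset.sum_ite_eq' , if_pos (Finset.mem_range.2 p.l_pos), smul_smul,
    one_div, inv_mul_cancel₀ p.l_ne_zero, one_smul]

/-- An identity in the algebra may be checked on each eigenspace of `K`. -/
theorem ext_idem {x y : Uq p} (h : ∀ k : ℤ, x * idem p k = y * idem p k) : x = y := by
  rw [← mul_one x, ← mul_one y, ← sum_idem, Finset.mul_sum, Finset.mul_sum]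
  exact Finset.sum_congr rfl fun k _ => h k

/-! ### Products of `E` and `F` on a weight space -/

theorem FE_mul_idem (k : ℤ) :
    p.c • (F p * E p * idem p k) = aeval (cas p) (X - C (p.bet (k + 1))) * idem p k := by
  rw [map_sub, aeval_X, aeval_C, sub_mul, ← Algebra.smul_def, cas, add_mul, add_mul,
    smul_mul_assoc, smul_mul_assoc, smul_mul_assoc, K_mul_idem, Kinv_mul_idem, smul_smul,
    smul_smul, Param.bet, neg_add, p.zpow_add, p.zpow_add, zpow_one, zpow_neg_one]
  module

theorem EF_mul_idem (k : ℤ) :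
    p.c • (E p * F p * idem p k) = aeval (cas p) (X - C (p.bet (k - 1))) * idem p k := by
  rw [map_sub, aeval_X, aeval_C, sub_mul, ← Algebra.smul_def, cas_eq, add_mul, add_mul,
    smul_mul_assoc, smul_mul_assoc, smul_mul_assoc, K_mul_idem, Kinv_mul_idem, smul_smul,
    smul_smul, Param.bet, neg_sub, sub_eq_neg_add, sub_eq_neg_add, sub_eq_add_neg, p.zpow_add,
    p.zpow_add, zpow_one, zpow_neg_one]
  module

theorem F_pow_E_pow_mul_idem (n : ℕ) (k : ℤ) :
    p.c ^ n • (F p ^ n * E p ^ n * idem p k) =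
      aeval (cas p) (∏ i ∈ Finset.range n, (X - C (p.bet (k + 1 + 2 * i)))) * idem p k := by
  induction n with
  | zero => simp
  | succ n ih =>
    have h1 : F p ^ (n + 1) * E p ^ (n + 1) * idem p k =
        F p ^ n * (F p * E p * idem p (k + 2 * n)) * E p ^ n := by
      rw [pow_succ (F p), pow_succ' (E p)]
      simp only [mul_assoc]
      rw [E_pow_mul_idem]
    calc p.c ^ (n + 1) • (F p ^ (n + 1) * E p ^ (n + 1) * idem p k)
        = p.c ^ n • (F p ^ n * (p.c • (F p * E p * idem p (k + 2 * n))) * E p ^ n) := by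
          rw [h1, pow_succ, mul_smul, mul_smul_comm, smul_mul_assoc]
      _ = aeval (cas p) (X - C (p.bet (k + 2 * n + 1))) *
            p.c ^ n • (F p ^ n * E p ^ n * idem p k) := by
          rw [FE_mul_idem, ← mul_assoc, aeval_cas_comm, mul_assoc, mul_assoc, mul_assoc,
            ← E_pow_mul_idem, ← mul_assoc (F p ^ n), mul_smul_comm]
      _ = _ := by
          rw [ih, ← mul_assoc, ← map_mul, Finset.prod_range_succ, mul_comm,
            show k + 2 * (n : ℤ) + 1 = k + 1 + 2 * n by ring]

theorem E_pow_F_pow_mul_idem (n : ℕ) (k : ℤ) :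
    p.c ^ n • (E p ^ n * F p ^ n * idem p k) =
      aeval (cas p) (∏ i ∈ Finset.range n, (X - C (p.bet (k - 1 - 2 * i)))) * idem p k := by
  induction n with
  | zero => simp
  | succ n ih =>
    have h1 : E p ^ (n + 1) * F p ^ (n + 1) * idem p k =
        E p ^ n * (E p * F p * idem p (k - 2 * n)) * F p ^ n := by
      rw [pow_succ (E p), pow_succ' (F p)]
      simp only [mul_assoc]
      rw [F_pow_mul_idem]
    calc p.c ^ (n + 1) • (E p ^ (n + 1) * F p ^ (n + 1) * idem p k)
        = p.c ^ n • (E p ^ n * (p.c • (E p * F p * idem p (k - 2 * n))) * F p ^ n) := by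
          rw [h1, pow_succ, mul_smul, mul_smul_comm, smul_mul_assoc]
      _ = aeval (cas p) (X - C (p.bet (k - 2 * n - 1))) *
            p.c ^ n • (E p ^ n * F p ^ n * idem p k) := by
          rw [EF_mul_idem, ← mul_assoc, aeval_cas_comm, mul_assoc, mul_assoc, mul_assoc,
            ← F_pow_mul_idem, ← mul_assoc (E p ^ n), mul_smul_comm]
      _ = _ := by
          rw [ih, ← mul_assoc, ← map_mul, Finset.prod_range_succ, mul_comm,
            show k - 2 * (n : ℤ) - 1 = k - 1 - 2 * n by ring]

/-- Expand `F ^ l E ^ l = 0` on each eigenspace of `K`. -/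
theorem aeval_minpol : aeval (cas p) p.minpol = 0 := by
  refine ext_idem p fun k => ?_
  rw [← p.prod_nodes (k + 1), ← F_pow_E_pow_mul_idem, E_pow, mul_zero, zero_mul, smul_zero]

/-! ### A spanning set -/

/-- The algebra is spanned by the products of a polynomial in the Casimir element, a power of one of
`E`, `F`, and an idempotent of `ℂ[K]`. -/
theorem span_induction {P : Uq p → Prop}
    (hE : ∀ (f : ℂ[X]) (n : ℕ) (k : ℤ), P (aeval (cas p) f * (E p ^ n * idem p k)))
    (hF : ∀ (f : ℂ[X]) (n : ℕ) (k : ℤ), P (aeval (cas p) f * (F p ^ n * idem p k)))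
    (hadd : ∀ x y, P x → P y → P (x + y)) (x : Uq p) : P x := by
  let s : Set (Uq p) := {y | ∃ (f : ℂ[X]) (n : ℕ) (k : ℤ),
    y = aeval (cas p) f * (E p ^ n * idem p k) ∨ y = aeval (cas p) f * (F p ^ n * idem p k)}
  have hs : ∀ (f : ℂ[X]) (n : ℕ) (k : ℤ),
      aeval (cas p) f * (E p ^ n * idem p k) ∈ AddSubmonoid.closure s :=
    fun f n k => AddSubmonoid.subset_closure ⟨f, n, k, Or.inl rfl⟩
  have hs' : ∀ (f : ℂ[X]) (n : ℕ) (k : ℤ),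
      aeval (cas p) f * (F p ^ n * idem p k) ∈ AddSubmonoid.closure s :=
    fun f n k => AddSubmonoid.subset_closure ⟨f, n, k, Or.inr rfl⟩
  have hc : p.c⁻¹ * p.c = 1 := inv_mul_cancel₀ p.c_ne_zero
  have hFE : ∀ j, F p * E p * idem p j =
      aeval (cas p) (C p.c⁻¹ * (X - C (p.bet (j + 1)))) * idem p j := fun j => by
    rw [map_mul, mul_assoc (aeval _ _), ← FE_mul_idem, aeval_C, ← Algebra.smul_def, smul_smul, hc, one_smul]
  have hEF : ∀ j, E p * F p * idem p j =
      aeval (cas p) (C p.c⁻¹ * (X - C (p.bet (j - 1)))) * idem p j := fun j => by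
    rw [map_mul, mul_assoc (aeval _ _), ← EF_mul_idem, aeval_C, ← Algebra.smul_def, smul_smul, hc, one_smul]
  have key : ∀ x : Uq p, ∀ y ∈ AddSubmonoid.closure s, x * y ∈ AddSubmonoid.closure s := by
    have red : ∀ x : Uq p, (∀ y ∈ s, x * y ∈ AddSubmonoid.closure s) →
        ∀ y ∈ AddSubmonoid.closure s, x * y ∈ AddSubmonoid.closure s := by
      intro x h y hy
      induction hy using AddSubmonoid.closure_induction with
      | mem y hy => exact h y hy
      | zero => simp
      | add y z _ _ hy hz => rw [mul_add]; exact add_mem hy hz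
    intro x
    induction x using induction with
    | hE =>
      refine red _ ?_
      rintro y ⟨f, n, k, rfl | rfl⟩
      · rw [← mul_assoc, aeval_cas_comm, mul_assoc, ← mul_assoc (E p), ← pow_succ']
        exact hs _ _ _
      · rw [← mul_assoc, aeval_cas_comm, mul_assoc]
        cases n with
        | zero =>
          rw [pow_zero, one_mul, ← pow_one (E p)]
          exact hs _ _ _
        | succ n =>
          rw [pow_succ', mul_assoc, F_pow_mul_idem, ← mul_assoc (F p), ← mul_assoc (E p), ← mul_assoc (E p),
            hEF, mul_assoc _ (idem p _), ← F_pow_mul_idem, ← mul_assoc, ← map_mul]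
          exact hs' _ _ _
    | hF =>
      refine red _ ?_
      rintro y ⟨f, n, k, rfl | rfl⟩
      · rw [← mul_assoc, aeval_cas_comm, mul_assoc]
        cases n with
        | zero =>
          rw [pow_zero, one_mul, ← pow_one (F p)]
          exact hs' _ _ _
        | succ n =>
          rw [pow_succ', mul_assoc, E_pow_mul_idem, ← mul_assoc (E p), ← mul_assoc (F p), ← mul_assoc (F p),
            hFE, mul_assoc _ (idem p _), ← E_pow_mul_idem, ← mul_assoc, ← map_mul]
          exact hs _ _ _
      · rw [← mul_assoc, aeval_cas_comm, mul_assoc, ← mul_assoc (F p), ← pow_succ']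
        exact hs' _ _ _
    | hK =>
      refine red _ ?_
      rintro y ⟨f, n, k, rfl | rfl⟩
      · rw [← mul_assoc, aeval_cas_comm, mul_assoc, E_pow_mul_idem, ← mul_assoc (K p), K_mul_idem,
          smul_mul_assoc, ← E_pow_mul_idem, mul_smul_comm, ← smul_mul_assoc, ← map_smul]
        exact hs _ _ _
      · rw [← mul_assoc, aeval_cas_comm, mul_assoc, F_pow_mul_idem, ← mul_assoc (K p), K_mul_idem,
          smul_mul_assoc, ← F_pow_mul_idem, mul_smul_comm, ← smul_mul_assoc, ← map_smul]
        exact hs' _ _ _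
    | hc c =>
      refine red _ ?_
      rintro y ⟨f, n, k, rfl | rfl⟩
      · rw [← Algebra.smul_def, ← smul_mul_assoc, ← map_smul]
        exact hs _ _ _
      · rw [← Algebra.smul_def, ← smul_mul_assoc, ← map_smul]
        exact hs' _ _ _
    | hadd x y hx hy => intro z hz; rw [add_mul]; exact add_mem (hx z hz) (hy z hz)
    | hmul x y hx hy => intro z hz; rw [mul_assoc]; exact hx _ (hy z hz)
  have h1 : (1 : Uq p) ∈ AddSubmonoid.closure s := by
    rw [← sum_idem]
    exact sum_mem fun k _ => by simpa using hs 1 0 k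
  have hx := key x 1 h1
  rw [mul_one] at hx
  induction hx using AddSubmonoid.closure_induction with
  | mem y hy =>
    obtain ⟨f, n, k, rfl | rfl⟩ := hy
    · exact hE f n k
    · exact hF f n k
  | zero => simpa using hE 0 0 0
  | add y z _ _ hy hz => exact hadd y z hy hz

end Uq

end SmallQuantum

end

noncomputable section

open Polynomial hiding smul_pow

namespace SmallQuantum

/-! ### Chebyshev polynomials in Newton form -/

namespace Param

variable (p : Param)

/-- The balanced `q`-binomial coefficient `[n + m choose m]`. -/
def qBinom (n m : ℕ) : ℂ := (∏ i ∈ Finset.range m, p.qInt (n + 1 + i)) / p.qFact m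

theorem qBinom_zero (n : ℕ) : p.qBinom n 0 = 1 := by simp [qBinom, qFact]

theorem qBinom_zero_left {m : ℕ} (hm : m < p.l) : p.qBinom 0 m = 1 := by
  have := p.qFact_ne_zero hm
  rw [qBinom, div_eq_one_iff_eq this, qFact]
  exact Finset.prod_congr rfl fun i _ => by congr 1; push_cast; ring

/-- The two signs give the two forms of the `q`-Pascal rule. -/
theorem qInt_pascal {e : ℤ} (he : e = 1 ∨ e = -1) (a b : ℤ) :
    p.qInt (a + b) - p.q ^ (-e * b) * p.qInt a = p.q ^ (e * a) * p.qInt b := by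
  have := p.q_sub_inv_ne_zero
  have h : ∀ x y : ℤ, p.q ^ (x + y) = p.q ^ x * p.q ^ y := p.zpow_add
  have h1 : p.q ^ b * p.q ^ (-b) = 1 := by rw [← h]; simp
  have h2 : p.q ^ a * p.q ^ (-a) = 1 := by rw [← h]; simp
  simp only [qInt]
  rw [mul_div_assoc', mul_div_assoc', ← sub_div]
  congr 1
  rcases he with rfl | rfl
  · simp only [neg_add, h, one_mul, neg_mul]
    ring
  · simp only [neg_add, h, one_mul, neg_mul, neg_neg]
    ring

theorem qBinom_pascal {e : ℤ} (he : e = 1 ∨ e = -1) (n : ℕ) {m : ℕ} (hm : m + 1 < p.l) :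
    p.qBinom (n + 1) (m + 1) - p.q ^ (-e * (m + 1)) * p.qBinom n (m + 1) =
      p.q ^ (e * (n + 1)) * p.qBinom (n + 1) m := by
  have h1 := p.qFact_ne_zero (show m < p.l by omega)
  have h2 : p.qInt ((m : ℤ) + 1) ≠ 0 := by exact_mod_cast p.qInt_ne_zero (n := m + 1) (by omega) hm
  have h3 := p.qInt_pascal he (n + 1) (m + 1)
  have e1 : p.qFact (m + 1) = p.qFact m * p.qInt ((m : ℤ) + 1) := by
    simp only [qFact]; rw [Finset.prod_range_succ]
  have e2 : ∏ i ∈ Finset.range (m + 1), p.qInt ((n + 1 : ℕ) + 1 + i) =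
      (∏ i ∈ Finset.range m, p.qInt ((n + 1 : ℕ) + 1 + i)) * p.qInt ((n + 1) + (m + 1)) := by
    rw [Finset.prod_range_succ]; congr 2; push_cast; ring
  have e3 : ∏ i ∈ Finset.range (m + 1), p.qInt (n + 1 + i) =
      (∏ i ∈ Finset.range m, p.qInt ((n + 1 : ℕ) + 1 + i)) * p.qInt (n + 1) := by
    rw [Finset.prod_range_succ']
    congr 1
    · exact Finset.prod_congr rfl fun i _ => by congr 1; push_cast; ring
  rw [qBinom, qBinom, qBinom, e1, e2, e3]
  field_simp
  linear_combination (∏ i ∈ Finset.range m, p.qInt ((n + 1 : ℕ) + 1 + i)) * h3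

/-- The generating series `∑ₙ [n + m choose m] q ^ (e n (k - 1 - m)) yⁿ`. By the `q`-binomial theorem
it is the inverse of the product of `1 - q ^ (e (k - 1 - 2i)) y`, `0 ≤ i ≤ m`. -/
def halfSeries (e k : ℤ) (m : ℕ) : PowerSeries ℂ :=
  PowerSeries.mk fun n => p.qBinom n m * p.q ^ (e * (n * (k - 1 - m)))

theorem halfSeries_zero_mul (e k : ℤ) :
    p.halfSeries e k 0 * (1 - PowerSeries.C (p.q ^ (e * (k - 1))) * PowerSeries.X) = 1 := by
  ext n
  rw [mul_sub, mul_one, mul_left_comm, map_sub, PowerSeries.coeff_C_mul]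
  cases n with
  | zero => simp [halfSeries, qBinom_zero]
  | succ n =>
    rw [PowerSeries.coeff_succ_mul_X, halfSeries, PowerSeries.coeff_mk, PowerSeries.coeff_mk,
      qBinom_zero, qBinom_zero, one_mul, one_mul, ← p.zpow_add, PowerSeries.coeff_one,
      if_neg (Nat.succ_ne_zero n), sub_eq_zero]
    congr 1; push_cast; ring

theorem halfSeries_succ_mul {e : ℤ} (he : e = 1 ∨ e = -1) (k : ℤ) {m : ℕ} (hm : m + 1 < p.l) :
    p.halfSeries e k (m + 1) *
      (1 - PowerSeries.C (p.q ^ (e * (k - 1 - 2 * (m + 1)))) * PowerSeries.X) =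
      p.halfSeries e k m := by
  ext n
  rw [mul_sub, mul_one, mul_left_comm, map_sub, PowerSeries.coeff_C_mul]
  cases n with
  | zero =>
    simp [halfSeries, qBinom_zero_left p hm, qBinom_zero_left p (show m < p.l by omega)]
  | succ n =>
    rw [PowerSeries.coeff_succ_mul_X]
    simp only [halfSeries, PowerSeries.coeff_mk]
    have h := p.qBinom_pascal he n hm
    have e1 : p.q ^ (e * (k - 1 - 2 * (m + 1))) * p.q ^ (e * (n * (k - 1 - ((m + 1 : ℕ) : ℤ)))) =
        p.q ^ (-e * (m + 1)) * p.q ^ (e * (((n + 1 : ℕ) : ℤ) * (k - 1 - ((m + 1 : ℕ) : ℤ)))) := by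
      rw [← p.zpow_add, ← p.zpow_add]; congr 1; push_cast; ring
    have e2 : p.q ^ (e * (((n + 1 : ℕ) : ℤ) * (k - 1 - m))) = p.q ^ (e * (n + 1)) *
        p.q ^ (e * (((n + 1 : ℕ) : ℤ) * (k - 1 - ((m + 1 : ℕ) : ℤ)))) := by
      rw [← p.zpow_add]; congr 1; push_cast; ring
    rw [e2]
    linear_combination p.q ^ (e * (((n + 1 : ℕ) : ℤ) * (k - 1 - ((m + 1 : ℕ) : ℤ)))) * h -
      p.qBinom n (m + 1) * e1

/-- The series `∏ᵢ (1 - (qᵃ + q⁻ᵃ) y + y²)⁻¹`, `a = k - 1 - 2i`, `0 ≤ i ≤ m`, whose coefficients are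
divided differences of Chebyshev polynomials. -/
def nodeSeries (k : ℤ) (m : ℕ) : PowerSeries ℂ := p.halfSeries 1 k m * p.halfSeries (-1) k m

theorem one_sub_bet (a : ℤ) :
    (1 - PowerSeries.C (p.bet a) * PowerSeries.X + PowerSeries.X ^ 2 : PowerSeries ℂ) =
      (1 - PowerSeries.C (p.q ^ (1 * a)) * PowerSeries.X) *
      (1 - PowerSeries.C (p.q ^ (-1 * a)) * PowerSeries.X) := by
  have h : (PowerSeries.C (p.q ^ a) * PowerSeries.C (p.q ^ (-a)) : PowerSeries ℂ) = 1 := by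
    rw [← map_mul, ← p.zpow_add, add_neg_cancel, zpow_zero, map_one]
  rw [bet, map_add, one_mul, neg_one_mul]
  linear_combination -PowerSeries.X ^ 2 * h

theorem nodeSeries_zero_mul (k : ℤ) :
    p.nodeSeries k 0 * (1 - PowerSeries.C (p.bet (k - 1)) * PowerSeries.X + PowerSeries.X ^ 2) =
      1 := by
  rw [one_sub_bet, nodeSeries, mul_mul_mul_comm, halfSeries_zero_mul, halfSeries_zero_mul, one_mul]

theorem nodeSeries_succ_mul (k : ℤ) {m : ℕ} (hm : m + 1 < p.l) :
    p.nodeSeries k (m + 1) * (1 - PowerSeries.C (p.bet (k - 1 - 2 * (m + 1))) * PowerSeries.X +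
      PowerSeries.X ^ 2) = p.nodeSeries k m := by
  rw [one_sub_bet, nodeSeries, mul_mul_mul_comm, halfSeries_succ_mul p (Or.inl rfl) k hm,
    halfSeries_succ_mul p (Or.inr rfl) k hm, nodeSeries]

/-- Newton interpolation of `1 / (1 - X y + y²)` at the nodes `X = qᵃ + q⁻ᵃ`, with its remainder. -/
theorem mul_sum_nodeSeries (k : ℤ) (M : ℕ) (hM : M < p.l) :
    (1 - PowerSeries.C (X : ℂ[X]) * PowerSeries.X + PowerSeries.X ^ 2) *
      ∑ m ∈ Finset.range (M + 1), PowerSeries.X ^ m *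
        (PowerSeries.C (∏ i ∈ Finset.range m, (X - C (p.bet (k - 1 - 2 * i)))) *
          PowerSeries.map C (p.nodeSeries k m)) =
      1 - PowerSeries.X ^ (M + 1) *
        (PowerSeries.C (∏ i ∈ Finset.range (M + 1), (X - C (p.bet (k - 1 - 2 * i)))) *
          PowerSeries.map C (p.nodeSeries k M)) := by
  induction M with
  | zero =>
    have h := congrArg (PowerSeries.map (C : ℂ →+* ℂ[X])) (p.nodeSeries_zero_mul k)
    simp only [map_mul, map_add, map_sub, map_one, map_pow, PowerSeries.map_C, PowerSeries.map_X]
      at h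
    simp only [zero_add, Finset.sum_range_one, Finset.prod_range_zero, Finset.prod_range_one,
      pow_zero, map_one, one_mul, pow_one, map_sub, Nat.cast_zero, mul_zero, sub_zero]
    linear_combination h
  | succ M ih =>
    have h := congrArg (PowerSeries.map (C : ℂ →+* ℂ[X])) (p.nodeSeries_succ_mul k hM)
    simp only [map_mul, map_add, map_sub, map_one, map_pow, PowerSeries.map_C, PowerSeries.map_X]
      at h
    rw [Finset.sum_range_succ, mul_add, ih (by omega), Finset.prod_range_succ _ (M + 1)]
    simp only [map_mul, map_sub, Nat.cast_add, Nat.cast_one]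
    linear_combination (PowerSeries.X ^ (M + 1) *
      PowerSeries.C (∏ i ∈ Finset.range (M + 1), (X - C (p.bet (k - 1 - 2 * i))))) * h

end Param

/-- The series `1 / (1 - X y + y²)` generates the Chebyshev polynomials `S`; only the terms below
`y ^ l` are compared. -/
theorem coeff_of_mul_eq {H T : PowerSeries ℂ[X]} {l : ℕ}
    (h : (1 - PowerSeries.C (X : ℂ[X]) * PowerSeries.X + PowerSeries.X ^ 2) * H =
      1 - PowerSeries.X ^ l * T) (n : ℕ) (hn : n < l) :
    PowerSeries.coeff n H = Chebyshev.S ℂ n := by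
  have h' : ∀ n, PowerSeries.coeff n (H - PowerSeries.C (X : ℂ[X]) * (PowerSeries.X * H) +
      PowerSeries.X * (PowerSeries.X * H)) = PowerSeries.coeff n (1 - PowerSeries.X ^ l * T) := by
    intro n
    rw [← h]; congr 1; ring
  induction n using Nat.twoStepInduction with
  | zero =>
    have := h' 0
    rw [map_add, map_sub, map_sub, PowerSeries.coeff_C_mul, PowerSeries.coeff_zero_X_mul,
      PowerSeries.coeff_zero_X_mul, PowerSeries.coeff_X_pow_mul', if_neg (by omega)] at this
    simpa using this
  | one =>
    have := h' 1
    rw [map_add, map_sub, map_sub, PowerSeries.coeff_C_mul, PowerSeries.coeff_succ_X_mul 0,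
      PowerSeries.coeff_succ_X_mul 0, PowerSeries.coeff_zero_X_mul, PowerSeries.coeff_X_pow_mul',
      if_neg (by omega)] at this
    have h0 := h' 0
    rw [map_add, map_sub, map_sub, PowerSeries.coeff_C_mul, PowerSeries.coeff_zero_X_mul,
      PowerSeries.coeff_zero_X_mul, PowerSeries.coeff_X_pow_mul', if_neg (by omega)] at h0
    simp only [PowerSeries.coeff_one] at this h0
    rw [if_neg one_ne_zero] at this
    simp only [if_true] at h0
    push_cast
    rw [Chebyshev.S_one]
    linear_combination this + X * h0
  | more n h0 h1 =>
    have := h' (n + 2)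
    rw [map_add, map_sub, map_sub, PowerSeries.coeff_C_mul, PowerSeries.coeff_succ_X_mul (n + 1),
      PowerSeries.coeff_succ_X_mul (n + 1), PowerSeries.coeff_succ_X_mul n, h0 (by omega),
      h1 (by omega), PowerSeries.coeff_X_pow_mul', if_neg (by omega), PowerSeries.coeff_one,
      if_neg (by omega)] at this
    push_cast at this ⊢
    rw [Chebyshev.S_add_two]
    linear_combination this

/-- The Newton form of the Chebyshev polynomial `S_n`. -/
theorem Param.sum_coeff_nodeSeries (p : Param) (k : ℤ) (n : ℕ) (hn : n < p.l) :
    ∑ m ∈ Finset.range p.l, C (if m ≤ n then PowerSeries.coeff (n - m) (p.nodeSeries k m) else 0) *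
      ∏ i ∈ Finset.range m, (X - C (p.bet (k - 1 - 2 * i))) = Chebyshev.S ℂ n := by
  have hl := p.l_pos
  have h := p.mul_sum_nodeSeries k (p.l - 1) (by omega)
  rw [Nat.sub_add_cancel hl] at h
  rw [← coeff_of_mul_eq h n hn, map_sum]
  refine Finset.sum_congr rfl fun m _ => ?_
  rw [PowerSeries.coeff_X_pow_mul', mul_comm]
  split_ifs
  · rw [PowerSeries.coeff_C_mul, PowerSeries.coeff_map]
  · simp

end SmallQuantum

end

noncomputable section

open Polynomial hiding smul_pow

namespace SmallQuantum

/-! ### The `q`-characters -/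

section Simple

variable (p : Param) (r : ℕ)

theorem matK_pow_apply (s : ℕ) :
    matK p r ^ s = Matrix.diagonal fun n : Fin r => p.q ^ (((r : ℤ) - 1 - 2 * (n : ℤ)) * s) := by
  rw [matK, Matrix.diagonal_pow]
  congr 1
  funext n
  rw [Pi.pow_apply, ← zpow_natCast, ← zpow_mul]

theorem matF_apply (i j : Fin r) : matF r i j = if (i : ℕ) = j + 1 then 1 else 0 := rfl

theorem matE_apply (i j : Fin r) :
    matE p r i j = if (i : ℕ) + 1 = j then p.qInt j * p.qInt (r - j) else 0 := rfl

theorem matF_pow_apply (n : ℕ) (i j : Fin r) :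
    (matF r ^ n) i j = if (i : ℕ) = j + n then 1 else 0 := by
  induction n generalizing i with
  | zero => simp [Matrix.one_apply, Fin.ext_iff]
  | succ n ih =>
    rw [pow_succ', Matrix.mul_apply]
    simp only [ih, matF_apply, ite_mul, one_mul, zero_mul]
    by_cases h : (i : ℕ) = j + (n + 1)
    · rw [if_pos h, Finset.sum_eq_single ⟨j + n, by omega⟩]
      · rw [if_pos (by simp only; omega), if_pos rfl]
      · intro b _ hb
        have : (b : ℕ) ≠ j + n := fun h => hb (Fin.ext h)
        split_ifs <;> rfl
      · simp
    · rw [if_neg h]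
      refine Finset.sum_eq_zero fun b _ => ?_
      split_ifs <;> first | rfl | omega

theorem matE_pow_apply (n : ℕ) (i j : Fin r) :
    (matE p r ^ n) i j = if (i : ℕ) + n = j then
      ∏ s ∈ Finset.range n, p.qInt ((j : ℤ) - s) * p.qInt (r - ((j : ℤ) - s)) else 0 := by
  induction n generalizing j with
  | zero => simp [Matrix.one_apply, Fin.ext_iff]
  | succ n ih =>
    rw [pow_succ, Matrix.mul_apply]
    simp only [ih, matE_apply, ite_mul, mul_ite, zero_mul, mul_zero]
    by_cases h : (i : ℕ) + (n + 1) = j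
    · rw [if_pos h, Finset.sum_eq_single ⟨i + n, by omega⟩]
      · rw [if_pos (by simp only; omega), if_pos rfl, Finset.prod_range_succ']
        congr 1
        · refine Finset.prod_congr rfl fun s _ => ?_
          have : ((j : ℕ) : ℤ) = i + n + 1 := by omega
          rw [this]; push_cast
          congr 2 <;> ring
      · intro b _ hb
        have : (b : ℕ) ≠ i + n := fun h => hb (Fin.ext h)
        split_ifs <;> first | rfl | omega
      · simp
    · rw [if_neg h]
      refine Finset.sum_eq_zero fun b _ => ?_
      split_ifs <;> first | rfl | omega

theorem matF_pow_mul_matE_pow_apply (m n : ℕ) (t : Fin r) :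
    (matF r ^ m * matE p r ^ n) t t = if m = n then
      ∏ s ∈ Finset.range m, p.qInt ((t : ℤ) - s) * p.qInt (r - ((t : ℤ) - s)) else 0 := by
  rw [Matrix.mul_apply]
  simp only [matF_pow_apply, matE_pow_apply, ite_mul, one_mul, zero_mul]
  by_cases h : m = n
  · subst h
    rw [if_pos rfl]
    by_cases hm : m ≤ t
    · rw [Finset.sum_eq_single ⟨t - m, by omega⟩]
      · rw [if_pos (by simp only; omega), if_pos (by simp only; omega)]
      · intro b _ hb
        have : (b : ℕ) ≠ t - m := fun h => hb (Fin.ext h)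
        rw [if_neg (by omega)]
      · simp
    · rw [Finset.sum_eq_zero, eq_comm, Finset.prod_eq_zero (Finset.mem_range.2 (not_le.1 hm))]
      · rw [sub_self, p.qInt_zero, zero_mul]
      · intro b _
        rw [if_neg (by omega)]
  · rw [if_neg h]
    refine Finset.sum_eq_zero fun b _ => ?_
    split_ifs <;> first | rfl | omega

variable {r}

@[simp] theorem simpleRep_E (hr : r ≤ p.l) : simpleRep p r hr (Uq.E p) = matE p r := Uq.lift_E
@[simp] theorem simpleRep_F (hr : r ≤ p.l) : simpleRep p r hr (Uq.F p) = matF r := Uq.lift_F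
@[simp] theorem simpleRep_K (hr : r ≤ p.l) : simpleRep p r hr (Uq.K p) = matK p r := Uq.lift_K

theorem simpleRep_Kinv (hr : r ≤ p.l) : simpleRep p r hr (Uq.Kinv p) =
    Matrix.diagonal fun n : Fin r => p.q ^ (-((r : ℤ) - 1 - 2 * (n : ℤ))) := by
  rw [Uq.Kinv, map_pow, simpleRep_K, matK_pow_pred]

theorem qCh_apply (hr : r ≤ p.l) (x : Uq p) :
    qCh p r hr x = Matrix.trace (simpleRep p r hr (Uq.Kinv p) * simpleRep p r hr x) := by
  simp [qCh]

/-- The `q`-character vanishes on `Fᵐ Eⁿ Kˢ` unless this product preserves weights, that is, `m = n`. -/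
theorem qCh_F_E_K (hr : r ≤ p.l) (m n s : ℕ) :
    qCh p r hr (Uq.F p ^ m * Uq.E p ^ n * Uq.K p ^ s) = if m = n then
      ∑ t : Fin r, p.q ^ (((r : ℤ) - 1 - 2 * (t : ℤ)) * (s - 1)) *
        ∏ i ∈ Finset.range m, p.qInt ((t : ℤ) - i) * p.qInt (r - ((t : ℤ) - i)) else 0 := by
  rw [qCh_apply, simpleRep_Kinv]
  simp only [map_mul, map_pow, simpleRep_E, simpleRep_F, simpleRep_K, matK_pow_apply]
  have : ∀ t : Fin r, (Matrix.diagonal (fun n : Fin r => p.q ^ (-((r : ℤ) - 1 - 2 * (n : ℤ)))) *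
      (matF r ^ m * matE p r ^ n *
        Matrix.diagonal fun n : Fin r => p.q ^ (((r : ℤ) - 1 - 2 * (n : ℤ)) * s))) t t =
      if m = n then p.q ^ (((r : ℤ) - 1 - 2 * (t : ℤ)) * (s - 1)) *
        ∏ i ∈ Finset.range m, p.qInt ((t : ℤ) - i) * p.qInt (r - ((t : ℤ) - i)) else 0 := by
    intro t
    rw [Matrix.diagonal_mul, Matrix.mul_diagonal, matF_pow_mul_matE_pow_apply]
    split_ifs
    · rw [mul_sub, mul_one, sub_eq_neg_add _ ((r : ℤ) - 1 - 2 * t), p.zpow_add]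
      ring
    · simp
  rw [Matrix.trace]
  simp only [Matrix.diag_apply, this]
  split_ifs
  · rfl
  · simp

end Simple

/-! ### The Drinfeld images of the `q`-characters -/

section Drinfeld

variable (p : Param)

/-- The coefficients of the `R`-matrix. -/
def rCoeff (m i j : ℕ) : ℂ :=
  (1 / (p.l : ℂ)) * ((p.q - p.q⁻¹) ^ m / p.qFact m) *
    p.q ^ ((m : ℤ) * (m - 1) / 2 + 2 * m * (i - j) - 2 * i * j)

open Uq

/-- The contraction as a linear function of the tensor. -/
def contractWith {H : Type*} [Ring H] [HopfAlgebra ℂ H] (β : Module.Dual ℂ H) : H ⊗[ℂ] H →ₗ[ℂ] H :=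
  (TensorProduct.lid ℂ H).toLinearMap ∘ₗ β.rTensor H

theorem contractLeft_apply {H : Type*} [Ring H] [HopfAlgebra ℂ H] (t : H ⊗[ℂ] H)
    (β : Module.Dual ℂ H) : HopfMaps.contractLeft t β = contractWith β t := rfl

@[simp] theorem contractWith_tmul {H : Type*} [Ring H] [HopfAlgebra ℂ H] (β : Module.Dual ℂ H)
    (x y : H) : contractWith β (x ⊗ₜ[ℂ] y) = β x • y := by
  simp [contractWith]

theorem drinfeldMap_rMatrix (β : Module.Dual ℂ (Uq p)) :
    HopfMaps.drinfeldMap (rMatrix p) β =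
      ∑ m ∈ Finset.range p.l, ∑ n ∈ Finset.range p.l,
      ∑ i ∈ Finset.range p.l, ∑ j ∈ Finset.range p.l,
      ∑ a ∈ Finset.range p.l, ∑ b ∈ Finset.range p.l,
        (rCoeff p m i j * rCoeff p n a b * β (F p ^ m * K p ^ j * (E p ^ n * K p ^ a))) •
          (E p ^ m * K p ^ i * (F p ^ n * K p ^ b)) := by
  have hR : rMatrix p = ∑ m ∈ Finset.range p.l, ∑ i ∈ Finset.range p.l, ∑ j ∈ Finset.range p.l,
    rCoeff p m i j • ((E p ^ m * K p ^ i) ⊗ₜ[ℂ] (F p ^ m * K p ^ j)) := rfl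
  rw [HopfMaps.drinfeldMap, contractLeft_apply, HopfMaps.drinfeldMatrix, hR]
  simp only [map_sum, map_smul, TensorProduct.comm_tmul, Finset.sum_mul]
  refine Finset.sum_congr rfl fun m _ => ?_
  simp only [Finset.mul_sum, map_sum]
  rw [Finset.sum_congr rfl fun i _ => Finset.sum_comm, Finset.sum_comm]
  refine Finset.sum_congr rfl fun n _ => Finset.sum_congr rfl fun i _ =>
    Finset.sum_congr rfl fun j _ => Finset.sum_congr rfl fun a _ => Finset.sum_congr rfl fun b _ => ?_
  rw [smul_mul_smul_comm, map_smul, Algebra.TensorProduct.tmul_mul_tmul, contractWith_tmul, smul_smul]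

theorem K_pow_mul_E_pow (j n : ℕ) :
    K p ^ j * E p ^ n = p.q ^ (2 * (n : ℤ) * j) • (E p ^ n * K p ^ j) := by
  have h1 : ∀ j, K p ^ j * E p = (p.q ^ 2) ^ j • (E p * K p ^ j) := pow_mul_qcomm (K_mul_E p)
  rw [mul_pow_qcomm (h1 j) n]
  congr 1
  rw [mul_assoc, mul_comm (n : ℤ), ← mul_assoc, zpow_mul, zpow_mul, zpow_natCast, zpow_natCast]
  rfl

/-- The coefficient of `Eᵐ Fᵐ` in a Drinfeld image on the eigenspace of `K` for `q ^ k`. -/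
def chiCoeff (r : ℕ) (k : ℤ) (m : ℕ) : ℂ :=
  (∑ t : Fin r, p.q ^ (((r : ℤ) - 1 - 2 * t + m) * (k - m - 1)) *
    ∏ i ∈ Finset.range m, p.qInt ((t : ℤ) - i) * p.qInt (r - ((t : ℤ) - i))) / p.qFact m ^ 2

/-- The sums over the powers of `K` in `R₂₁` and in `R` are two double Gauss sums. -/
theorem sum_rCoeff (m : ℕ) (w k : ℤ) :
    ∑ i ∈ Finset.range p.l, ∑ j ∈ Finset.range p.l,
      ∑ a ∈ Finset.range p.l, ∑ b ∈ Finset.range p.l,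
        rCoeff p m i j * rCoeff p m a b * p.q ^ (2 * (m : ℤ) * j) *
          p.q ^ (w * ((j + a : ℕ) - 1)) * (p.q ^ ((k : ℤ) * b) * p.q ^ ((k - 2 * m) * i)) =
      p.c ^ m / p.qFact m ^ 2 * p.q ^ ((w + m) * (k - m - 1)) := by
  have hl := p.l_ne_zero
  have hm2 : ∃ d : ℤ, (m : ℤ) * (m - 1) / 2 = d ∧ 2 * d = m * (m - 1) :=
    ⟨_, rfl, Int.mul_ediv_cancel' (Int.even_mul_pred_self m).two_dvd⟩
  obtain ⟨d, hd, hd2⟩ := hm2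
  have hterm : ∀ i j a b : ℕ,
      rCoeff p m i j * rCoeff p m a b * p.q ^ (2 * (m : ℤ) * j) *
          p.q ^ (w * ((j + a : ℕ) - 1)) * (p.q ^ ((k : ℤ) * b) * p.q ^ ((k - 2 * m) * i)) =
      (p.c ^ m / p.qFact m ^ 2 / (p.l : ℂ) ^ 2 * p.q ^ (2 * d - w)) *
        (p.q ^ (-2 * (i : ℤ) * j + j * w + i * k) *
          p.q ^ (-2 * (a : ℤ) * b + b * (k - 2 * m) + a * (w + 2 * m))) := by
    intro i j a b
    rw [rCoeff, rCoeff, hd, Param.c, ← pow_mul, mul_comm 2 m, pow_mul]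
    have e : p.q ^ (d + 2 * (m : ℤ) * (i - j) - 2 * i * j) *
        p.q ^ (d + 2 * (m : ℤ) * (a - b) - 2 * a * b) * p.q ^ (2 * (m : ℤ) * j) *
          p.q ^ (w * ((j + a : ℕ) - 1)) * (p.q ^ ((k : ℤ) * b) * p.q ^ ((k - 2 * m) * i)) =
        p.q ^ (2 * d - w) * (p.q ^ (-2 * (i : ℤ) * j + j * w + i * k) *
          p.q ^ (-2 * (a : ℤ) * b + b * (k - 2 * m) + a * (w + 2 * m))) := by
      simp only [← p.zpow_add]
      congr 1; push_cast; ring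
    linear_combination (1 / (p.l : ℂ)) ^ 2 * ((p.q - p.q⁻¹) ^ m / p.qFact m) ^ 2 * e
  simp only [hterm]
  simp only [← Finset.mul_sum]
  simp only [← Finset.sum_mul]
  rw [p.sum_sum_zpow, p.sum_sum_zpow]
  have e : p.q ^ (2 * d - w) * (p.q ^ ((p.h + 1) * w * k : ℤ) *
      p.q ^ ((p.h + 1) * (k - 2 * m) * (w + 2 * m) : ℤ)) = p.q ^ ((w + m) * (k - m - 1)) := by
    simp only [← p.zpow_add]
    rw [p.zpow_eq_iff]
    refine ⟨w * k + m * k - m * w - 2 * m ^ 2, ?_⟩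
    have : (p.l : ℤ) = 2 * p.h + 1 := by simp [Param.l]
    rw [this]
    linear_combination hd2
  rw [← e]
  field_simp

/-- Only the terms of `R₂₁ R` with equal powers of `E` and `F` contribute to the trace. -/
theorem chi_mul_idem {r : ℕ} (hr : r ≤ p.l) (k : ℤ) :
    chi p r hr * idem p k =
      ∑ m ∈ Finset.range p.l, (p.c ^ m * chiCoeff p r k m) • (E p ^ m * F p ^ m * idem p k) := by
  rw [chi, drinfeldMap_rMatrix, Finset.sum_mul]
  refine Finset.sum_congr rfl fun m hm => ?_
  have h1 : ∀ n i j a b : ℕ,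
      (rCoeff p m i j * rCoeff p n a b *
        qCh p r hr (F p ^ m * K p ^ j * (E p ^ n * K p ^ a))) •
          (E p ^ m * K p ^ i * (F p ^ n * K p ^ b)) * idem p k =
      (if m = n then ∑ t : Fin r, rCoeff p m i j * rCoeff p n a b * p.q ^ (2 * (n : ℤ) * j) *
        p.q ^ (((r : ℤ) - 1 - 2 * t) * ((j + a : ℕ) - 1)) *
          (p.q ^ ((k : ℤ) * b) * p.q ^ ((k - 2 * n) * i)) *
          ∏ i ∈ Finset.range m, p.qInt ((t : ℤ) - i) * p.qInt (r - ((t : ℤ) - i)) else 0) •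
        (E p ^ m * F p ^ n * idem p k) := by
    intro n i j a b
    have e1 : F p ^ m * K p ^ j * (E p ^ n * K p ^ a) =
        p.q ^ (2 * (n : ℤ) * j) • (F p ^ m * E p ^ n * K p ^ (j + a)) := by
      rw [mul_assoc, ← mul_assoc (K p ^ j), K_pow_mul_E_pow, smul_mul_assoc, mul_smul_comm,
        pow_add, mul_assoc, mul_assoc, mul_assoc]
    have e2 : E p ^ m * K p ^ i * (F p ^ n * K p ^ b) * idem p k =
        (p.q ^ ((k : ℤ) * b) * p.q ^ ((k - 2 * n) * i)) • (E p ^ m * F p ^ n * idem p k) := by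
      rw [mul_assoc, mul_assoc, mul_assoc, K_pow_mul_idem, mul_smul_comm, mul_smul_comm,
        mul_smul_comm, F_pow_mul_idem, ← mul_assoc (K p ^ i), K_pow_mul_idem, smul_mul_assoc,
        mul_smul_comm, smul_smul, ← F_pow_mul_idem, mul_assoc]
    rw [e1, map_smul, smul_mul_assoc, e2, qCh_F_E_K, smul_smul]
    congr 1
    split_ifs
    · rw [smul_eq_mul, Finset.mul_sum, Finset.mul_sum, Finset.sum_mul]
      refine Finset.sum_congr rfl fun t _ => ?_
      ring
    · simp
  simp only [Finset.sum_mul, h1]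
  rw [Finset.sum_eq_single m]
  · simp only [if_true, ← Finset.sum_smul]
    congr 1
    rw [chiCoeff, mul_div_assoc', Finset.mul_sum, Finset.sum_div]
    have h2 : ∀ t : Fin r, p.c ^ m * (p.q ^ (((r : ℤ) - 1 - 2 * t + m) * (k - m - 1)) *
        ∏ i ∈ Finset.range m, p.qInt ((t : ℤ) - i) * p.qInt (r - ((t : ℤ) - i))) / p.qFact m ^ 2 =
        (∑ i ∈ Finset.range p.l, ∑ j ∈ Finset.range p.l,
          ∑ a ∈ Finset.range p.l, ∑ b ∈ Finset.range p.l,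
          rCoeff p m i j * rCoeff p m a b * p.q ^ (2 * (m : ℤ) * j) *
          p.q ^ (((r : ℤ) - 1 - 2 * t) * ((j + a : ℕ) - 1)) *
            (p.q ^ ((k : ℤ) * b) * p.q ^ ((k - 2 * m) * i))) *
        ∏ i ∈ Finset.range m, p.qInt ((t : ℤ) - i) * p.qInt (r - ((t : ℤ) - i)) := by
      intro t
      rw [sum_rCoeff]
      ring
    simp only [h2, Finset.sum_mul]
    simp only [Finset.sum_comm (s := (Finset.univ : Finset (Fin r)))]
  · intro n _ hn
    simp [hn.symm]
  · intro h
    exact absurd hm h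

/-- The trace over `V_r` is a convolution of `q`-binomial coefficients. -/
theorem chiCoeff_eq {r : ℕ} (hr : r + 1 ≤ p.l) (k : ℤ) {m : ℕ} (hm : m < p.l) :
    chiCoeff p (r + 1) k m =
      if m ≤ r then PowerSeries.coeff (r - m) (p.nodeSeries k m) else 0 := by
  have hf := p.qFact_ne_zero hm
  let g : ℕ → ℂ := fun t => p.q ^ (((r + 1 : ℕ) - 1 - 2 * t + m) * (k - m - 1)) *
    ∏ i ∈ Finset.range m, p.qInt ((t : ℤ) - i) * p.qInt ((r + 1 : ℕ) - ((t : ℤ) - i))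
  have hg0 : ∀ t, t < m → g t = 0 := fun t ht => by
    simp only [g]
    rw [Finset.prod_eq_zero (Finset.mem_range.2 ht), mul_zero]
    rw [sub_self, p.qInt_zero, zero_mul]
  have hdef : chiCoeff p (r + 1) k m = (∑ t ∈ Finset.range (r + 1), g t) / p.qFact m ^ 2 := by
    rw [chiCoeff, ← Fin.sum_univ_eq_sum_range]
  rw [hdef]
  split_ifs with h
  · obtain ⟨s, rfl⟩ := Nat.exists_eq_add_of_le h
    rw [add_assoc, Finset.sum_range_add, Finset.sum_eq_zero fun t ht => hg0 t (Finset.mem_range.1 ht),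
      zero_add, Param.nodeSeries, mul_comm (p.halfSeries 1 k m), PowerSeries.coeff_mul,
      Nat.add_sub_cancel_left, Finset.Nat.sum_antidiagonal_eq_sum_range_succ_mk, Finset.sum_div]
    refine Finset.sum_congr rfl fun a ha => ?_
    have ha := Finset.mem_range.1 ha
    obtain ⟨b, rfl⟩ := Nat.exists_eq_add_of_le (show a ≤ s by omega)
    simp only [Param.halfSeries, PowerSeries.coeff_mk, g, Nat.add_sub_cancel_left]
    have e1 : ∏ i ∈ Finset.range m,
        p.qInt (((m + a : ℕ) : ℤ) - i) * p.qInt ((m + (a + b) + 1 : ℕ) - (((m + a : ℕ) : ℤ) - i)) =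
        (p.qBinom a m * p.qFact m) * (p.qBinom b m * p.qFact m) := by
      rw [Finset.prod_mul_distrib, Param.qBinom, Param.qBinom, div_mul_cancel₀ _ hf,
        div_mul_cancel₀ _ hf]
      congr 1
      · rw [← Finset.prod_range_reflect]
        refine Finset.prod_congr rfl fun i hi => ?_
        have := Finset.mem_range.1 hi
        congr 1
        rw [Nat.cast_sub (by omega), Nat.cast_sub (by omega)]
        push_cast; ring
      · refine Finset.prod_congr rfl fun i _ => ?_
        congr 1
        push_cast; ring
    have e2 : p.q ^ ((((m + (a + b) + 1 : ℕ) : ℤ) - 1 - 2 * ((m + a : ℕ) : ℤ) + m) * (k - m - 1)) =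
        p.q ^ (-1 * ((a : ℤ) * (k - 1 - m))) * p.q ^ (1 * ((b : ℤ) * (k - 1 - m))) := by
      rw [← p.zpow_add]; congr 1; push_cast; ring
    rw [e1, e2]
    field_simp
  · rw [Finset.sum_eq_zero fun t ht => hg0 t (by have := Finset.mem_range.1 ht; omega), zero_div]

/-- The coefficients of `Eᵐ Fᵐ` are those of the Newton form of a Chebyshev polynomial. -/
theorem chi_eq {r : ℕ} (hr : r + 1 ≤ p.l) :
    chi p (r + 1) hr = aeval (cas p) (Chebyshev.S ℂ r) := by
  refine ext_idem p fun k => ?_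
  rw [chi_mul_idem, ← p.sum_coeff_nodeSeries k r (by omega), map_sum, Finset.sum_mul]
  refine Finset.sum_congr rfl fun m hm => ?_
  rw [map_mul, mul_assoc (aeval _ _), ← E_pow_F_pow_mul_idem, aeval_C, ← Algebra.smul_def, smul_smul,
    chiCoeff_eq p hr k (Finset.mem_range.1 hm), mul_comm]

end Drinfeld

end SmallQuantum

end

noncomputable section

open Polynomial hiding smul_pow

namespace SmallQuantum

/-! ### Independence of the powers of the Casimir element on a weight space -/

section Induced

variable (p : Param) (k : ℤ)

/-- The coordinate space of a module with basis `Fᵃ Eᵇ u`, `0 ≤ a, b < l`, a model of the left ideal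
generated by the idempotent of a weight. -/
abbrev IndSpace : Type := Fin p.l × Fin p.l → ℂ

/-- The basis vector that stands for `Fᵃ Eᵇ u`, `u` the cyclic vector; it is zero unless
`a, b < l`. -/
def indVec (a b : ℕ) : IndSpace p :=
  if h : a < p.l ∧ b < p.l then Pi.single (⟨a, h.1⟩, ⟨b, h.2⟩) 1 else 0

theorem indVec_of_le_left {a : ℕ} (h : p.l ≤ a) (b : ℕ) : indVec p a b = 0 := by
  rw [indVec, dif_neg (by omega)]

theorem indVec_of_le_right (a : ℕ) {b : ℕ} (h : p.l ≤ b) : indVec p a b = 0 := by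
  rw [indVec, dif_neg (by omega)]

theorem indVec_diag_apply (n : ℕ) (d : Fin p.l) :
    indVec p n n (d, d) = if n = d then 1 else 0 := by
  unfold indVec
  split_ifs with h1 h2 h2
  · subst h2; simp
  · rw [Pi.single_eq_of_ne]
    intro h
    exact h2 (by simpa using (congrArg (fun x => (x.1 : ℕ)) h).symm)
  · exact absurd d.isLt (by omega)
  · rfl

theorem indVec_ext {f g : Module.End ℂ (IndSpace p)}
    (h : ∀ a b, a < p.l → b < p.l → f (indVec p a b) = g (indVec p a b)) : f = g := by
  refine (Pi.basisFun ℂ (Fin p.l × Fin p.l)).ext ?_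
  rintro ⟨a, b⟩
  have := h a b a.isLt b.isLt
  rw [indVec, dif_pos ⟨a.isLt, b.isLt⟩] at this
  simpa using this

/-- The endomorphism with prescribed values on the basis. -/
def indOp (v : ℕ → ℕ → IndSpace p) : Module.End ℂ (IndSpace p) :=
  (Pi.basisFun ℂ (Fin p.l × Fin p.l)).constr ℂ fun i => v i.1 i.2

theorem indOp_apply (v : ℕ → ℕ → IndSpace p) {a b : ℕ} (ha : a < p.l) (hb : b < p.l) :
    indOp p v (indVec p a b) = v a b := by
  have := (Pi.basisFun ℂ (Fin p.l × Fin p.l)).constr_basis ℂ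
    (fun i : Fin p.l × Fin p.l => v i.1 i.2) (⟨a, ha⟩, ⟨b, hb⟩)
  rw [Pi.basisFun_apply] at this
  rw [indVec, dif_pos ⟨ha, hb⟩]
  exact this

/-- The action of `K`. -/
def indK : Module.End ℂ (IndSpace p) := indOp p fun a b => p.q ^ (k - 2 * a + 2 * b) • indVec p a b

/-- The action of `F`. -/
def indF : Module.End ℂ (IndSpace p) := indOp p fun a b => indVec p (a + 1) b

/-- The action of `E`, obtained by moving `E` past `Fᵃ`. -/
def indE : Module.End ℂ (IndSpace p) := indOp p fun a b =>
  indVec p a (b + 1) + (p.qInt a * p.qInt (k + 2 * b + 1 - a)) • indVec p (a - 1) b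

theorem indK_apply (a b : ℕ) :
    indK p k (indVec p a b) = p.q ^ (k - 2 * a + 2 * b) • indVec p a b := by
  by_cases ha : a < p.l
  · by_cases hb : b < p.l
    · exact indOp_apply p _ ha hb
    · rw [indVec_of_le_right p a (not_lt.1 hb)]; simp
  · rw [indVec_of_le_left p (not_lt.1 ha)]; simp

theorem indF_apply (a b : ℕ) : indF p (indVec p a b) = indVec p (a + 1) b := by
  by_cases ha : a < p.l
  · by_cases hb : b < p.l
    · exact indOp_apply p _ ha hb
    · rw [indVec_of_le_right p a (not_lt.1 hb), indVec_of_le_right p _ (not_lt.1 hb), map_zero]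
  · rw [indVec_of_le_left p (not_lt.1 ha), indVec_of_le_left p (by omega), map_zero]

theorem indE_apply {a : ℕ} (ha : a ≤ p.l) (b : ℕ) : indE p k (indVec p a b) =
    indVec p a (b + 1) + (p.qInt a * p.qInt (k + 2 * b + 1 - a)) • indVec p (a - 1) b := by
  by_cases hb : b < p.l
  · rcases ha.lt_or_eq with ha | rfl
    · exact indOp_apply p _ ha hb
    · -- the coefficient `[l]` vanishes, so the formula holds at `a = l` as well
      rw [(p.qInt_eq_zero_iff p.l).2 dvd_rfl, indVec_of_le_left p le_rfl, indVec_of_le_left p le_rfl]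
      simp
  · rw [indVec_of_le_right p a (not_lt.1 hb), indVec_of_le_right p _ (not_lt.1 hb),
      indVec_of_le_right p a (by omega)]
    simp

theorem indK_pow_apply (n : ℕ) {x : IndSpace p} {s : ℤ} (hx : indK p k x = p.q ^ s • x) :
    (indK p k ^ n) x = p.q ^ (s * n) • x := by
  induction n with
  | zero => simp
  | succ n ih =>
    rw [pow_succ, Module.End.mul_apply, hx, map_smul, ih, smul_smul, ← p.zpow_add]
    congr 2; push_cast; ring

theorem indK_pow_l : indK p k ^ p.l = 1 := by
  refine indVec_ext p fun a b _ _ => ?_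
  rw [indK_pow_apply p k _ (indK_apply p k a b), (p.zpow_eq_one_iff _).2 (dvd_mul_left _ _), one_smul,
    Module.End.one_apply]

theorem indK_mul_indE : indK p k * indE p k = (p.q ^ 2) • (indE p k * indK p k) := by
  refine indVec_ext p fun a b ha _ => ?_
  simp only [LinearMap.smul_apply, Module.End.mul_apply, indK_apply, map_smul,
    indE_apply p k ha.le b, map_add, smul_add]
  have e : p.q ^ 2 = p.q ^ (2 : ℤ) := rfl
  rw [e]
  congr 1
  · rw [smul_smul, ← p.zpow_add]
    congr 2; push_cast; ring
  · cases a with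
    | zero => simp [p.qInt_zero]
    | succ a =>
      rw [smul_smul, smul_smul, smul_smul, Nat.add_sub_cancel,
        show k - 2 * (a : ℤ) + 2 * b = 2 + (k - 2 * (a + 1 : ℕ) + 2 * b) by push_cast; ring,
        p.zpow_add]
      congr 1
      ring

theorem indK_mul_indF : indK p k * indF p = (p.q ^ 2)⁻¹ • (indF p * indK p k) := by
  refine indVec_ext p fun a b _ _ => ?_
  simp only [LinearMap.smul_apply, Module.End.mul_apply, indK_apply, map_smul, indF_apply]
  have e : (p.q ^ 2)⁻¹ = p.q ^ (-2 : ℤ) := by rw [zpow_neg]; rfl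
  rw [e, smul_smul, ← p.zpow_add]
  congr 2; push_cast; ring

theorem indE_mul_indF_apply {a : ℕ} (ha : a < p.l) (b : ℕ) :
    indE p k (indF p (indVec p a b)) = indF p (indE p k (indVec p a b)) +
      p.qInt (k - 2 * a + 2 * b) • indVec p a b := by
  have h := qInt_identity p a (k + 2 * b + 1)
  have h' : (p.q - p.q⁻¹)⁻¹ * (p.q ^ (k + 2 * (b : ℤ) + 1 - 1 - 2 * a) -
      p.q ^ (-(k + 2 * (b : ℤ) + 1 - 1 - 2 * a))) = p.qInt (k - 2 * a + 2 * b) := by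
    rw [Param.qInt, div_eq_inv_mul]
    congr 3 <;> ring_nf
  have h'' : p.qInt (a + 1 : ℕ) * p.qInt (k + 2 * b + 1 - (a + 1 : ℕ)) =
      p.qInt a * p.qInt (k + 2 * b + 1 - a) + p.qInt (k - 2 * a + 2 * b) := by
    rw [h'] at h
    push_cast
    linear_combination h
  rw [indF_apply, indE_apply p k (show a + 1 ≤ p.l from ha), indE_apply p k ha.le, map_add, indF_apply, map_smul,
    indF_apply, h'', add_smul, Nat.add_sub_cancel,
    ← add_assoc (indVec p (a + 1) (b + 1))]
  congr 2
  cases a with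
  | zero => simp [p.qInt_zero]
  | succ a => rfl

theorem indE_mul_indF : indE p k * indF p - indF p * indE p k =
    (p.q - p.q⁻¹)⁻¹ • (indK p k - indK p k ^ (p.l - 1)) := by
  refine indVec_ext p fun a b ha _ => ?_
  rw [LinearMap.sub_apply, Module.End.mul_apply, Module.End.mul_apply, indE_mul_indF_apply p k ha,
    add_sub_cancel_left, LinearMap.smul_apply, LinearMap.sub_apply,
    indK_pow_apply p k _ (indK_apply p k a b), indK_apply, ← sub_smul, smul_smul, Param.qInt,
    div_eq_inv_mul]
  congr 3
  rw [p.zpow_eq_iff]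
  refine ⟨-(k - 2 * a + 2 * b), ?_⟩
  rw [Nat.cast_sub p.l_pos]; push_cast; ring

theorem indE_indF_of_weight {x : IndSpace p} {s : ℤ} (hx : indK p k x = p.q ^ s • x) :
    indE p k (indF p x) = indF p (indE p k x) + p.qInt s • x := by
  have h := congrArg (fun f => f x) (indE_mul_indF p k)
  simp only [LinearMap.sub_apply, Module.End.mul_apply, LinearMap.smul_apply,
    indK_pow_apply p k _ hx] at h
  rw [← sub_eq_iff_eq_add', h, hx, ← sub_smul, smul_smul, Param.qInt, div_eq_inv_mul]
  congr 3
  rw [p.zpow_eq_iff]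
  refine ⟨s, ?_⟩
  rw [Nat.cast_sub p.l_pos]; push_cast; ring

theorem indK_indE_pow {x : IndSpace p} {s : ℤ} (hx : indK p k x = p.q ^ s • x) (n : ℕ) :
    indK p k ((indE p k ^ n) x) = p.q ^ (s + 2 * n) • (indE p k ^ n) x := by
  have h := congrArg (fun f => f x) (mul_pow_qcomm (indK_mul_indE p k) n)
  simp only [Module.End.mul_apply, LinearMap.smul_apply, hx, map_smul, smul_smul] at h
  rw [h]
  congr 1
  rw [← pow_mul, ← zpow_natCast, ← p.zpow_add]
  congr 1; push_cast; ring

theorem indE_pow_indF {x : IndSpace p} {s : ℤ} (hx : indK p k x = p.q ^ s • x) (n : ℕ) :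
    (indE p k ^ (n + 1)) (indF p x) = indF p ((indE p k ^ (n + 1)) x) +
      (p.qInt (n + 1) * p.qInt (s + n)) • (indE p k ^ n) x := by
  induction n with
  | zero =>
    have h1 : p.qInt 1 = 1 := by
      rw [Param.qInt, zpow_one, zpow_neg_one, div_self p.q_sub_inv_ne_zero]
    simp [indE_indF_of_weight p k hx, h1]
  | succ n ih =>
    have hp : ∀ (m : ℕ) (y : IndSpace p),
        (indE p k ^ (m + 1)) y = indE p k ((indE p k ^ m) y) := fun m y => by
      rw [pow_succ', Module.End.mul_apply]
    rw [hp (n + 1) (indF p x), ih, map_add, map_smul,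
      indE_indF_of_weight p k (indK_indE_pow p k hx (n + 1)), ← hp, ← hp, add_assoc, ← add_smul]
    congr 2
    have hc := p.c_ne_zero
    have h1 := p.c_mul_qInt_mul (n + 1) (s + n)
    have h2 := p.c_mul_qInt_mul (n + 1 + 1) (s + n + 1)
    have h3 := p.c_mul_qInt_mul 1 (s + 2 * n + 2)
    have h4 : p.qInt 1 = 1 := by
      rw [Param.qInt, zpow_one, zpow_neg_one, div_self p.q_sub_inv_ne_zero]
    rw [h4, one_mul] at h3
    rw [show (n : ℤ) + 1 + (s + n) = s + 2 * n + 1 by ring,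
      show (n : ℤ) + 1 - (s + n) = 1 - s by ring] at h1
    rw [show (n : ℤ) + 1 + 1 + (s + n + 1) = s + 2 * n + 3 by ring,
      show (n : ℤ) + 1 + 1 - (s + n + 1) = 1 - s by ring] at h2
    rw [show 1 + (s + 2 * (n : ℤ) + 2) = s + 2 * n + 3 by ring, ← p.bet_neg (1 - _),
      show -(1 - (s + 2 * (n : ℤ) + 2)) = s + 2 * n + 1 by ring] at h3
    refine mul_left_cancel₀ hc ?_
    push_cast
    rw [show s + 2 * ((n : ℤ) + 1) = s + 2 * n + 2 by ring, ← add_assoc s]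
    linear_combination h1 + h3 - h2

theorem indE_pow_apply_zero (n b : ℕ) : (indE p k ^ n) (indVec p 0 b) = indVec p 0 (b + n) := by
  induction n generalizing b with
  | zero => simp
  | succ n ih =>
    rw [pow_succ, Module.End.mul_apply, indE_apply p k (Nat.zero_le _), Nat.cast_zero, p.qInt_zero,
      zero_mul, zero_smul, add_zero, ih]
    congr 1; omega

theorem indE_pow_l : indE p k ^ p.l = 0 := by
  refine indVec_ext p fun a b ha _ => ?_
  rw [LinearMap.zero_apply]
  induction a with
  | zero => rw [indE_pow_apply_zero, indVec_of_le_right p _ (by omega)]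
  | succ a ih =>
    have h := indE_pow_indF p k (indK_apply p k a b) (p.l - 1)
    rw [Nat.sub_add_cancel p.l_pos, ih (by omega), map_zero, indF_apply] at h
    rw [h, Nat.cast_sub p.l_pos, Nat.cast_one, sub_add_cancel, (p.qInt_eq_zero_iff p.l).2 dvd_rfl,
      zero_mul, zero_smul, zero_add]

theorem indF_pow_apply (n a b : ℕ) : (indF p ^ n) (indVec p a b) = indVec p (a + n) b := by
  induction n generalizing a with
  | zero => simp
  | succ n ih =>
    rw [pow_succ, Module.End.mul_apply, indF_apply, ih]
    congr 1; omega

theorem indF_pow_l : indF p ^ p.l = 0 := by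
  refine indVec_ext p fun a b _ _ => ?_
  rw [indF_pow_apply, indVec_of_le_left p (by omega), LinearMap.zero_apply]

/-- The module with basis `Fᵃ Eᵇ u`, `0 ≤ a, b < l`, and `K u = q ^ k u`. -/
def indRep : Uq p →ₐ[ℂ] Module.End ℂ (IndSpace p) :=
  Uq.lift (indE p k) (indF p) (indK p k) (indE_pow_l p k) (indF_pow_l p) (indK_pow_l p k)
    (indK_mul_indE p k) (indK_mul_indF p k) (indE_mul_indF p k)

theorem indRep_idem : indRep p k (Uq.idem p k) (indVec p 0 0) = indVec p 0 0 := by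
  rw [Uq.idem, map_smul, map_sum, LinearMap.smul_apply, LinearMap.sum_apply]
  have h : ∀ j ∈ Finset.range p.l,
      indRep p k ((p.q ^ (-k) • Uq.K p) ^ j) (indVec p 0 0) = indVec p 0 0 := by
    intro j _
    rw [smul_pow, map_smul, map_pow, indRep, Uq.lift_K, LinearMap.smul_apply,
      indK_pow_apply p k _ (indK_apply p k 0 0), smul_smul, ← zpow_natCast, ← zpow_mul,
      ← p.zpow_add]
    simp
  rw [Finset.sum_congr rfl h, Finset.sum_const, Finset.card_range, ← Nat.cast_smul_eq_nsmul ℂ,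
    smul_smul, one_div, inv_mul_cancel₀ p.l_ne_zero, one_smul]

theorem indRep_newton (n : ℕ) : indRep p k (aeval (Uq.cas p)
      (∏ i ∈ Finset.range n, (X - C (p.bet (k + 1 + 2 * i))))) (indVec p 0 0) =
    p.c ^ n • indVec p n n := by
  have h := congrArg (fun x => indRep p k x (indVec p 0 0)) (Uq.F_pow_E_pow_mul_idem p n k)
  simp only [map_smul, map_mul, map_pow, LinearMap.smul_apply, Module.End.mul_apply,
    indRep_idem] at h
  rw [← h]
  congr 1
  rw [indRep, Uq.lift_E, Uq.lift_F, indE_pow_apply_zero, indF_pow_apply, zero_add]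

/-- The polynomial `C ^ d` contributes `Fᵈ Eᵈ u` plus lower terms, so the top coefficient of `f` can be
read off from `f(C) u`. -/
theorem indRep_aeval_apply (e : ℕ) (f : ℂ[X]) (hf : f.natDegree ≤ e) (d : Fin p.l)
    (hd : e ≤ d) : indRep p k (aeval (Uq.cas p) f) (indVec p 0 0) (d, d) = f.coeff d * p.c ^ (d : ℕ) := by
  induction e generalizing f with
  | zero =>
    rw [natDegree_eq_zero.1 (Nat.le_zero.1 hf) |>.choose_spec.symm, aeval_C, AlgHom.commutes,
      Module.algebraMap_end_apply, Pi.smul_apply, indVec_diag_apply, coeff_C]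
    by_cases h : (d : ℕ) = 0
    · simp [h]
    · rw [if_neg (Ne.symm h), if_neg h]; simp
  | succ e ih =>
    let N : ℂ[X] := ∏ i ∈ Finset.range (e + 1), (X - C (p.bet (k + 1 + 2 * i)))
    have hN : N.Monic := monic_prod_of_monic _ _ fun i _ => monic_X_sub_C _
    have hNd : N.natDegree = e + 1 := by
      rw [natDegree_prod_of_monic _ _ fun i _ => monic_X_sub_C _]
      simp
    have hNc : N.coeff (e + 1) = 1 := by rw [← hNd]; exact hN.coeff_natDegree
    have hle : (f - C (f.coeff (e + 1)) * N).natDegree ≤ e := by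
      refine natDegree_le_iff_coeff_eq_zero.2 fun j hj => ?_
      rw [coeff_sub, coeff_C_mul]
      rcases (Nat.succ_le_of_lt hj).eq_or_lt with rfl | hj
      · rw [hNc, mul_one, sub_self]
      · rw [coeff_eq_zero_of_natDegree_lt (by omega : N.natDegree < j),
          coeff_eq_zero_of_natDegree_lt (lt_of_le_of_lt hf hj)]
        simp
    have h := ih _ hle (by omega)
    rw [map_sub, map_sub, map_mul, map_mul, aeval_C, AlgHom.commutes, LinearMap.sub_apply,
      Module.End.mul_apply, indRep_newton, Module.algebraMap_end_apply, Pi.sub_apply, Pi.smul_apply,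
      Pi.smul_apply, indVec_diag_apply, coeff_sub, coeff_C_mul, sub_eq_iff_eq_add] at h
    rw [h]
    rcases hd.eq_or_lt with hd | hd
    · rw [if_pos hd, ← hd, hNc]; simp
    · rw [if_neg (by omega), coeff_eq_zero_of_natDegree_lt (by omega : N.natDegree < d)]; simp

/-- The powers `1, C, …, C ^ (l - 1)` of the Casimir element are independent on each weight space. -/
theorem Uq.eq_zero_of_aeval_mul_idem {f : ℂ[X]} (hf : f.natDegree < p.l)
    (h : aeval (Uq.cas p) f * Uq.idem p k = 0) : f = 0 := by
  have h1 := indRep_aeval_apply p k _ f le_rfl ⟨f.natDegree, hf⟩ le_rfl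
  have h2 : indRep p k (aeval (Uq.cas p) f) (indVec p 0 0) = 0 := by
    rw [← indRep_idem p k, ← Module.End.mul_apply, ← map_mul, h, map_zero, LinearMap.zero_apply]
  rw [h2, Pi.zero_apply, eq_comm, mul_eq_zero, or_iff_left (pow_ne_zero _ p.c_ne_zero)] at h1
  exact leadingCoeff_eq_zero.1 h1

end Induced

end SmallQuantum

end

noncomputable section

open Polynomial hiding smul_pow

namespace SmallQuantum

open Uq

variable (p : Param)

/-! ### The two-sided integral -/

theorem F_pow_E_pow_pred_mul_idem (k : ℤ) :
    p.c ^ (p.l - 1) • (F p ^ (p.l - 1) * E p ^ (p.l - 1) * idem p k) =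
      aeval (cas p) (p.cofactor (k - 1)) * idem p k := by
  have h := p.prod_mul_prod_nodes k p.l_pos
  rw [Finset.prod_range_zero, one_mul, Nat.sub_zero, Nat.cast_zero, mul_zero, sub_zero] at h
  rw [F_pow_E_pow_mul_idem, h]

theorem sum_K_pow : ∑ j ∈ Finset.range p.l, K p ^ j = (p.l : ℂ) • idem p 0 := by
  rw [idem, smul_smul, mul_one_div_cancel p.l_ne_zero, one_smul]
  simp

theorem integral_eq : integral p =
    (((Real.sqrt p.l : ℝ) : ℂ) / p.qFact (p.l - 1) ^ 2 * p.l) •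
      (F p ^ (p.l - 1) * E p ^ (p.l - 1) * idem p 0) := by
  rw [integral, sum_K_pow, mul_smul_comm, smul_smul]

/-- The integral is a multiple of a polynomial in the Casimir element times an idempotent. -/
theorem integral_eq_aeval : ∃ a : ℂ,
    integral p = a • (aeval (cas p) (p.cofactor 1) * idem p 0) := by
  refine ⟨((Real.sqrt p.l : ℝ) : ℂ) / p.qFact (p.l - 1) ^ 2 * p.l * (p.c ^ (p.l - 1))⁻¹, ?_⟩
  rw [← p.cofactor_congr (p.bet_neg 1), ← zero_sub, ← F_pow_E_pow_pred_mul_idem, smul_smul, mul_assoc,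
    inv_mul_cancel₀ (pow_ne_zero _ p.c_ne_zero), mul_one, integral_eq]

theorem aeval_cofactor_mul_idem_two_mul_E :
    aeval (cas p) (p.cofactor 1) * idem p 2 * E p = 0 := by
  have h := F_pow_E_pow_pred_mul_idem p 2
  rw [show (2 : ℤ) - 1 = 1 by norm_num] at h
  rw [← h, smul_mul_assoc, mul_assoc, show (2 : ℤ) = 0 + 2 by norm_num, ← E_mul_idem, ← mul_assoc,
    mul_assoc (F p ^ _), ← pow_succ, Nat.sub_add_cancel p.l_pos, E_pow, mul_zero, zero_mul, smul_zero]

theorem F_mul_aeval_cofactor_mul_idem_two :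
    F p * (aeval (cas p) (p.cofactor 1) * idem p 2) = 0 := by
  have h := F_pow_E_pow_pred_mul_idem p 2
  rw [show (2 : ℤ) - 1 = 1 by norm_num] at h
  rw [← h, mul_smul_comm, ← mul_assoc, ← mul_assoc, ← pow_succ', Nat.sub_add_cancel p.l_pos, F_pow,
    zero_mul, zero_mul, smul_zero]

theorem E_mul_integral : E p * integral p = 0 := by
  obtain ⟨a, ha⟩ := integral_eq_aeval p
  rw [ha, mul_smul_comm, ← mul_assoc, aeval_cas_comm, mul_assoc, E_mul_idem, zero_add, ← mul_assoc,
    aeval_cofactor_mul_idem_two_mul_E, smul_zero]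

theorem integral_mul_F : integral p * F p = 0 := by
  obtain ⟨a, ha⟩ := integral_eq_aeval p
  have h := F_mul_idem p 2
  rw [sub_self] at h
  rw [ha, smul_mul_assoc, mul_assoc, ← h, ← mul_assoc, ← aeval_cas_comm, mul_assoc,
    F_mul_aeval_cofactor_mul_idem_two, smul_zero]

theorem F_mul_integral : F p * integral p = 0 := by
  rw [integral_eq, mul_smul_comm, ← mul_assoc, ← mul_assoc, ← pow_succ', Nat.sub_add_cancel p.l_pos,
    F_pow, zero_mul, zero_mul, smul_zero]

theorem integral_mul_E : integral p * E p = 0 := by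
  have h := E_mul_idem p (-2)
  rw [neg_add_cancel] at h
  rw [integral_eq, smul_mul_assoc, mul_assoc, ← h, ← mul_assoc, mul_assoc (F p ^ _), ← pow_succ,
    Nat.sub_add_cancel p.l_pos, E_pow, mul_zero, zero_mul, smul_zero]

theorem K_mul_integral : K p * integral p = integral p := by
  obtain ⟨a, ha⟩ := integral_eq_aeval p
  rw [ha, mul_smul_comm, ← mul_assoc, aeval_cas_comm, mul_assoc, K_mul_idem, zpow_zero, one_smul]

theorem integral_mul_K : integral p * K p = integral p := by
  obtain ⟨a, ha⟩ := integral_eq_aeval p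
  rw [ha, smul_mul_assoc, mul_assoc, idem_mul_K, K_mul_idem, zpow_zero, one_smul]

/-! ### The coproduct of the integral -/

theorem one_tmul_K_mul : ((1 : Uq p) ⊗ₜ[ℂ] K p) * comulHom p (integral p) =
    (Kinv p ⊗ₜ[ℂ] (1 : Uq p)) * comulHom p (integral p) := by
  have h : (K p ⊗ₜ[ℂ] K p) * comulHom p (integral p) = comulHom p (integral p) := by
    rw [← comulHom_K, ← map_mul, K_mul_integral]
  conv_rhs => rw [← h]
  rw [← mul_assoc, Algebra.TensorProduct.tmul_mul_tmul, Kinv_mul_K, one_mul]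

theorem one_tmul_Kinv_mul : ((1 : Uq p) ⊗ₜ[ℂ] Kinv p) * comulHom p (integral p) =
    (K p ⊗ₜ[ℂ] (1 : Uq p)) * comulHom p (integral p) := by
  have h : (K p ⊗ₜ[ℂ] K p) * comulHom p (integral p) = comulHom p (integral p) := by
    rw [← comulHom_K, ← map_mul, K_mul_integral]
  conv_lhs => rw [← h]
  rw [← mul_assoc, Algebra.TensorProduct.tmul_mul_tmul, Kinv_mul_K, one_mul]

theorem one_tmul_E_mul : ((1 : Uq p) ⊗ₜ[ℂ] E p) * comulHom p (integral p) =
    ((-(E p * Kinv p)) ⊗ₜ[ℂ] (1 : Uq p)) * comulHom p (integral p) := by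
  have h : ((1 : Uq p) ⊗ₜ[ℂ] E p + E p ⊗ₜ[ℂ] K p) * comulHom p (integral p) = 0 := by
    rw [← comulHom_E, ← map_mul, E_mul_integral, map_zero]
  have e : E p ⊗ₜ[ℂ] K p = (E p ⊗ₜ[ℂ] 1) * ((1 : Uq p) ⊗ₜ[ℂ] K p) := by simp
  rw [add_mul, e, mul_assoc, one_tmul_K_mul, ← mul_assoc, Algebra.TensorProduct.tmul_mul_tmul,
    one_mul] at h
  rw [eq_neg_of_add_eq_zero_left h, TensorProduct.neg_tmul, neg_mul]

theorem one_tmul_F_mul : ((1 : Uq p) ⊗ₜ[ℂ] F p) * comulHom p (integral p) =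
    ((-(K p * F p)) ⊗ₜ[ℂ] (1 : Uq p)) * comulHom p (integral p) := by
  have h : (Kinv p ⊗ₜ[ℂ] F p + F p ⊗ₜ[ℂ] 1) * comulHom p (integral p) = 0 := by
    rw [← comulHom_F, ← map_mul, F_mul_integral, map_zero]
  have h2 := congrArg (fun t => (K p ⊗ₜ[ℂ] (1 : Uq p)) * t) h
  simp only [← mul_assoc, mul_add, add_mul, Algebra.TensorProduct.tmul_mul_tmul, K_mul_Kinv, one_mul,
    mul_one, mul_zero] at h2
  rw [eq_neg_of_add_eq_zero_left h2, TensorProduct.neg_tmul, neg_mul]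

/-- The Casimir element is fixed by the antipode, so it can be moved across the coproduct of the
integral. -/
theorem one_tmul_cas_mul : ((1 : Uq p) ⊗ₜ[ℂ] cas p) * comulHom p (integral p) =
    (cas p ⊗ₜ[ℂ] (1 : Uq p)) * comulHom p (integral p) := by
  have hFE : ((1 : Uq p) ⊗ₜ[ℂ] (F p * E p)) * comulHom p (integral p) =
      ((E p * F p) ⊗ₜ[ℂ] (1 : Uq p)) * comulHom p (integral p) := by
    have e1 : (1 : Uq p) ⊗ₜ[ℂ] (F p * E p) = (1 ⊗ₜ[ℂ] F p) * (1 ⊗ₜ[ℂ] E p) := by simp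
    have e2 : ((1 : Uq p) ⊗ₜ[ℂ] F p) * ((-(E p * Kinv p)) ⊗ₜ[ℂ] (1 : Uq p)) =
        ((-(E p * Kinv p)) ⊗ₜ[ℂ] (1 : Uq p)) * ((1 : Uq p) ⊗ₜ[ℂ] F p) := by simp
    rw [e1, mul_assoc, one_tmul_E_mul, ← mul_assoc, e2, mul_assoc, one_tmul_F_mul, ← mul_assoc,
      Algebra.TensorProduct.tmul_mul_tmul, neg_mul_neg, one_mul, mul_assoc, ← mul_assoc (Kinv p),
      Kinv_mul_K, one_mul]
  conv_rhs => rw [cas_eq]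
  rw [cas]
  simp only [TensorProduct.tmul_add, TensorProduct.add_tmul, TensorProduct.tmul_smul,
    ← TensorProduct.smul_tmul', add_mul, smul_mul_assoc, hFE, one_tmul_K_mul, one_tmul_Kinv_mul]
  abel

theorem mul_one_tmul_K : comulHom p (integral p) * ((1 : Uq p) ⊗ₜ[ℂ] K p) =
    comulHom p (integral p) * (Kinv p ⊗ₜ[ℂ] (1 : Uq p)) := by
  have h : comulHom p (integral p) * (K p ⊗ₜ[ℂ] K p) = comulHom p (integral p) := by
    rw [← comulHom_K, ← map_mul, integral_mul_K]
  conv_rhs => rw [← h]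
  rw [mul_assoc, Algebra.TensorProduct.tmul_mul_tmul, K_mul_Kinv, mul_one]

theorem mul_one_tmul_E : comulHom p (integral p) * ((1 : Uq p) ⊗ₜ[ℂ] E p) =
    comulHom p (integral p) * ((-(Kinv p * E p)) ⊗ₜ[ℂ] (1 : Uq p)) := by
  have h : comulHom p (integral p) * ((1 : Uq p) ⊗ₜ[ℂ] E p + E p ⊗ₜ[ℂ] K p) = 0 := by
    rw [← comulHom_E, ← map_mul, integral_mul_E, map_zero]
  have e : E p ⊗ₜ[ℂ] K p = ((1 : Uq p) ⊗ₜ[ℂ] K p) * (E p ⊗ₜ[ℂ] 1) := by simp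
  rw [mul_add, e, ← mul_assoc, mul_one_tmul_K, mul_assoc, Algebra.TensorProduct.tmul_mul_tmul,
    one_mul] at h
  rw [eq_neg_of_add_eq_zero_left h, TensorProduct.neg_tmul, mul_neg]

theorem mul_one_tmul_F : comulHom p (integral p) * ((1 : Uq p) ⊗ₜ[ℂ] F p) =
    comulHom p (integral p) * ((-(F p * K p)) ⊗ₜ[ℂ] (1 : Uq p)) := by
  have h : comulHom p (integral p) * (Kinv p ⊗ₜ[ℂ] F p + F p ⊗ₜ[ℂ] 1) = 0 := by
    rw [← comulHom_F, ← map_mul, integral_mul_F, map_zero]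
  have h2 := congrArg (fun t => t * (K p ⊗ₜ[ℂ] (1 : Uq p))) h
  simp only [mul_assoc, mul_add, add_mul, Algebra.TensorProduct.tmul_mul_tmul, Kinv_mul_K, mul_one,
    zero_mul] at h2
  rw [eq_neg_of_add_eq_zero_left h2, TensorProduct.neg_tmul, mul_neg]

/-! ### The Radford images of the `q`-characters -/

section Contract

variable {p} (β : Module.Dual ℂ (Uq p))

theorem contractWith_one_tmul_mul (x : Uq p) (t : Uq p ⊗[ℂ] Uq p) :
    contractWith β ((1 ⊗ₜ[ℂ] x) * t) = x * contractWith β t := by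
  induction t with
  | zero => simp
  | tmul a b => simp
  | add a b ha hb => rw [mul_add, map_add, map_add, ha, hb, mul_add]

theorem contractWith_mul_one_tmul (x : Uq p) (t : Uq p ⊗[ℂ] Uq p) :
    contractWith β (t * (1 ⊗ₜ[ℂ] x)) = contractWith β t * x := by
  induction t with
  | zero => simp
  | tmul a b => simp
  | add a b ha hb => rw [add_mul, map_add, map_add, ha, hb, add_mul]

/-- A twisted trace exchanges left and right multiplication on the first factor. -/
theorem contractWith_tmul_one_comm {x y : Uq p} (h : ∀ a, β (x * a) = β (a * y))
    (t : Uq p ⊗[ℂ] Uq p) :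
    contractWith β ((x ⊗ₜ[ℂ] 1) * t) = contractWith β (t * (y ⊗ₜ[ℂ] 1)) := by
  induction t with
  | zero => simp
  | tmul a b => simp [h]
  | add a b ha hb => rw [mul_add, add_mul, map_add, map_add, ha, hb]

end Contract

variable {r : ℕ} (hr : r ≤ p.l)

/-- The `q`-character is a trace twisted by the square of the antipode. -/
theorem qCh_mul_comm {x y : Uq p} (h : Kinv p * x * K p = y) (a : Uq p) :
    qCh p r hr (x * a) = qCh p r hr (a * y) := by
  rw [qCh_apply, qCh_apply, ← map_mul, ← map_mul, ← h]
  have e : Kinv p * (a * (Kinv p * x * K p)) = (Kinv p * a) * ((Kinv p * x) * K p) := by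
    simp only [mul_assoc]
  rw [e, map_mul _ (Kinv p * a), Matrix.trace_mul_comm, ← map_mul]
  congr 2
  rw [mul_assoc, ← mul_assoc (K p), K_mul_Kinv, one_mul, mul_assoc]

theorem phi_eq : phi p r hr = contractWith (qCh p r hr) (comulHom p (integral p)) := rfl

/-- Right and left multiplication of `Δ(Λ)` by `1 ⊗ x` are moved to the first factor, where they differ
by the twist of the `q`-character. -/
theorem phi_mem_center : phi p r hr ∈ Subalgebra.center ℂ (Uq p) := by
  refine mem_center_of_commute p ?_ ?_ ?_
  · rw [phi_eq, ← contractWith_mul_one_tmul, ← contractWith_one_tmul_mul, mul_one_tmul_E,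
      one_tmul_E_mul]
    refine (contractWith_tmul_one_comm _ (qCh_mul_comm p hr ?_) _).symm
    rw [mul_neg, neg_mul, ← mul_assoc, mul_assoc _ (Kinv p) (K p), Kinv_mul_K, mul_one]
  · rw [phi_eq, ← contractWith_mul_one_tmul, ← contractWith_one_tmul_mul, mul_one_tmul_F,
      one_tmul_F_mul]
    refine (contractWith_tmul_one_comm _ (qCh_mul_comm p hr ?_) _).symm
    rw [mul_neg, neg_mul, ← mul_assoc, Kinv_mul_K, one_mul]
  · rw [phi_eq, ← contractWith_mul_one_tmul, ← contractWith_one_tmul_mul, mul_one_tmul_K,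
      one_tmul_K_mul]
    refine (contractWith_tmul_one_comm _ (qCh_mul_comm p hr ?_) _).symm
    rw [mul_assoc, Kinv_mul_K, mul_one]

theorem simpleRep_cas : simpleRep p r hr (cas p) = p.bet r • (1 : Matrix (Fin r) (Fin r) ℂ) := by
  rw [cas, map_add, map_add, map_smul, map_smul, map_smul, map_mul, simpleRep_E, simpleRep_F,
    simpleRep_K, simpleRep_Kinv, ← Matrix.diagonal_one]
  have hFE : matF r * matE p r =
      Matrix.diagonal fun n : Fin r => p.qInt n * p.qInt (r - (n : ℤ)) := by
    ext i j
    by_cases hij : i = j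
    · subst hij
      have := matF_pow_mul_matE_pow_apply p r 1 1 i
      simpa using this
    · rw [Matrix.diagonal_apply_ne _ hij, Matrix.mul_apply]
      have : (i : ℕ) ≠ j := fun h => hij (Fin.ext h)
      refine Finset.sum_eq_zero fun b _ => ?_
      rw [matF_apply, matE_apply]
      split_ifs <;> first | omega | simp
  rw [hFE, matK, ← Matrix.diagonal_smul, ← Matrix.diagonal_smul, ← Matrix.diagonal_smul,
    ← Matrix.diagonal_smul, Matrix.diagonal_add, Matrix.diagonal_add]
  congr 1
  funext n
  simp only [Pi.smul_apply, smul_eq_mul, mul_one, p.c_mul_qInt_mul]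
  have e1 : p.q * p.q ^ ((r : ℤ) - 1 - 2 * n) = p.q ^ ((r : ℤ) - 2 * n) := by
    rw [← zpow_one_add₀ p.q_ne_zero]; congr 1; ring
  have e2 : p.q⁻¹ * p.q ^ (-((r : ℤ) - 1 - 2 * n)) = p.q ^ (-((r : ℤ) - 2 * n)) := by
    rw [← zpow_neg_one, ← p.zpow_add]; congr 1; ring
  rw [e1, e2, add_assoc, ← Param.bet, ← p.bet_neg ((r : ℤ) - 2 * n),
    show (n : ℤ) + (r - n) = r by ring, show (n : ℤ) - (r - n) = -(r - 2 * n) by ring]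
  ring

/-- The Casimir element acts on a Radford image by its value on the simple module. -/
theorem cas_mul_phi : cas p * phi p r hr = p.bet r • phi p r hr := by
  rw [phi_eq, ← contractWith_one_tmul_mul, one_tmul_cas_mul]
  induction comulHom p (integral p) with
  | zero => simp
  | tmul a b =>
    rw [Algebra.TensorProduct.tmul_mul_tmul, one_mul, contractWith_tmul, contractWith_tmul, smul_smul]
    congr 1
    rw [qCh_apply, qCh_apply, map_mul, simpleRep_cas, smul_mul_assoc, one_mul, mul_smul_comm,
      Matrix.trace_smul, smul_eq_mul]
  | add a b ha hb => rw [mul_add, map_add, map_add, ha, hb, smul_add]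

end SmallQuantum

end

noncomputable section

open Polynomial hiding smul_pow

namespace SmallQuantum

open Uq

variable (p : Param)

/-! ### The weights of the simple modules -/

/-- The multiplicity of the weight `-k` modulo `l` (equivalently, of `k`) in the simple module of
dimension `r`. -/
def wtMult (r : ℕ) (k : ℤ) : ℂ :=
  ∑ t ∈ Finset.range r, if (p.l : ℤ) ∣ (r : ℤ) - 1 - 2 * t + k then 1 else 0

theorem sum_ite_dvd_weight (w : ℤ) :
    ∑ t ∈ Finset.range p.l, (if (p.l : ℤ) ∣ w - 2 * t then (1 : ℂ) else 0) = 1 := by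
  simp only [p.dvd_sub_two_mul_iff]
  exact p.sum_ite_dvd_sub ((p.h + 1) * w) (fun _ => 1) fun _ _ _ => rfl

theorem wtMult_l (k : ℤ) : wtMult p p.l k = 1 := by
  refine (Finset.sum_congr rfl fun t _ => ?_).trans (sum_ite_dvd_weight p ((p.l : ℤ) - 1 + k))
  rw [show (p.l : ℤ) - 1 - 2 * t + k = p.l - 1 + k - 2 * t by ring]

/-- Modulo `l`, the weights of `V_r` and of `V_{l-r}` are complementary. -/
theorem wtMult_add_wtMult {r : ℕ} (hr : r ≤ p.l) (k : ℤ) :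
    wtMult p r k + wtMult p (p.l - r) k = 1 := by
  rw [← sum_ite_dvd_weight p ((r : ℤ) - 1 + k)]
  conv_rhs => rw [show p.l = r + (p.l - r) by omega]
  rw [Finset.sum_range_add, wtMult, wtMult]
  congr 1
  · refine Finset.sum_congr rfl fun t _ => ?_
    rw [show r + (p.l - r) = p.l by omega,
      show (r : ℤ) - 1 - 2 * t + k = r - 1 + k - 2 * t by ring]
  · refine Finset.sum_congr rfl fun t _ => ?_
    rw [show r + (p.l - r) = p.l by omega]
    have : (p.l : ℤ) ∣ ((p.l - r : ℕ) : ℤ) - 1 - 2 * t + k ↔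
        (p.l : ℤ) ∣ (r : ℤ) - 1 + k - 2 * ((r + t : ℕ) : ℤ) := by
      rw [Nat.cast_sub hr, show (p.l : ℤ) - r - 1 - 2 * t + k =
        p.l + (r - 1 + k - 2 * ((r + t : ℕ) : ℤ)) by push_cast; ring, dvd_add_right dvd_rfl]
    simp only [this]

/-! ### The leading coefficient of a Radford image -/

/-- Evaluate the cofactor of the node `2` at `2`: the product form gives the left side, the Chebyshev
expansion the right side. -/
theorem Param.qFact_sq_mul : p.qFact (p.l - 1) ^ 2 * p.c ^ (p.l - 1) = (p.l : ℂ) ^ 2 := by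
  have hl := p.l_pos
  have h1 : p.qFact (p.l - 1) ^ 2 * p.c ^ (p.l - 1) =
      ∏ i ∈ Finset.range (p.l - 1), (2 - p.bet (2 + 2 * i)) := by
    have he : Even (p.l - 1) := by unfold Param.l; simp
    have h2 : ∏ i ∈ Finset.range (p.l - 1), (2 - p.bet (2 + 2 * i)) =
        ∏ i ∈ Finset.range (p.l - 1), (p.bet (2 + 2 * i) - 2) := by
      have := Finset.prod_neg (s := Finset.range (p.l - 1)) (f := fun i : ℕ => p.bet (2 + 2 * i) - 2)
      rw [Finset.card_range, he.neg_one_pow, one_mul] at this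
      rw [← this]
      exact Finset.prod_congr rfl fun i _ => by ring
    rw [h2, Param.qFact, ← Finset.prod_pow]
    conv_lhs => rw [← Finset.card_range (p.l - 1), ← Finset.prod_const, Finset.card_range]
    rw [← Finset.prod_mul_distrib]
    refine Finset.prod_congr rfl fun i _ => ?_
    rw [sq, mul_comm, p.c_mul_qInt_mul, sub_self, p.bet_zero]
    congr 2; ring
  have h2 := congrArg (Polynomial.eval 2) (p.prod_mul_prod_nodes 1 hl)
  simp only [Finset.prod_range_zero, one_mul, Nat.sub_zero, Nat.cast_zero, mul_zero, sub_self,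
    eval_prod, eval_sub, eval_X, eval_C] at h2
  rw [h1]
  have h3 : ∀ i : ℕ, (1 : ℤ) + 1 + 2 * i = 2 + 2 * i := fun i => by ring
  simp only [h3] at h2
  rw [h2, Param.cofactor, eval_add, eval_finsetSum]
  simp only [eval_mul, eval_C, mul_zero, p.bet_zero, Chebyshev.S_eval_two]
  have h4 : ∀ n : ℕ, ∑ j ∈ Finset.range n, (2 : ℂ) * (((j : ℤ) : ℂ) + 1) = n * (n + 1) := by
    intro n
    induction n with
    | zero => simp
    | succ n ih => rw [Finset.sum_range_succ, ih]; push_cast; ring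
  rw [h4, Nat.cast_sub hl]
  push_cast
  ring

theorem comulHom_F_pow (n : ℕ) : comulHom p (F p ^ n) =
    ∑ a ∈ Finset.range (n + 1),
      gauss (p.q ^ 2) n a • ((F p ^ a * Kinv p ^ (n - a)) ⊗ₜ[ℂ] (F p ^ (n - a))) := by
  have h : (Kinv p ⊗ₜ[ℂ] F p) * (F p ⊗ₜ[ℂ] 1) = (p.q ^ 2) • ((F p ⊗ₜ[ℂ] 1) * (Kinv p ⊗ₜ[ℂ] F p)) := by
    simp [Kinv_mul_F, TensorProduct.smul_tmul']
  rw [map_pow, comulHom_F, add_comm, add_pow_qcomm h]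
  refine Finset.sum_congr rfl fun a _ => ?_
  simp [Algebra.TensorProduct.tmul_pow]

theorem comulHom_E_pow (n : ℕ) : comulHom p (E p ^ n) =
    ∑ b ∈ Finset.range (n + 1),
      gauss (p.q ^ 2) n b • ((E p ^ (n - b)) ⊗ₜ[ℂ] (E p ^ b * K p ^ (n - b))) := by
  have h : (E p ⊗ₜ[ℂ] K p) * ((1 : Uq p) ⊗ₜ[ℂ] E p) =
      (p.q ^ 2) • (((1 : Uq p) ⊗ₜ[ℂ] E p) * (E p ⊗ₜ[ℂ] K p)) := by
    simp [K_mul_E]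
  rw [map_pow, comulHom_E, add_pow_qcomm h]
  refine Finset.sum_congr rfl fun a _ => ?_
  simp [Algebra.TensorProduct.tmul_pow]

theorem gauss_self (ω : ℂ) (n : ℕ) : gauss ω n n = 1 := by
  induction n with
  | zero => rfl
  | succ n ih => rw [gauss, ih, gauss_of_lt ω n (n + 1) (by omega)]; simp

variable {r : ℕ} (hr : r ≤ p.l)

theorem qCh_F_Kinv_E_K (a s t j : ℕ) (h : a ≠ t) :
    qCh p r hr (F p ^ a * Kinv p ^ s * (E p ^ t * K p ^ j)) = 0 := by
  rw [Kinv, ← pow_mul, mul_assoc, ← mul_assoc (K p ^ _), K_pow_mul_E_pow, smul_mul_assoc,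
    mul_smul_comm, map_smul, mul_assoc (E p ^ t), ← pow_add, ← mul_assoc, qCh_F_E_K, if_neg h, smul_zero]

theorem sum_qCh_K_pow (k : ℤ) :
    ∑ j ∈ Finset.range p.l, qCh p r hr (K p ^ (j + 1)) * p.q ^ (k * j) = p.l * wtMult p r k := by
  have h1 : ∀ j : ℕ, qCh p r hr (K p ^ (j + 1)) * p.q ^ (k * j) =
      ∑ t ∈ Finset.range r, p.q ^ (((r : ℤ) - 1 - 2 * t + k) * j) := by
    intro j
    have h := qCh_F_E_K p hr 0 0 (j + 1)
    rw [if_pos rfl] at h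
    simp only [pow_zero, one_mul, Finset.prod_range_zero, mul_one, Nat.cast_add, Nat.cast_one,
      add_sub_cancel_right] at h
    rw [h, Fin.sum_univ_eq_sum_range (fun t : ℕ => p.q ^ (((r : ℤ) - 1 - 2 * (t : ℤ)) * j)) r,
      Finset.sum_mul]
    refine Finset.sum_congr rfl fun t _ => ?_
    rw [← p.zpow_add]
    congr 1; ring
  simp only [h1]
  rw [Finset.sum_comm, wtMult, Finset.mul_sum]
  refine Finset.sum_congr rfl fun t _ => ?_
  rw [p.sum_zpow_mul]
  split_ifs <;> simp

/-- On a weight space a Radford image is a combination of the elements `Fᵇ Eᵇ`, and the coefficient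
of the top one counts weights. -/
theorem exists_phi_mul_idem (k : ℤ) : ∃ d : ℕ → ℂ,
    d (p.l - 1) = ((Real.sqrt p.l : ℝ) : ℂ) / p.qFact (p.l - 1) ^ 2 * (p.l * wtMult p r k) ∧
    phi p r hr * idem p k =
      ∑ b ∈ Finset.range (p.l - 1 + 1), d b • (F p ^ b * E p ^ b * idem p k) := by
  let n := p.l - 1
  let ζ : ℂ := ((Real.sqrt p.l : ℝ) : ℂ) / p.qFact n ^ 2
  refine ⟨fun b => ζ * (gauss (p.q ^ 2) n (n - b) * gauss (p.q ^ 2) n b *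
    ∑ j ∈ Finset.range p.l, qCh p r hr (F p ^ (n - b) * Kinv p ^ b * (E p ^ (n - b) * K p ^ j)) *
      p.q ^ (k * (n - b + j : ℕ))), ?_, ?_⟩
  · simp only [n, Nat.sub_self, gauss_zero, gauss_self, pow_zero, one_mul, Kinv_pow_pred, ← pow_succ',
      Nat.zero_add]
    rw [sum_qCh_K_pow]
  · have hΔ : comulHom p (integral p) = ζ • ∑ j ∈ Finset.range p.l,
        ∑ b ∈ Finset.range (n + 1), ∑ a ∈ Finset.range (n + 1),
          (gauss (p.q ^ 2) n a * gauss (p.q ^ 2) n b) •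
          ((F p ^ a * Kinv p ^ (n - a) * (E p ^ (n - b) * K p ^ j)) ⊗ₜ[ℂ]
            (F p ^ (n - a) * (E p ^ b * K p ^ (n - b + j)))) := by
      rw [integral, map_smul, map_mul, map_mul, map_sum, comulHom_F_pow, comulHom_E_pow,
        Finset.sum_mul_sum, Finset.mul_sum]
      congr 1
      refine Finset.sum_congr rfl fun j _ => ?_
      rw [Finset.sum_mul, Finset.sum_comm]
      simp only [Finset.sum_mul]
      refine Finset.sum_congr rfl fun b _ => Finset.sum_congr rfl fun a _ => ?_
      rw [map_pow, comulHom_K, Algebra.TensorProduct.tmul_pow, smul_mul_smul_comm, smul_mul_assoc,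
        Algebra.TensorProduct.tmul_mul_tmul, Algebra.TensorProduct.tmul_mul_tmul, pow_add]
      simp only [mul_assoc]
      rfl
    rw [phi_eq, hΔ, map_smul, map_sum, smul_mul_assoc, Finset.sum_mul]
    have hj : ∀ j : ℕ, contractWith (qCh p r hr) (∑ b ∈ Finset.range (n + 1),
        ∑ a ∈ Finset.range (n + 1), (gauss (p.q ^ 2) n a * gauss (p.q ^ 2) n b) •
          ((F p ^ a * Kinv p ^ (n - a) * (E p ^ (n - b) * K p ^ j)) ⊗ₜ[ℂ]
            (F p ^ (n - a) * (E p ^ b * K p ^ (n - b + j))))) * idem p k =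
        ∑ b ∈ Finset.range (n + 1), (gauss (p.q ^ 2) n (n - b) * gauss (p.q ^ 2) n b *
          (qCh p r hr (F p ^ (n - b) * Kinv p ^ b * (E p ^ (n - b) * K p ^ j)) *
            p.q ^ (k * (n - b + j : ℕ)))) • (F p ^ b * E p ^ b * idem p k) := by
      intro j
      rw [map_sum, Finset.sum_mul]
      refine Finset.sum_congr rfl fun b hb => ?_
      have hb := Finset.mem_range.1 hb
      rw [map_sum, Finset.sum_eq_single (n - b)]
      · rw [map_smul, contractWith_tmul, show n - (n - b) = b by omega, smul_mul_assoc,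
          smul_mul_assoc, mul_assoc (F p ^ b), mul_assoc (E p ^ b), K_pow_mul_idem, mul_smul_comm,
          mul_smul_comm, smul_smul, smul_smul, mul_assoc (F p ^ b)]
        congr 1
        ring
      · intro a _ ha
        rw [map_smul, contractWith_tmul, qCh_F_Kinv_E_K p hr _ _ _ _ ha, zero_smul, smul_zero]
      · intro h
        exact absurd (Finset.mem_range.2 (by omega)) h
    simp only [hj]
    rw [Finset.sum_comm, Finset.smul_sum]
    refine Finset.sum_congr rfl fun b _ => ?_
    rw [← Finset.sum_smul, smul_smul, ← Finset.mul_sum]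

/-- A Radford image is supported on the weights of the simple module, where it is the polynomial in
the Casimir element obtained from the annihilating polynomial by removing the factor that
vanishes on the simple module. -/
theorem phi_mul_idem (k : ℤ) : phi p r hr * idem p k =
    (1 / ((Real.sqrt p.l : ℝ) : ℂ) * wtMult p r k) •
      (aeval (cas p) (p.cofactor r) * idem p k) := by
  obtain ⟨d, hd, hphi⟩ := exists_phi_mul_idem p hr k
  have hl := p.l_pos
  have hc := p.c_ne_zero
  let n := p.l - 1
  let N : ℕ → ℂ[X] := fun b => ∏ i ∈ Finset.range b, (X - C (p.bet (k + 1 + 2 * i)))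
  have hNm : ∀ b, (N b).Monic := fun b => monic_prod_of_monic _ _ fun i _ => monic_X_sub_C _
  have hNd : ∀ b, (N b).natDegree = b := fun b => by
    simp only [N]
    rw [natDegree_prod_of_monic _ _ fun i _ => monic_X_sub_C _]
    simp
  let P : ℂ[X] := ∑ b ∈ Finset.range (n + 1), C (d b * (p.c ^ b)⁻¹) * N b
  have hP : phi p r hr * idem p k = aeval (cas p) P * idem p k := by
    rw [hphi, map_sum, Finset.sum_mul]
    refine Finset.sum_congr rfl fun b _ => ?_
    rw [map_mul, mul_assoc (aeval _ _), ← F_pow_E_pow_mul_idem, aeval_C, ← Algebra.smul_def, smul_smul,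
      mul_assoc (d b), inv_mul_cancel₀ (pow_ne_zero _ hc), mul_one]
  have hPd : P.natDegree ≤ n := by
    refine natDegree_sum_le_of_forall_le _ _ fun b hb => ?_
    have hb := Finset.mem_range.1 hb
    refine (natDegree_C_mul_le _ _).trans ?_
    rw [hNd]; omega
  have hPc : P.coeff n = 1 / ((Real.sqrt p.l : ℝ) : ℂ) * wtMult p r k := by
    have hs : ((Real.sqrt p.l : ℝ) : ℂ) ^ 2 = p.l := by
      rw [← Complex.ofReal_pow, Real.sq_sqrt (Nat.cast_nonneg _), Complex.ofReal_natCast]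
    have hs0 : ((Real.sqrt p.l : ℝ) : ℂ) ≠ 0 := by
      intro h; rw [h] at hs; exact p.l_ne_zero (by rw [← hs]; simp)
    have hq := p.qFact_sq_mul
    have hl0 := p.l_ne_zero
    have hf := p.qFact_ne_zero (show p.l - 1 < p.l by omega)
    have h1 : (N n).coeff n = 1 := by
      have := (hNm n).coeff_natDegree
      rwa [hNd] at this
    simp only [P]
    rw [finsetSum_coeff, Finset.sum_range_succ, Finset.sum_eq_zero, zero_add, coeff_C_mul, h1, hd]
    · rw [mul_one]
      simp only [n]
      have hq' : p.c ^ (p.l - 1) = (p.l : ℂ) ^ 2 / p.qFact (p.l - 1) ^ 2 := by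
        rw [← hq]; field_simp
      rw [hq']
      field_simp
      linear_combination (wtMult p r k) * hs
    · intro b hb
      have hb := Finset.mem_range.1 hb
      rw [coeff_C_mul, coeff_eq_zero_of_natDegree_lt (by rw [hNd]; exact hb), mul_zero]
  have hMc : (p.cofactor r).coeff n = 1 := by
    have := (p.monic_cofactor r).coeff_natDegree
    rwa [p.natDegree_cofactor] at this
  let D : ℂ[X] := P - C (P.coeff n) * p.cofactor r
  have hD : D.natDegree < n := by
    have hn : 0 < n := by have := p.one_lt_l; omega
    refine lt_of_le_of_lt (b := n - 1) (natDegree_le_iff_coeff_eq_zero.2 fun j hj => ?_) (by omega)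
    simp only [D]
    rw [coeff_sub, coeff_C_mul]
    rcases eq_or_lt_of_le (show n ≤ j by omega) with rfl | hj'
    · rw [hMc, mul_one, sub_self]
    · rw [coeff_eq_zero_of_natDegree_lt (lt_of_le_of_lt hPd hj'),
        coeff_eq_zero_of_natDegree_lt (p := p.cofactor r) (by rw [p.natDegree_cofactor]; exact hj'),
        mul_zero, sub_zero]
  have hz : aeval (cas p) ((X - C (p.bet r)) * D) * idem p k = 0 := by
    have h1 : (X - C (p.bet r)) * D = (X - C (p.bet r)) * P - C (P.coeff n) * p.minpol := by
      rw [← p.mul_cofactor r]; simp only [D]; ring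
    rw [h1, map_sub, map_mul, map_mul, aeval_minpol, mul_zero, sub_zero, mul_assoc, ← hP, map_sub,
      aeval_X, aeval_C, ← mul_assoc, sub_mul, cas_mul_phi, ← Algebra.smul_def, sub_self, zero_mul]
  have h0 := eq_zero_of_aeval_mul_idem p k (by
    refine lt_of_le_of_lt natDegree_mul_le ?_
    rw [natDegree_X_sub_C]; omega) hz
  have hD0 : D = 0 := (mul_eq_zero.1 h0).resolve_left (X_sub_C_ne_zero _)
  rw [hP, sub_eq_zero.1 hD0, map_mul, aeval_C, ← Algebra.smul_def, smul_mul_assoc, hPc]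

theorem phi_l : phi p p.l le_rfl =
    (1 / ((Real.sqrt p.l : ℝ) : ℂ)) • aeval (cas p) (p.cofactor 0) := by
  refine ext_idem p fun k => ?_
  rw [phi_mul_idem, wtMult_l, mul_one, smul_mul_assoc,
    p.cofactor_congr (p.bet_congr (a := p.l) (b := 0) (by simp))]

/-- The weight multiplicities of `V_r` and `V_{l-r}` add up to `1`. -/
theorem phi_add_phi : phi p r hr + phi p (p.l - r) (Nat.sub_le _ _) =
    (1 / ((Real.sqrt p.l : ℝ) : ℂ)) • aeval (cas p) (p.cofactor r) := by
  refine ext_idem p fun k => ?_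
  have h : p.cofactor ((p.l - r : ℕ) : ℤ) = p.cofactor r := by
    refine p.cofactor_congr ?_
    rw [Nat.cast_sub hr, p.bet_l_sub]
  rw [add_mul, phi_mul_idem, phi_mul_idem, h, ← add_smul, ← mul_add, wtMult_add_wtMult p hr, mul_one,
    smul_mul_assoc]

end SmallQuantum

end

noncomputable section

open Polynomial hiding smul_pow

namespace SmallQuantum

open Uq

variable (p : Param)

/-! ### The right action behind the trace map -/

/-- The linear map `a ⊗ b ↦ (x ↦ S(b) x a)`. -/
def twMap : Uq p ⊗[ℂ] Uq p →ₗ[ℂ] Module.End ℂ (Uq p) :=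
  TensorProduct.lift (LinearMap.mk₂ ℂ
    (fun a b => LinearMap.mulLeft ℂ (antipodeLin p b) * LinearMap.mulRight ℂ a)
    (fun a a' b => by ext x; simp [mul_add])
    (fun c a b => by ext x; simp)
    (fun a b b' => by ext x; simp [add_mul])
    (fun c a b => by ext x; simp))

theorem twMap_tmul_apply (a b x : Uq p) :
    twMap p (a ⊗ₜ[ℂ] b) x = antipodeLin p b * (x * a) := by
  simp [twMap]

theorem twMap_mul (t s : Uq p ⊗[ℂ] Uq p) : twMap p (t * s) = twMap p s * twMap p t := by
  induction t with
  | zero => simp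
  | add t t' h h' => rw [add_mul, map_add, map_add, mul_add, h, h']
  | tmul a b =>
    induction s with
    | zero => simp
    | add s s' h h' => rw [mul_add, map_add, map_add, add_mul, h, h']
    | tmul a' b' =>
      ext x
      rw [Algebra.TensorProduct.tmul_mul_tmul, Module.End.mul_apply, twMap_tmul_apply,
        twMap_tmul_apply, twMap_tmul_apply, antipodeLin_mul]
      simp only [mul_assoc]

/-- The operator `x ↦ ∑ S(u₍₂₎) x u₍₁₎`. -/
def twAct : Uq p →ₗ[ℂ] Module.End ℂ (Uq p) := twMap p ∘ₗ (comulHom p).toLinearMap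

theorem twAct_apply (u : Uq p) : twAct p u = twMap p (comulHom p u) := rfl

/-- The operators form a right action, as the antipode reverses products. -/
theorem twAct_mul (u v : Uq p) : twAct p (u * v) = twAct p v * twAct p u := by
  rw [twAct_apply, map_mul, twMap_mul]; rfl

theorem twAct_one : twAct p 1 = 1 := by
  ext x
  rw [twAct_apply, map_one, Algebra.TensorProduct.one_def, twMap_tmul_apply]
  simp

theorem twAct_pow (u : Uq p) (n : ℕ) : twAct p (u ^ n) = twAct p u ^ n := by
  induction n with
  | zero => rw [pow_zero, pow_zero, twAct_one]
  | succ n ih => rw [pow_succ, twAct_mul, ih, pow_succ']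

theorem twAct_K (x : Uq p) : twAct p (K p) x = Kinv p * (x * K p) := by
  rw [twAct_apply, comulHom_K, twMap_tmul_apply, antipodeLin_K]

theorem twAct_F (x : Uq p) : twAct p (F p) x = x * F p - K p * F p * (x * Kinv p) := by
  rw [twAct_apply, comulHom_F, map_add, LinearMap.add_apply, twMap_tmul_apply, twMap_tmul_apply,
    antipodeLin_F, antipodeLin_one, one_mul, neg_mul, neg_add_eq_sub]

theorem twAct_E : twAct p (E p) =
    LinearMap.mulLeft ℂ (Kinv p) * LinearMap.mulRight ℂ (E p) +
      -LinearMap.mulLeft ℂ (E p * Kinv p) := by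
  ext x
  rw [twAct_apply, comulHom_E, map_add, LinearMap.add_apply, twMap_tmul_apply, twMap_tmul_apply,
    antipodeLin_E, antipodeLin_K]
  simp [add_comm, mul_assoc]

theorem twAct_center_mul {z : Uq p} (hz : z ∈ Subalgebra.center ℂ (Uq p)) (u x : Uq p) :
    twAct p u (z * x) = z * twAct p u x := by
  rw [twAct_apply]
  induction comulHom p u with
  | zero => simp
  | tmul a b =>
    rw [twMap_tmul_apply, twMap_tmul_apply, mul_assoc, ← mul_assoc,
      Subalgebra.mem_center_iff.1 hz, mul_assoc]
  | add s t hs ht => rw [map_add, LinearMap.add_apply, LinearMap.add_apply, hs, ht, mul_add]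

theorem higmanTrace_apply (x : Uq p) :
    HopfMaps.higmanTrace (integral p) (Kinv p) x = twAct p (integral p) x * Kinv p := by
  have h : HopfMaps.higmanTrace (integral p) (Kinv p) x = LinearMap.mul' ℂ (Uq p)
    (TensorProduct.map (antipodeLin p)
      (LinearMap.mulLeft ℂ x ∘ₗ LinearMap.mulRight ℂ (Kinv p))
      (TensorProduct.comm ℂ (Uq p) (Uq p) (comulHom p (integral p)))) := rfl
  rw [h, twAct_apply]
  induction comulHom p (integral p) with
  | zero => simp
  | tmul a b =>
    rw [twMap_tmul_apply, TensorProduct.comm_tmul, TensorProduct.map_tmul, LinearMap.mul'_apply]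
    simp [mul_assoc]
  | add s t hs ht => rw [map_add, map_add, map_add, hs, ht, map_add, LinearMap.add_apply, add_mul]

theorem higmanTrace_center_mul {z : Uq p} (hz : z ∈ Subalgebra.center ℂ (Uq p)) (x : Uq p) :
    HopfMaps.higmanTrace (integral p) (Kinv p) (z * x) =
      z * HopfMaps.higmanTrace (integral p) (Kinv p) x := by
  rw [higmanTrace_apply, higmanTrace_apply, twAct_center_mul p hz, mul_assoc]

/-! ### The trace map on the spanning set -/

/-- Since `K` fixes the integral, the trace map kills all elements of nonzero weight. -/
theorem higmanTrace_eq_zero_of_weight {x : Uq p} {s : ℤ} (hs : ¬ (p.l : ℤ) ∣ s)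
    (hx : Kinv p * (x * K p) = p.q ^ s • x) :
    HopfMaps.higmanTrace (integral p) (Kinv p) x = 0 := by
  rw [higmanTrace_apply]
  have h : twAct p (integral p) x = p.q ^ s • twAct p (integral p) x := by
    conv_lhs => rw [← K_mul_integral, twAct_mul, Module.End.mul_apply, twAct_K, hx, map_smul]
  have h1 : (1 - p.q ^ s) • twAct p (integral p) x = 0 := by
    rw [sub_smul, one_smul, ← h, sub_self]
  rcases smul_eq_zero.1 h1 with h2 | h2
  · exact absurd ((p.zpow_eq_one_iff s).1 (sub_eq_zero.1 h2).symm) hs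
  · rw [h2, zero_mul]

theorem not_dvd_two_mul {n : ℕ} (h0 : 0 < n) (hn : n < p.l) : ¬ (p.l : ℤ) ∣ 2 * n := fun h => by
  have := Int.le_of_dvd (by omega) (p.dvd_of_dvd_two_mul h)
  omega

theorem higmanTrace_E_pow (n : ℕ) (hn : 0 < n) (k : ℤ) :
    HopfMaps.higmanTrace (integral p) (Kinv p) (E p ^ n * idem p k) = 0 := by
  by_cases h : n < p.l
  · refine higmanTrace_eq_zero_of_weight p (s := -(2 * n)) ?_ ?_
    · rw [dvd_neg]; exact not_dvd_two_mul p hn h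
    · rw [mul_assoc, idem_mul_K, K_mul_idem, mul_smul_comm, E_pow_mul_idem, mul_smul_comm, ← mul_assoc,
        Kinv_mul_idem, smul_mul_assoc, smul_smul, ← p.zpow_add]
      congr 2; ring
  · rw [← Nat.add_sub_cancel' (not_lt.1 h), pow_add, E_pow, zero_mul, zero_mul, map_zero]

theorem higmanTrace_F_pow (n : ℕ) (hn : 0 < n) (k : ℤ) :
    HopfMaps.higmanTrace (integral p) (Kinv p) (F p ^ n * idem p k) = 0 := by
  by_cases h : n < p.l
  · refine higmanTrace_eq_zero_of_weight p (s := 2 * n) (not_dvd_two_mul p hn h) ?_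
    rw [mul_assoc, idem_mul_K, K_mul_idem, mul_smul_comm, F_pow_mul_idem, mul_smul_comm, ← mul_assoc,
      Kinv_mul_idem, smul_mul_assoc, smul_smul, ← p.zpow_add]
    congr 2; ring
  · rw [← Nat.add_sub_cancel' (not_lt.1 h), pow_add, F_pow, zero_mul, zero_mul, map_zero]

theorem K_pow_mul_F (c : ℕ) : K p ^ c * F p = p.q ^ (-(2 * c : ℤ)) • (F p * K p ^ c) := by
  rw [pow_mul_qcomm (K_mul_F p)]
  congr 1
  rw [inv_pow, ← pow_mul, zpow_neg]; norm_cast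

theorem K_mul_F_pow (n : ℕ) : K p * F p ^ n = p.q ^ (-(2 * n : ℤ)) • (F p ^ n * K p) := by
  rw [mul_pow_qcomm (K_mul_F p)]
  congr 1
  rw [inv_pow, ← pow_mul, zpow_neg]; norm_cast

/-- The scalar vanishes for `0 < c ≤ n`, because of the factor `i = c - 1`. -/
theorem twAct_F_pow_K_pow (n c : ℕ) : (twAct p (F p) ^ n) (K p ^ c) =
    (∏ i ∈ Finset.range n, (p.q ^ (-(2 * c : ℤ)) - p.q ^ (-(2 * (i + 1) : ℤ)))) •
      (F p ^ n * K p ^ c) := by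
  induction n with
  | zero => simp
  | succ n ih =>
    have h1 : F p ^ n * K p ^ c * F p = p.q ^ (-(2 * c : ℤ)) • (F p ^ (n + 1) * K p ^ c) := by
      rw [mul_assoc, K_pow_mul_F, mul_smul_comm, ← mul_assoc, pow_succ]
    have h2 : K p * F p * (F p ^ n * K p ^ c * Kinv p) =
        p.q ^ (-(2 * (n + 1) : ℤ)) • (F p ^ (n + 1) * K p ^ c) := by
      have h3 : K p * K p ^ c * Kinv p = K p ^ c := by
        rw [← pow_succ', pow_succ, mul_assoc, K_mul_Kinv, mul_one]
      have h4 := K_mul_F_pow p (n + 1)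
      push_cast at h4
      rw [mul_assoc, ← mul_assoc (F p), ← mul_assoc (F p), ← pow_succ', ← mul_assoc, ← mul_assoc, h4,
        smul_mul_assoc, smul_mul_assoc, mul_assoc, mul_assoc, ← mul_assoc (K p), h3]
    rw [pow_succ', Module.End.mul_apply, ih, map_smul, twAct_F, h1, h2, ← sub_smul, smul_smul,
      Finset.prod_range_succ]

theorem integral_eq_mul : ∃ ζ : ℂ, ζ ≠ 0 ∧ integral p =
    ζ • (F p ^ (p.l - 1) * E p ^ (p.l - 1) * ∑ j ∈ Finset.range p.l, K p ^ j) := by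
  refine ⟨_, div_ne_zero ?_ (pow_ne_zero _ (p.qFact_ne_zero (by have := p.l_pos; omega))), rfl⟩
  rw [Complex.ofReal_ne_zero, Real.sqrt_ne_zero']
  exact_mod_cast p.l_pos

theorem higmanTrace_K_pow {c : ℕ} (h0 : 0 < c) (hc : c < p.l) :
    HopfMaps.higmanTrace (integral p) (Kinv p) (K p ^ c) = 0 := by
  obtain ⟨ζ, -, hζ⟩ := integral_eq_mul p
  rw [higmanTrace_apply, hζ, map_smul, mul_assoc, twAct_mul, twAct_pow, LinearMap.smul_apply,
    Module.End.mul_apply, twAct_F_pow_K_pow, Finset.prod_eq_zero (i := c - 1)]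
  · simp
  · exact Finset.mem_range.2 (by omega)
  · rw [Nat.cast_sub h0]; simp

/-- The Gaussian binomial coefficients with top entry `l - 1` are signed powers of `q`. -/
theorem gauss_pred (k : ℕ) (hk : k < p.l) :
    gauss (p.q ^ 2) (p.l - 1) k = (-1) ^ k * p.q ^ (-(k * (k + 1) : ℤ)) := by
  induction k with
  | zero => simp [gauss_zero]
  | succ k ih =>
    have h := gauss_eq_zero p.prim_sq (Nat.succ_pos k) hk
    have hl : p.l = p.l - 1 + 1 := by have := p.l_pos; omega
    rw [hl, Nat.succ_eq_add_one, gauss, ih (by omega)] at h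
    have hq : (p.q ^ 2) ^ (k + 1) = p.q ^ (2 * (k + 1) : ℤ) := by rw [← pow_mul]; norm_cast
    rw [hq] at h
    have e1 : p.q ^ (2 * (k + 1) : ℤ) * p.q ^ (-(((k + 1 : ℕ) : ℤ) * ((k + 1 : ℕ) + 1))) =
        p.q ^ (-(k * (k + 1) : ℤ)) := by
      rw [← p.zpow_add]; congr 1; push_cast; ring
    refine mul_left_cancel₀ (p.zpow_ne_zero (2 * (k + 1))) ?_
    rw [pow_succ (-1 : ℂ) k]
    linear_combination h - (-1) ^ k * (-1) * e1

theorem E_mul_Kinv_pow (j : ℕ) :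
    (E p * Kinv p) ^ j = p.q ^ (j * (j + 1) : ℤ) • (Kinv p ^ j * E p ^ j) := by
  have h : ∀ n : ℕ, E p * Kinv p ^ n = p.q ^ (2 * n : ℤ) • (Kinv p ^ n * E p) := by
    intro n
    have h1 := pow_mul_qcomm (Kinv_mul_E p) n
    rw [h1, smul_smul, inv_pow, ← pow_mul]
    have : p.q ^ (2 * n : ℤ) = p.q ^ (2 * n) := by norm_cast
    rw [this, mul_inv_cancel₀ (pow_ne_zero _ p.q_ne_zero), one_smul]
  induction j with
  | zero => simp
  | succ j ih =>
    rw [pow_succ', ih, mul_smul_comm, mul_assoc, ← mul_assoc (Kinv p), ← pow_succ', ← mul_assoc, h,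
      smul_mul_assoc, smul_smul, mul_assoc, ← pow_succ', ← p.zpow_add]
    congr 2; push_cast; ring

/-- The operator of `E` is a sum of two `q`-commuting operators, and the Gaussian binomial coefficients
cancel against the powers of `q` from reordering. -/
theorem twAct_E_pow_pred (x : Uq p) : (twAct p (E p) ^ (p.l - 1)) x =
    K p * ∑ b ∈ Finset.range p.l, E p ^ b * x * E p ^ (p.l - 1 - b) := by
  have hl := p.l_pos
  have hcomm : -LinearMap.mulLeft ℂ (E p * Kinv p) *
      (LinearMap.mulLeft ℂ (Kinv p) * LinearMap.mulRight ℂ (E p)) = (p.q ^ 2) •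
      ((LinearMap.mulLeft ℂ (Kinv p) * LinearMap.mulRight ℂ (E p)) *
        -LinearMap.mulLeft ℂ (E p * Kinv p)) := by
    ext x
    have h1 : Kinv p * (E p * Kinv p) = (p.q ^ 2)⁻¹ • (E p * Kinv p * Kinv p) := by
      rw [← mul_assoc, Kinv_mul_E, smul_mul_assoc]
    simp only [Module.End.mul_apply, LinearMap.neg_apply, LinearMap.smul_apply,
      LinearMap.mulLeft_apply, LinearMap.mulRight_apply]
    rw [neg_mul, mul_neg, mul_assoc (E p * Kinv p) x, ← mul_assoc (Kinv p) (E p * Kinv p), h1,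
      smul_mul_assoc, smul_neg, smul_smul, mul_inv_cancel₀ (pow_ne_zero _ p.q_ne_zero), one_smul,
      ← mul_assoc (E p * Kinv p) (Kinv p)]
  rw [twAct_E, add_pow_qcomm hcomm, Nat.sub_add_cancel hl, LinearMap.sum_apply, Finset.mul_sum,
    ← Finset.sum_range_reflect]
  refine Finset.sum_congr rfl fun b hb => ?_
  have hb := Finset.mem_range.1 hb
  have hA : ∀ (k : ℕ) (y : Uq p),
      ((LinearMap.mulLeft ℂ (Kinv p) * LinearMap.mulRight ℂ (E p)) ^ k) y =
        Kinv p ^ k * (y * E p ^ k) := by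
    intro k
    induction k with
    | zero => simp
    | succ k ih =>
      intro y
      rw [pow_succ', Module.End.mul_apply, ih, Module.End.mul_apply, LinearMap.mulLeft_apply,
        LinearMap.mulRight_apply, pow_succ', pow_succ]
      simp only [mul_assoc]
  have hB : ∀ (k : ℕ) (y : Uq p), ((-LinearMap.mulLeft ℂ (E p * Kinv p)) ^ k) y =
      (-1 : ℂ) ^ k • ((E p * Kinv p) ^ k * y) := by
    intro k
    induction k with
    | zero => simp
    | succ k ih =>
      intro y
      rw [pow_succ', Module.End.mul_apply, ih, map_smul, LinearMap.neg_apply, LinearMap.mulLeft_apply,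
        pow_succ' (E p * Kinv p), pow_succ (-1 : ℂ), mul_smul, neg_one_smul, mul_assoc (E p * Kinv p)]
  have hsub : p.l - 1 - (p.l - 1 - b) = b := by omega
  have hK : Kinv p ^ (p.l - 1 - b) * Kinv p ^ b = K p := by
    rw [← pow_add, Nat.sub_add_cancel (by omega), Kinv_pow_pred]
  have hcoef : (-1 : ℂ) ^ (p.l - 1 - b) * p.q ^ (-(((p.l - 1 - b : ℕ) : ℤ) * ((p.l - 1 - b : ℕ) + 1))) *
      ((-1) ^ b * p.q ^ ((b : ℤ) * (b + 1))) = 1 := by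
    have he : Even (p.l - 1) := by unfold Param.l; simp
    rw [mul_mul_mul_comm, ← pow_add, Nat.sub_add_cancel (by omega), he.neg_one_pow, one_mul,
      ← p.zpow_add, p.zpow_eq_one_iff, Nat.cast_sub (by omega), Nat.cast_sub (by omega)]
    exact ⟨1 + 2 * b - p.l, by push_cast; ring⟩
  rw [LinearMap.smul_apply, Module.End.mul_apply, hA, hsub, hB, E_mul_Kinv_pow,
    gauss_pred p _ (by omega), smul_mul_assoc, smul_mul_assoc, smul_mul_assoc, smul_smul,
    mul_smul_comm, smul_smul, hcoef, one_smul, mul_assoc (Kinv p ^ b), mul_assoc (Kinv p ^ b), ← mul_assoc, hK]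

/-- On each eigenspace of `K` the summand with index `b` is the cofactor of one node. -/
theorem sum_E_pow_F_pow_E_pow : p.c ^ (p.l - 1) •
    ∑ b ∈ Finset.range p.l, E p ^ b * F p ^ (p.l - 1) * E p ^ (p.l - 1 - b) =
      (p.l : ℂ) • aeval (cas p) (Chebyshev.S ℂ (p.l - 1)) := by
  refine ext_idem p fun j => ?_
  have h1 : ∀ b ∈ Finset.range p.l, p.c ^ (p.l - 1) •
      (E p ^ b * F p ^ (p.l - 1) * E p ^ (p.l - 1 - b)) * idem p j =
      aeval (cas p) (p.cofactor (j - 1 - 2 * b)) * idem p j := by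
    intro b hb
    have hb := Finset.mem_range.1 hb
    obtain ⟨a, ha⟩ : ∃ a, p.l - 1 - b = a := ⟨_, rfl⟩
    have h2 : E p ^ b * F p ^ (b + a) * E p ^ a * idem p j =
        E p ^ b * F p ^ b * (F p ^ a * E p ^ a * idem p j) := by
      rw [pow_add]; simp only [mul_assoc]
    rw [← p.prod_mul_prod_nodes j hb, ha, show p.l - 1 = b + a by omega, pow_add p.c,
      smul_mul_assoc, h2, mul_smul, ← mul_smul_comm, F_pow_E_pow_mul_idem, ← mul_assoc,
      aeval_cas_comm, mul_assoc, ← mul_smul_comm, E_pow_F_pow_mul_idem, ← mul_assoc, ← map_mul,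
      mul_comm]
  rw [Finset.smul_sum, Finset.sum_mul, Finset.sum_congr rfl h1, ← Finset.sum_mul, ← map_sum,
    p.sum_cofactor, map_mul, map_natCast, ← nsmul_eq_mul, ← Nat.cast_smul_eq_nsmul ℂ]

theorem higmanTrace_one : ∃ e : ℂ, e ≠ 0 ∧ HopfMaps.higmanTrace (integral p) (Kinv p) 1 =
    e • aeval (cas p) (Chebyshev.S ℂ (p.l - 1)) := by
  obtain ⟨ζ, hζ0, hζ⟩ := integral_eq_mul p
  let a : ℂ := ∏ i ∈ Finset.range (p.l - 1), (1 - p.q ^ (-(2 * (i + 1) : ℤ)))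
  have ha : a ≠ 0 := by
    refine Finset.prod_ne_zero_iff.2 fun i hi => ?_
    have hi := Finset.mem_range.1 hi
    rw [sub_ne_zero, ne_comm, Ne, p.zpow_eq_one_iff, dvd_neg]
    exact_mod_cast not_dvd_two_mul p (Nat.succ_pos i) (by omega)
  have hc := pow_ne_zero (p.l - 1) p.c_ne_zero
  have hl := p.l_ne_zero
  refine ⟨ζ * a * (p.l * ((p.c ^ (p.l - 1))⁻¹ * p.l)),
    mul_ne_zero (mul_ne_zero hζ0 ha) (mul_ne_zero hl (mul_ne_zero (inv_ne_zero hc) hl)), ?_⟩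
  have hF : (twAct p (F p) ^ (p.l - 1)) 1 = a • F p ^ (p.l - 1) := by
    have := twAct_F_pow_K_pow p (p.l - 1) 0
    simpa [a] using this
  let Y : Uq p := ((p.c ^ (p.l - 1))⁻¹ * p.l) • aeval (cas p) (Chebyshev.S ℂ (p.l - 1))
  have hY : ∑ b ∈ Finset.range p.l, E p ^ b * F p ^ (p.l - 1) * E p ^ (p.l - 1 - b) = Y := by
    simp only [Y]
    rw [mul_smul, ← sum_E_pow_F_pow_E_pow, smul_smul, inv_mul_cancel₀ hc, one_smul]
  have hYc : ∀ x, x * Y = Y * x := fun x => by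
    simp only [Y]
    rw [mul_smul_comm, aeval_cas_comm, smul_mul_assoc]
  have hK : ∀ j : ℕ, (twAct p (K p) ^ j) (K p * Y) = K p * Y := by
    intro j
    induction j with
    | zero => simp
    | succ j ih =>
      rw [pow_succ', Module.End.mul_apply, ih, twAct_K, mul_assoc, ← hYc, ← mul_assoc, Kinv_mul_K,
        one_mul]
  rw [higmanTrace_apply, hζ, map_smul, twAct_mul, twAct_mul, twAct_pow, twAct_pow, map_sum,
    LinearMap.smul_apply, Module.End.mul_apply, Module.End.mul_apply, hF, map_smul,
    twAct_E_pow_pred, hY, map_smul, LinearMap.sum_apply]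
  simp only [twAct_pow, hK]
  rw [Finset.sum_const, Finset.card_range, ← Nat.cast_smul_eq_nsmul ℂ, smul_mul_assoc,
    smul_mul_assoc, smul_mul_assoc, mul_assoc, ← hYc, ← mul_assoc, K_mul_Kinv, one_mul, smul_smul,
    smul_smul]
  simp only [Y]
  rw [smul_smul]
  congr 1
  ring

/-- The Higman ideal is the principal ideal generated by `χ(l)` in the algebra of polynomials in the
Casimir element. -/
theorem mem_higman_iff (x : Uq p) :
    x ∈ higman p ↔ ∃ f : ℂ[X], x = aeval (cas p) (f * Chebyshev.S ℂ (p.l - 1)) := by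
  obtain ⟨e, he, h1⟩ := higmanTrace_one p
  have hl := p.l_pos
  constructor
  · rintro ⟨y, rfl⟩
    have hidem : ∀ (f : ℂ[X]) (k : ℤ), ∃ g : ℂ[X],
        HopfMaps.higmanTrace (integral p) (Kinv p) (aeval (cas p) f * idem p k) =
          aeval (cas p) (g * Chebyshev.S ℂ (p.l - 1)) := by
      intro f k
      refine ⟨(1 / (p.l : ℂ) * e) • f, ?_⟩
      rw [higmanTrace_center_mul p (aeval_cas_mem_center p f), idem, map_smul, map_sum,
        Finset.sum_eq_single 0]
      · rw [pow_zero, h1, smul_smul, mul_smul_comm, smul_mul_assoc, map_smul, map_mul]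
      · intro j hj hj0
        rw [smul_pow, map_smul, higmanTrace_K_pow p (Nat.pos_of_ne_zero hj0) (Finset.mem_range.1 hj),
          smul_zero]
      · intro h
        exact absurd (Finset.mem_range.2 hl) h
    induction y using span_induction with
    | hE f n k =>
      rcases n.eq_zero_or_pos with rfl | hn
      · rw [pow_zero, one_mul]; exact hidem f k
      · refine ⟨0, ?_⟩
        rw [higmanTrace_center_mul p (aeval_cas_mem_center p f), higmanTrace_E_pow p n hn]
        simp
    | hF f n k =>
      rcases n.eq_zero_or_pos with rfl | hn
      · rw [pow_zero, one_mul]; exact hidem f k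
      · refine ⟨0, ?_⟩
        rw [higmanTrace_center_mul p (aeval_cas_mem_center p f), higmanTrace_F_pow p n hn]
        simp
    | hadd x y hx hy =>
      obtain ⟨f, hf⟩ := hx
      obtain ⟨g, hg⟩ := hy
      exact ⟨f + g, by rw [map_add, hf, hg, add_mul, map_add]⟩
  · rintro ⟨f, rfl⟩
    refine ⟨e⁻¹ • (aeval (cas p) f * 1), ?_⟩
    rw [map_smul, higmanTrace_center_mul p (aeval_cas_mem_center p f), h1, mul_smul_comm, smul_smul,
      inv_mul_cancel₀ he, one_smul, map_mul]

end SmallQuantum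

end

noncomputable section

open Polynomial hiding smul_pow

namespace SmallQuantum

open Uq

variable (p : Param)

/-! ### The Higman ideal inside the Casimir algebra -/

/-- The cofactor of a node is an eigenvector of the Casimir element. -/
theorem aeval_mul_cofactor (f : ℂ[X]) (n : ℤ) : aeval (cas p) (f * p.cofactor n) =
    f.eval (p.bet n) • aeval (cas p) (p.cofactor n) := by
  obtain ⟨g, hg⟩ := X_sub_C_dvd_sub_C_eval (a := p.bet n) (p := f)
  have h : f * p.cofactor n = f.eval (p.bet n) • p.cofactor n + g * p.minpol := by
    rw [← p.mul_cofactor n, smul_eq_C_mul]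
    linear_combination p.cofactor n * hg
  rw [h, map_add, map_mul, aeval_minpol, mul_zero, add_zero, map_smul]

theorem aeval_cofactor_ne_zero (n : ℤ) : aeval (cas p) (p.cofactor n) ≠ 0 := fun h => by
  refine (p.monic_cofactor n).ne_zero (eq_zero_of_aeval_mul_idem p 0 ?_ (by rw [h, zero_mul]))
  have := p.l_pos
  rw [p.natDegree_cofactor]; omega

/-- Every node is one of the nodes of index at most `h`. -/
theorem Param.exists_bet_eq (n : ℤ) : ∃ r : Fin (p.h + 1), p.bet n = p.bet (r : ℕ) := by
  have hl : (p.l : ℤ) = 2 * p.h + 1 := by simp [Param.l]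
  have h0 := Int.emod_nonneg n (b := p.l) (by omega)
  have h1 := Int.emod_lt_of_pos n (b := p.l) (by omega)
  have hd : (p.l : ℤ) ∣ n - n % p.l := Int.dvd_self_sub_emod
  obtain ⟨m, hm⟩ : ∃ m, n % p.l = m := ⟨_, rfl⟩
  rw [hm] at h0 h1 hd
  by_cases h : m ≤ p.h
  · refine ⟨⟨m.toNat, by omega⟩, p.bet_congr ?_⟩
    rwa [Int.toNat_of_nonneg h0]
  · refine ⟨⟨(p.l - m).toNat, by omega⟩, ?_⟩
    rw [Int.toNat_of_nonneg (by omega), p.bet_l_sub]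
    exact p.bet_congr hd

theorem phiSum_eq (r : Fin (p.h + 1)) : phiSum p r =
    (1 / ((Real.sqrt p.l : ℝ) : ℂ)) • aeval (cas p) (p.cofactor (r : ℕ)) := by
  rw [phiSum]
  split_ifs with h
  · rw [phi_l, h]; simp
  · exact phi_add_phi p (by have := r.isLt; unfold Param.l; omega)

theorem sqrt_l_ne_zero : ((Real.sqrt p.l : ℝ) : ℂ) ≠ 0 := by
  rw [Complex.ofReal_ne_zero, Real.sqrt_ne_zero']
  exact_mod_cast p.l_pos

theorem aeval_cofactor_mem_span (n : ℤ) :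
    aeval (cas p) (p.cofactor n) ∈ Submodule.span ℂ (Set.range (phiSum p)) := by
  obtain ⟨r, hr⟩ := p.exists_bet_eq n
  have h : aeval (cas p) (p.cofactor n) = ((Real.sqrt p.l : ℝ) : ℂ) • phiSum p r := by
    rw [phiSum_eq, smul_smul, mul_one_div_cancel (sqrt_l_ne_zero p), one_smul, p.cofactor_congr hr]
  rw [h]
  exact Submodule.smul_mem _ _ (Submodule.subset_span ⟨r, rfl⟩)

/-- The decomposition into Casimir eigenvectors of the multiples of `χ(l)`. -/
theorem l_smul_aeval_mul (f : ℂ[X]) : (p.l : ℂ) • aeval (cas p) (f * Chebyshev.S ℂ (p.l - 1)) =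
    ∑ b ∈ Finset.range p.l, f.eval (p.bet (0 - 2 * (b : ℤ))) •
      aeval (cas p) (p.cofactor (0 - 2 * (b : ℤ))) := by
  simp only [← aeval_mul_cofactor]
  rw [← map_sum, ← Finset.mul_sum, p.sum_cofactor, ← map_smul]
  congr 1
  rw [smul_eq_C_mul, map_natCast]
  ring

theorem higman_le_span_phiSum : higman p ≤ Submodule.span ℂ (Set.range (phiSum p)) := by
  intro x hx
  obtain ⟨f, rfl⟩ := (mem_higman_iff p x).1 hx
  rw [← inv_smul_smul₀ p.l_ne_zero (aeval (cas p) (f * Chebyshev.S ℂ (p.l - 1))), l_smul_aeval_mul]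
  exact Submodule.smul_mem _ _ (Submodule.sum_mem _ fun b _ =>
    Submodule.smul_mem _ _ (aeval_cofactor_mem_span p _))

theorem aeval_cofactor_mem_higman (n : ℤ) : aeval (cas p) (p.cofactor n) ∈ higman p := by
  obtain ⟨r, hr⟩ := p.exists_bet_eq n
  rw [p.cofactor_congr hr]
  -- Lagrange interpolation isolates the eigenvalue with index `r`.
  let f : ℂ[X] := ∏ s ∈ Finset.univ.erase r, (X - C (p.bet (s : ℕ)))
  have hf : ∀ s : Fin (p.h + 1), s ≠ r → f.eval (p.bet (s : ℕ)) = 0 := fun s hs => by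
    simp only [f]
    rw [eval_prod]
    exact Finset.prod_eq_zero (Finset.mem_erase.2 ⟨hs, Finset.mem_univ s⟩) (by simp)
  have hfr : f.eval (p.bet (r : ℕ)) ≠ 0 := by
    simp only [f]
    rw [eval_prod]
    refine Finset.prod_ne_zero_iff.2 fun s hs => ?_
    rw [eval_sub, eval_X, eval_C, sub_ne_zero]
    intro h
    exact (Finset.mem_erase.1 hs).1
      (Fin.ext (p.bet_injOn (Nat.lt_succ_iff.1 r.isLt) (Nat.lt_succ_iff.1 s.isLt) h)).symm
  -- the multiplicity of the node `r` among the nodes `-2b`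
  let N : ℕ := ((Finset.range p.l).filter
    fun b : ℕ => p.bet (0 - 2 * (b : ℤ)) = p.bet (r : ℕ)).card
  have hN : (N : ℂ) ≠ 0 := by
    rw [Nat.cast_ne_zero]
    refine Finset.card_ne_zero.2 ?_
    have h1 := sum_ite_dvd_weight p (r : ℕ)
    obtain ⟨b, hb, hb'⟩ := Finset.exists_ne_zero_of_sum_ne_zero (h1.trans_ne one_ne_zero)
    have hd : (p.l : ℤ) ∣ (r : ℕ) - 2 * (b : ℤ) := by
      by_contra h
      exact hb' (if_neg h)
    refine ⟨b, Finset.mem_filter.2 ⟨hb, ?_⟩⟩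
    rw [zero_sub, p.bet_neg]
    exact (p.bet_congr hd).symm
  have key : (p.l : ℂ) • aeval (cas p) (f * Chebyshev.S ℂ (p.l - 1)) =
      (N * f.eval (p.bet (r : ℕ))) • aeval (cas p) (p.cofactor (r : ℕ)) := by
    rw [l_smul_aeval_mul, ← Finset.sum_filter_add_sum_filter_not (Finset.range p.l)
      fun b : ℕ => p.bet (0 - 2 * (b : ℤ)) = p.bet (r : ℕ), Finset.sum_congr rfl
      (g := fun _ => f.eval (p.bet (r : ℕ)) • aeval (cas p) (p.cofactor (r : ℕ))),
      Finset.sum_const, Finset.sum_eq_zero, add_zero, ← Nat.cast_smul_eq_nsmul ℂ, smul_smul]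
    · intro b hb
      obtain ⟨s, hs⟩ := p.exists_bet_eq (0 - 2 * (b : ℤ))
      rw [hs, hf s, zero_smul]
      rintro rfl
      exact (Finset.mem_filter.1 hb).2 hs
    · intro b hb
      have hb := (Finset.mem_filter.1 hb).2
      rw [hb, p.cofactor_congr hb]
  refine (mem_higman_iff p _).2 ⟨((N * f.eval (p.bet (r : ℕ)))⁻¹ * p.l) • f, ?_⟩
  rw [smul_mul_assoc, map_smul, mul_smul, key, inv_smul_smul₀ (mul_ne_zero hN hfr)]

theorem span_phiSum : Submodule.span ℂ (Set.range (phiSum p)) = higman p := by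
  refine le_antisymm (Submodule.span_le.2 ?_) (higman_le_span_phiSum p)
  rintro _ ⟨r, rfl⟩
  rw [phiSum_eq]
  exact Submodule.smul_mem _ _ (aeval_cofactor_mem_higman p _)

/-- The sums of Radford images are eigenvectors of the Casimir element with distinct eigenvalues. -/
theorem linearIndependent_phiSum : LinearIndependent ℂ (phiSum p) := by
  refine Module.End.eigenvectors_linearIndependent' (LinearMap.mulLeft ℂ (cas p))
    (fun r : Fin (p.h + 1) => p.bet (r : ℕ)) ?_ _ fun r => ?_
  · intro r s h
    exact Fin.ext (p.bet_injOn (Nat.lt_succ_iff.1 r.isLt) (Nat.lt_succ_iff.1 s.isLt) h)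
  · rw [Module.End.hasEigenvector_iff, Module.End.mem_eigenspace_iff, phiSum_eq]
    refine ⟨?_, smul_ne_zero (one_div_ne_zero (sqrt_l_ne_zero p)) (aeval_cofactor_ne_zero p _)⟩
    have h := aeval_mul_cofactor p X (r : ℕ)
    rw [map_mul, aeval_X, eval_X] at h
    rw [LinearMap.mulLeft_apply, mul_smul_comm, h, smul_comm]

/-! ### Drinfeld images and the transformation matrix -/

theorem chi_eq_of_one_le {r : ℕ} (h0 : 1 ≤ r) (hr : r ≤ p.l) :
    chi p r hr = aeval (cas p) (Chebyshev.S ℂ ((r - 1 : ℕ) : ℤ)) := by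
  obtain ⟨n, rfl⟩ : ∃ n, r = n + 1 := ⟨r - 1, by omega⟩
  exact chi_eq p hr

theorem nu_zero : nu p 0 = aeval (cas p) (Chebyshev.S ℂ (p.l - 1)) := by
  rw [nu, if_pos rfl, chi_eq_of_one_le p p.l_pos, Nat.cast_sub p.l_pos, Nat.cast_one]

theorem nu_succ (i : Fin p.h) : nu p i.succ =
    aeval (cas p) (Chebyshev.S ℂ (i : ℕ) + Chebyshev.S ℂ ((2 * p.h - 1 - i : ℕ) : ℤ)) := by
  have hi := i.isLt
  have hl : p.l = 2 * p.h + 1 := rfl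
  rw [nu, if_neg (Fin.succ_ne_zero i), map_add, chi_eq_of_one_le p (by simp) (by rw [Fin.val_succ]; omega),
    chi_eq_of_one_le p (by rw [Fin.val_succ]; omega)]
  rw [Fin.val_succ, Nat.add_sub_cancel, show p.l - (i + 1) - 1 = 2 * p.h - 1 - i by omega]

/-- The cofactor, folded along the symmetry `j ↦ l - j` of its coefficients. -/
theorem Param.cofactor_eq_sum (r : ℤ) : p.cofactor r = Chebyshev.S ℂ (p.l - 1) +
    ∑ i : Fin p.h, C (p.bet ((i + 1) * r)) *
      (Chebyshev.S ℂ (i : ℕ) + Chebyshev.S ℂ ((2 * p.h - 1 - i : ℕ) : ℤ)) := by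
  have hl : p.l = 2 * p.h + 1 := rfl
  rw [Param.cofactor, Fin.sum_univ_eq_sum_range (fun i : ℕ => C (p.bet ((i + 1) * r)) *
    (Chebyshev.S ℂ (i : ℕ) + Chebyshev.S ℂ ((2 * p.h - 1 - i : ℕ) : ℤ))) p.h,
    show p.l - 1 = p.h + p.h by omega, Finset.sum_range_add]
  simp only [mul_add, Finset.sum_add_distrib]
  congr 2
  rw [← Finset.sum_range_reflect]
  refine Finset.sum_congr rfl fun i hi => ?_
  have hi := Finset.mem_range.1 hi
  have h1 : p.h + (p.h - 1 - i) = 2 * p.h - 1 - i := by omega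
  rw [h1]
  congr 2
  rw [← p.bet_neg ((i + 1) * r)]
  refine p.bet_congr ⟨r, ?_⟩
  rw [hl, Nat.cast_sub (by omega), Nat.cast_sub (by omega)]
  push_cast
  ring

theorem phiSum_eq_sum (r : Fin (p.h + 1)) : phiSum p r = ∑ j, sMatrix p j r • nu p j := by
  rw [phiSum_eq, p.cofactor_eq_sum, Fin.sum_univ_succ, map_add, map_sum, smul_add, Finset.smul_sum,
    nu_zero]
  congr 1
  · simp [sMatrix]
  · refine Finset.sum_congr rfl fun i _ => ?_
    rw [nu_succ, map_mul, aeval_C, ← Algebra.smul_def, smul_smul]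
    simp [sMatrix, Param.bet, Fin.succ_ne_zero]

/-- The `h + 1` elements `ν(r)` span at least the Higman ideal, which has dimension `h + 1`. -/
theorem linearIndependent_nu_and_span :
    LinearIndependent ℂ (nu p) ∧ Submodule.span ℂ (Set.range (nu p)) = higman p := by
  have hle : higman p ≤ Submodule.span ℂ (Set.range (nu p)) := by
    rw [← span_phiSum, Submodule.span_le]
    rintro _ ⟨r, rfl⟩
    rw [phiSum_eq_sum]
    exact Submodule.sum_mem _ fun j _ => Submodule.smul_mem _ _ (Submodule.subset_span ⟨j, rfl⟩)
  have hcard : Module.finrank ℂ (higman p) = p.h + 1 := by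
    rw [← span_phiSum, finrank_span_eq_card (linearIndependent_phiSum p), Fintype.card_fin]
  have hfin : FiniteDimensional ℂ (Submodule.span ℂ (Set.range (nu p))) :=
    FiniteDimensional.span_of_finite ℂ (Set.finite_range _)
  have h1 := Submodule.finrank_mono hle
  have h2 := finrank_range_le_card (R := ℂ) (nu p)
  rw [Set.finrank, Fintype.card_fin] at h2
  refine ⟨linearIndependent_iff_card_eq_finrank_span.2 ?_,
    (Submodule.eq_of_le_of_finrank_le hle (by omega)).symm⟩
  rw [Set.finrank, Fintype.card_fin]
  omega

/-! ### The intersection of the Drinfeld and Radford images -/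

theorem drinfeldImage_le_center :
    drinfeldImage p ≤ Subalgebra.toSubmodule (Subalgebra.center ℂ (Uq p)) := by
  refine Submodule.span_le.2 ?_
  rintro _ ⟨r, h0, hr, rfl⟩
  rw [chi_eq_of_one_le p h0 hr]
  exact aeval_cas_mem_center p _

theorem radfordImage_le_center :
    radfordImage p ≤ Subalgebra.toSubmodule (Subalgebra.center ℂ (Uq p)) := by
  refine Submodule.span_le.2 ?_
  rintro _ ⟨r, h0, hr, rfl⟩
  exact phi_mem_center p hr

theorem nu_mem_drinfeldImage (r : Fin (p.h + 1)) : nu p r ∈ drinfeldImage p := by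
  have hr := r.isLt
  have hl : p.l = 2 * p.h + 1 := rfl
  rw [nu]
  split_ifs with h
  · exact Submodule.subset_span ⟨p.l, p.l_pos, le_rfl, rfl⟩
  · have h0 : (r : ℕ) ≠ 0 := fun h' => h (Fin.ext h')
    exact add_mem (Submodule.subset_span ⟨r, by omega, _, rfl⟩)
      (Submodule.subset_span ⟨p.l - r, by omega, _, rfl⟩)

theorem phiSum_mem_radfordImage (r : Fin (p.h + 1)) : phiSum p r ∈ radfordImage p := by
  have hr := r.isLt
  have hl : p.l = 2 * p.h + 1 := rfl
  rw [phiSum]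
  split_ifs with h
  · exact Submodule.subset_span ⟨p.l, p.l_pos, le_rfl, rfl⟩
  · have h0 : (r : ℕ) ≠ 0 := fun h' => h (Fin.ext h')
    exact add_mem (Submodule.subset_span ⟨r, by omega, _, rfl⟩)
      (Submodule.subset_span ⟨p.l - r, by omega, _, rfl⟩)

theorem exists_aeval_of_mem_drinfeldImage {x : Uq p} (hx : x ∈ drinfeldImage p) :
    ∃ f : ℂ[X], f.natDegree < p.l ∧ x = aeval (cas p) f := by
  have hl := p.l_pos
  induction hx using Submodule.span_induction with
  | mem x hx =>
    obtain ⟨r, h0, hr, rfl⟩ := hx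
    refine ⟨_, ?_, chi_eq_of_one_le p h0 hr⟩
    rw [(monic_and_natDegree_chebyshev_S _).2]
    omega
  | zero => exact ⟨0, by simpa using hl, by simp⟩
  | add x y _ _ hx hy =>
    obtain ⟨f, hf, rfl⟩ := hx
    obtain ⟨g, hg, rfl⟩ := hy
    exact ⟨f + g, (natDegree_add_le _ _).trans_lt (max_lt hf hg), (map_add _ _ _).symm⟩
  | smul a x _ hx =>
    obtain ⟨f, hf, rfl⟩ := hx
    exact ⟨a • f, (natDegree_smul_le _ _).trans_lt hf, (map_smul _ _ _).symm⟩

/-- On a single weight space, an element of the Radford image coincides with an element of the Higman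
ideal. -/
theorem exists_aeval_of_mem_radfordImage {x : Uq p} (hx : x ∈ radfordImage p) (k : ℤ) :
    ∃ g : ℂ[X], g.natDegree < p.l ∧ aeval (cas p) g ∈ higman p ∧
      x * idem p k = aeval (cas p) g * idem p k := by
  have hl := p.l_pos
  induction hx using Submodule.span_induction with
  | mem x hx =>
    obtain ⟨r, h0, hr, rfl⟩ := hx
    refine ⟨(1 / ((Real.sqrt p.l : ℝ) : ℂ) * wtMult p r k) • p.cofactor r, ?_, ?_, ?_⟩
    · refine (natDegree_smul_le _ _).trans_lt ?_
      rw [p.natDegree_cofactor]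
      omega
    · rw [map_smul]
      exact Submodule.smul_mem _ _ (aeval_cofactor_mem_higman p _)
    · rw [phi_mul_idem, map_smul, smul_mul_assoc]
  | zero => exact ⟨0, by simpa using hl, by simp, by simp⟩
  | add x y _ _ hx hy =>
    obtain ⟨f, hf, hf', hfx⟩ := hx
    obtain ⟨g, hg, hg', hgy⟩ := hy
    exact ⟨f + g, (natDegree_add_le _ _).trans_lt (max_lt hf hg),
      by rw [map_add]; exact add_mem hf' hg', by rw [map_add, add_mul, add_mul, hfx, hgy]⟩
  | smul a x _ hx =>
    obtain ⟨f, hf, hf', hfx⟩ := hx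
    exact ⟨a • f, (natDegree_smul_le _ _).trans_lt hf,
      by rw [map_smul]; exact Submodule.smul_mem _ _ hf',
      by rw [map_smul, smul_mul_assoc, smul_mul_assoc, hfx]⟩

/-- An element of the intersection is determined, as a polynomial in the Casimir element of degree less
than `l`, by its component on one weight space. -/
theorem drinfeldImage_inf_radfordImage : drinfeldImage p ⊓ radfordImage p = higman p := by
  refine le_antisymm ?_ (le_inf ?_ ?_)
  · rintro x ⟨hD, hR⟩
    obtain ⟨f, hf, rfl⟩ := exists_aeval_of_mem_drinfeldImage p hD
    obtain ⟨g, hg, hgH, hfg⟩ := exists_aeval_of_mem_radfordImage p hR 0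
    have h : f - g = 0 := eq_zero_of_aeval_mul_idem p 0
      ((natDegree_sub_le _ _).trans_lt (max_lt hf hg))
      (by rw [map_sub, sub_mul, hfg, sub_self])
    rwa [sub_eq_zero.1 h]
  · rw [← (linearIndependent_nu_and_span p).2, Submodule.span_le]
    rintro _ ⟨r, rfl⟩
    exact nu_mem_drinfeldImage p r
  · rw [← span_phiSum, Submodule.span_le]
    rintro _ ⟨r, rfl⟩
    exact phiSum_mem_radfordImage p r

end SmallQuantum

end

theorem mainTheorem2 (h : ℕ) (hh : 1 ≤ h) (q : ℂ) (hq : IsPrimitiveRoot q (2 * h + 1)) :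
    let p : SmallQuantum.Param := ⟨h, hh, q, hq⟩
    SmallQuantum.drinfeldImage p ≤
        Subalgebra.toSubmodule (Subalgebra.center ℂ (SmallQuantum.Uq p)) ∧
      SmallQuantum.radfordImage p ≤
        Subalgebra.toSubmodule (Subalgebra.center ℂ (SmallQuantum.Uq p)) ∧
      SmallQuantum.drinfeldImage p ⊓ SmallQuantum.radfordImage p = SmallQuantum.higman p ∧
      LinearIndependent ℂ (SmallQuantum.nu p) ∧
      Submodule.span ℂ (Set.range (SmallQuantum.nu p)) = SmallQuantum.higman p ∧
      LinearIndependent ℂ (SmallQuantum.phiSum p) ∧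
      Submodule.span ℂ (Set.range (SmallQuantum.phiSum p)) = SmallQuantum.higman p ∧
      ∀ r : Fin (p.h + 1),
        SmallQuantum.phiSum p r = ∑ j, SmallQuantum.sMatrix p j r • SmallQuantum.nu p j := by
  intro p
  exact ⟨SmallQuantum.drinfeldImage_le_center p, SmallQuantum.radfordImage_le_center p,
    SmallQuantum.drinfeldImage_inf_radfordImage p, (SmallQuantum.linearIndependent_nu_and_span p).1,
    (SmallQuantum.linearIndependent_nu_and_span p).2, SmallQuantum.linearIndependent_phiSum p,
    SmallQuantum.span_phiSum p, SmallQuantum.phiSum_eq_sum p⟩
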